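/- All graphs are finite and simple. For graphs $G,H$ let $\overline{G}$ denote the complement, $G+H$ the disjoint union, $nG$ the disjoint union of $n$ copies of $G$, and $G\oplus H=\overline{\overline{G}+\overline{H}}$ the join. For nonnegative integers $s,k$, a graph $G$ is $(s,k)$-polar if its vertex set has a partition $(A,B)$ such that $G[A]$ is complete multipartite with at most $s$ parts and $G[B]$ is the complement of a complete multipartite graph with at most $k$ parts (i.e. a disjoint union of at most $k$ complete graphs); parts of a partition may be empty. $G$ is a minimal $(s,k)$-polar obstruction if $G$ is not $(s,k)$-polar but every proper induced subgraph of $G$ is. $G$ is $P_4$-extendible if, for every vertex set $W$ inducing a $P_4$, there is at most one vertex $v\notin W$ which belongs to an induced $P_4$ of $G$ sharing vertices with $W$. Let $P$ (the banner) be the graph obtained from a $4$-cycle by attaching one pendant vertex to one of its vertices, and let $\mathcal{E}$ be the set of the seven graphs $$K_1+2K_2,\quad 2P_3,\quad C_4+2K_1,\quad K_1+\overline{P_3+K_2},\quad K_1+C_5,\quad K_1+P,\quad K_1+\overline{P_5}.$$ **Theorem.** Let $s\ge 2$ be an integer and let $G$ be a $P_4$-extendible graph. Then $G$ is a minimal $(s,1)$-polar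 obstruction if and only if $G$ satisfies exactly one of the following assertions: 1. $G$ is isomorphic to one of the seven graphs in $\mathcal{E}$. 2. $G$ is isomorphic to one of $2K_{s+1}$, $K_2+(K_s\oplus 2K_1)$, $K_1+(K_{s-1}\oplus C_4)$. 3. The complement of $G$ is disconnected with components $G_1,\dots,G_t$, and there are nonnegative integers $s_1,\dots,s_t$ such that each $G_i$ is a minimal $(1,s_i)$-polar obstruction whose complement is isomorphic to none of the graphs in $\mathcal{E}$, and $s=t-1+\sum_{i=1}^t s_i$. -/

import Mathlib

namespace PolarGraph

/-- The complete graph on `n` vertices. -/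
abbrev K (n : ℕ) : SimpleGraph (Fin n) := ⊤

/-- The join of two graphs, i.e. the complement of the disjoint union of the complements. -/
def join {V W : Type*} (G : SimpleGraph V) (H : SimpleGraph W) : SimpleGraph (V ⊕ W) :=
  (Gᶜ ⊕g Hᶜ)ᶜ

/-- `G` is complete multipartite with at most `s` parts: the vertices can be labelled by `s`
labels so that two vertices are adjacent exactly when their labels differ
(labels that are not used correspond to missing parts). -/
def IsCompletePartite {V : Type*} (G : SimpleGraph V) (s : ℕ) : Prop :=
  ∃ f : V → Fin s, ∀ u v, G.Adj u v ↔ f u ≠ f v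

/-- `G` is a `k`-cluster: its complement is complete multipartite with at most `k` parts. -/
def IsCluster {V : Type*} (G : SimpleGraph V) (k : ℕ) : Prop :=
  IsCompletePartite Gᶜ k

/-- `(A, Aᶜ)` is an `(s, k)`-polar partition of `G`. -/
def IsPolarPartition {V : Type*} (G : SimpleGraph V) (s k : ℕ) (A : Set V) : Prop :=
  IsCompletePartite (G.induce A) s ∧ IsCluster (G.induce Aᶜ) k

/-- `G` is an `(s, k)`-polar graph. -/
def IsPolar {V : Type*} (G : SimpleGraph V) (s k : ℕ) : Prop :=
  ∃ A : Set V, IsPolarPartition G s k A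

/-- `G` is a minimal `(s, k)`-polar obstruction: it is not `(s, k)`-polar, but all its proper
induced subgraphs are. -/
def IsMinimalPolarObstruction {V : Type*} (G : SimpleGraph V) (s k : ℕ) : Prop :=
  ¬ IsPolar G s k ∧ ∀ U : Set V, U ≠ Set.univ → IsPolar (G.induce U) s k

/-- The vertex set `W` induces a path on four vertices in `G`. -/
def InducesP4 {V : Type*} (G : SimpleGraph V) (W : Set V) : Prop :=
  Nonempty (G.induce W ≃g SimpleGraph.pathGraph 4)

/-- The vertices outside `W` which belong to an induced `P₄` sharing vertices with `W`. -/
def extensionVertices {V : Type*} (G : SimpleGraph V) (W : Set V) : Set V :=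
  {x | x ∉ W ∧ ∃ W' : Set V, InducesP4 G W' ∧ x ∈ W' ∧ (W ∩ W').Nonempty}

/-- `G` is `P₄`-extendible: for every set `W` inducing a `P₄` there is at most one vertex outside
`W` which belongs to an induced `P₄` sharing vertices with `W`. -/
def IsP4Extendible {V : Type*} (G : SimpleGraph V) : Prop :=
  ∀ W : Set V, InducesP4 G W → (extensionVertices G W).Subsingleton

/-- The graph `P` (banner): a four-cycle `0, 1, 2, 3` with a pendant vertex `4` attached to `2`. -/
def banner : SimpleGraph (Fin 5) :=
  SimpleGraph.fromEdgeSet {s(0, 1), s(1, 2), s(2, 3), s(3, 0), s(2, 4)}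

/-- `G` is isomorphic to one of the seven graphs `K₁ + 2K₂`, `2P₃`, `C₄ + 2K₁`,
`K₁ + (P₃ + K₂)ᶜ`, `K₁ + C₅`, `K₁ + P`, `K₁ + P₅ᶜ`. -/
def IsEssential {V : Type*} (G : SimpleGraph V) : Prop :=
  Nonempty (G ≃g K 1 ⊕g (K 2 ⊕g K 2)) ∨
  Nonempty (G ≃g SimpleGraph.pathGraph 3 ⊕g SimpleGraph.pathGraph 3) ∨
  Nonempty (G ≃g SimpleGraph.cycleGraph 4 ⊕g (K 1 ⊕g K 1)) ∨
  Nonempty (G ≃g K 1 ⊕g (SimpleGraph.pathGraph 3 ⊕g K 2)ᶜ) ∨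
  Nonempty (G ≃g K 1 ⊕g SimpleGraph.cycleGraph 5) ∨
  Nonempty (G ≃g K 1 ⊕g banner) ∨
  Nonempty (G ≃g K 1 ⊕g (SimpleGraph.pathGraph 5)ᶜ)

/-- `G` is isomorphic to `2K_{s+1}`, to `K₂ + (K_s ⊕ 2K₁)` or to `K₁ + (K_{s-1} ⊕ C₄)`, where `⊕`
is the join. -/
def IsSpecialDisconnected {V : Type*} (G : SimpleGraph V) (s : ℕ) : Prop :=
  Nonempty (G ≃g K (s + 1) ⊕g K (s + 1)) ∨
  Nonempty (G ≃g K 2 ⊕g join (K s) (K 1 ⊕g K 1)) ∨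
  Nonempty (G ≃g K 1 ⊕g join (K (s - 1)) (SimpleGraph.cycleGraph 4))

/-- The complement of `G` is disconnected with components `G₁, …, G_t` such that, for some
nonnegative integers `s₁, …, s_t`, each `G_i` is a minimal `(1, s_i)`-polar obstruction whose
complement is none of the seven graphs of `IsEssential`, and `s = t - 1 + ∑ s_i`
(`t ≥ 2` holds automatically, as the complement is disconnected). -/
def IsRecursiveJoin {V : Type*} (G : SimpleGraph V) (s : ℕ) : Prop :=
  ¬ Gᶜ.Preconnected ∧
  ∃ (t : ℕ) (C : Fin t ≃ Gᶜ.ConnectedComponent) (r : Fin t → ℕ),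
    (∀ i, IsMinimalPolarObstruction (C i).toSimpleGraph 1 (r i) ∧
      ¬ IsEssential ((C i).toSimpleGraph)ᶜ) ∧
    s = (t - 1) + ∑ i, r i

/-- Exactly one of three propositions holds. -/
def ExactlyOne (a b c : Prop) : Prop :=
  (a ∧ ¬ b ∧ ¬ c) ∨ (¬ a ∧ b ∧ ¬ c) ∨ (¬ a ∧ ¬ b ∧ c)

end PolarGraph

namespace PolarGraph

-- The proof splits according to whether `G` and its complement are connected.
--
-- If both are connected and there are at least two vertices, `P₄`-extendibility forces a rigid
-- shape (`IsP4Extendible.exists_hull_eq_univ`): an induced path `a b c d`, at most one extension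
-- vertex, and vertices which on the path see exactly `b` and `c`. Such a graph has an `(s,
-- 1)`-polar partition as soon as `s ≥ 2` and its vertex-deleted subgraphs are polar and two of the
-- seven graphs are excluded (`IsP4Extendible.polarOn_of_hull_eq_univ`), so no minimal obstruction
-- arises here.
--
-- If `G` is disconnected, note that none of the ten listed graphs is `(s, 1)`-polar. A minimal
-- obstruction different from all of them therefore contains none of them as an induced subgraph,
-- and these exclusions force a polar partition
-- (`IsMinimalPolarObstruction.isEssential_or_isSpecialDisconnected`).
--
-- If the complement is disconnected, `G` is a join. The clique sides of the factors unite to a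
-- clique and their multipartite parts add up, so the least number of parts is additive
-- (`polarOn_iff_of_join`). A minimal obstruction is then a join of minimal `(r i, 1)`-obstructions
-- with `∑ (r i + 1) = s + 1`, provided that each factor becomes polar with one more part. This
-- holds for all minimal obstructions except the seven essential graphs, which are polar for no
-- number of parts (`IsMinimalPolarObstruction.isPolar_succ`, by induction on the order); hence
-- their exclusion in the third assertion.

universe u v w

variable {V : Type u} {W : Type v}

open SimpleGraph

/-! ### Polarity of vertex subsets and minimal obstructions -/

/-- The subgraph of `G` induced by `U` is `(s, 1)`-polar, in terms of labels on the vertices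
of `G`. -/
def PolarOn (G : SimpleGraph V) (U : Set V) (s : ℕ) : Prop :=
  ∃ A : Set V, (∃ f : V → ℕ, (∀ u ∈ U, u ∈ A → f u < s) ∧
    ∀ u ∈ U, u ∈ A → ∀ v ∈ U, v ∈ A → (G.Adj u v ↔ f u ≠ f v)) ∧
    ∀ u ∈ U, u ∉ A → ∀ v ∈ U, v ∉ A → u ≠ v → G.Adj u v

theorem PolarOn.mono {G : SimpleGraph V} {U U' : Set V} {s s' : ℕ} (h : PolarOn G U s)
    (hU : U' ⊆ U) (hs : s ≤ s') : PolarOn G U' s' := by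
  obtain ⟨A, ⟨f, h1, h2⟩, h3⟩ := h
  exact ⟨A, ⟨f, fun u hu hA => (h1 u (hU hu) hA).trans_le hs,
    fun u hu hA v hv hB => h2 u (hU hu) hA v (hU hv) hB⟩,
    fun u hu hA v hv hB => h3 u (hU hu) hA v (hU hv) hB⟩

/-- Only the number of labels matters, so they may come from any type and are renumbered by
`L.equivFin`. The default `0` is never seen on `U ∩ A`. -/
theorem PolarOn.of_labels {G : SimpleGraph V} {U : Set V} {s : ℕ} (A : Set V) {ι : Type w}
    (f : V → ι) (L : Finset ι) (hL : L.card ≤ s) (hf : ∀ u ∈ U, u ∈ A → f u ∈ L)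
    (hA : ∀ u ∈ U, u ∈ A → ∀ v ∈ U, v ∈ A → (G.Adj u v ↔ f u ≠ f v))
    (hB : ∀ u ∈ U, u ∉ A → ∀ v ∈ U, v ∉ A → u ≠ v → G.Adj u v) : PolarOn G U s := by
  classical
  refine ⟨A, ⟨fun u => if h : f u ∈ L then (L.equivFin ⟨f u, h⟩ : ℕ) else 0, ?_, ?_⟩, hB⟩
  · intro u hu huA
    simp only [hf u hu huA, dif_pos]
    exact (L.equivFin _).2.trans_le hL
  · intro u hu huA v hv hvA
    rw [hA u hu huA v hv hvA]
    simp only [hf u hu huA, hf v hv hvA, dif_pos]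
    rw [Ne, Ne, Fin.val_inj, EmbeddingLike.apply_eq_iff_eq, Subtype.mk.injEq]

/-- With labels on the ambient vertices, polarity of different subsets can be compared without
moving between nested subtypes. -/
theorem isPolar_induce_iff {G : SimpleGraph V} {U : Set V} {s : ℕ} :
    IsPolar (G.induce U) s 1 ↔ PolarOn G U s := by
  classical
  constructor
  · rintro ⟨A, ⟨f, hf⟩, ⟨g, hg⟩⟩
    refine ⟨(↑) '' A, ⟨fun u => if h : ∃ hu : u ∈ U, (⟨u, hu⟩ : U) ∈ A then
      (f ⟨⟨u, h.1⟩, h.2⟩ : ℕ) else 0, ?_, ?_⟩, ?_⟩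
    · rintro _ - ⟨u, hu, rfl⟩
      have h : ∃ hu : (u : V) ∈ U, (⟨u, hu⟩ : U) ∈ A := ⟨u.2, hu⟩
      simp only [h, dif_pos]
      exact (f _).2
    · rintro _ - ⟨u, hu, rfl⟩ _ - ⟨v, hv, rfl⟩
      have h : ∃ hu : (u : V) ∈ U, (⟨u, hu⟩ : U) ∈ A := ⟨u.2, hu⟩
      have h' : ∃ hu : (v : V) ∈ U, (⟨v, hu⟩ : U) ∈ A := ⟨v.2, hv⟩
      simp only [h, h', dif_pos]
      rw [Ne, Fin.val_inj]
      exact hf ⟨u, hu⟩ ⟨v, hv⟩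
    · intro u hu hA v hv hB huv
      have hu' : (⟨u, hu⟩ : U) ∈ Aᶜ := fun h => hA ⟨_, h, rfl⟩
      have hv' : (⟨v, hv⟩ : U) ∈ Aᶜ := fun h => hB ⟨_, h, rfl⟩
      by_contra hn
      have := (hg ⟨_, hu'⟩ ⟨_, hv'⟩).1 (by
        simp only [SimpleGraph.compl_adj]
        exact ⟨fun h => huv (by simpa using h), hn⟩)
      exact this (Subsingleton.elim _ _)
  · rintro ⟨A, ⟨f, h1, h2⟩, h3⟩
    refine ⟨{u | (u : V) ∈ A}, ⟨fun u => ⟨f u.1, h1 _ u.1.2 u.2⟩, ?_⟩, ⟨fun _ => 0, ?_⟩⟩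
    · intro u v
      rw [Ne, Fin.mk.injEq]
      exact h2 _ u.1.2 u.2 _ v.1.2 v.2
    · intro u v
      simp only [SimpleGraph.compl_adj, ne_eq, not_true_eq_false, iff_false, not_and, not_not]
      intro huv
      exact h3 _ u.1.2 u.2 _ v.1.2 v.2 fun h => huv (Subtype.ext (Subtype.ext h))

theorem IsPolar.of_embedding {G : SimpleGraph V} {H : SimpleGraph W} {s k : ℕ}
    (h : IsPolar G s k) (φ : H ↪g G) : IsPolar H s k := by
  obtain ⟨A, ⟨f, hf⟩, ⟨g, hg⟩⟩ := h
  refine ⟨φ ⁻¹' A, ⟨fun u => f ⟨φ u, u.2⟩, fun u v => ?_⟩, ⟨fun u => g ⟨φ u, u.2⟩, fun u v => ?_⟩⟩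
  · rw [← hf]
    exact φ.map_adj_iff.symm
  · rw [← hg]
    simp only [SimpleGraph.compl_adj, SimpleGraph.comap_adj, Function.Embedding.subtype_apply,
      SimpleGraph.Embedding.map_adj_iff]
    simp only [ne_eq, Subtype.ext_iff, EmbeddingLike.apply_eq_iff_eq]

theorem isPolar_iff {G : SimpleGraph V} {s : ℕ} : IsPolar G s 1 ↔ PolarOn G Set.univ s := by
  rw [← isPolar_induce_iff]
  exact ⟨fun h => h.of_embedding (SimpleGraph.induceUnivIso G).toEmbedding,
    fun h => h.of_embedding (SimpleGraph.induceUnivIso G).symm.toEmbedding⟩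

/-- Polarity passes to induced subgraphs, so only deletions of one vertex have to be tested. -/
theorem isMinimalPolarObstruction_iff {G : SimpleGraph V} {s : ℕ} :
    IsMinimalPolarObstruction G s 1 ↔
      ¬ PolarOn G Set.univ s ∧ ∀ v, PolarOn G {v}ᶜ s := by
  unfold IsMinimalPolarObstruction
  rw [isPolar_iff]
  refine and_congr_right fun _ => ⟨fun h v => ?_, fun h U hU => ?_⟩
  · exact isPolar_induce_iff.1 (h _ (by simp))
  · obtain ⟨v, hv⟩ := (Set.ne_univ_iff_exists_notMem U).1 hU
    exact isPolar_induce_iff.2 ((h v).mono (by rintro x hx rfl; exact hv hx) le_rfl)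

/-- A non-polar induced subgraph cannot be proper. This is how the listed graphs are excluded from
any other obstruction. -/
theorem IsMinimalPolarObstruction.surjective {G : SimpleGraph V} {H : SimpleGraph W} {s k : ℕ}
    (hG : IsMinimalPolarObstruction G s k) (φ : H ↪g G) (hH : ¬ IsPolar H s k) :
    Function.Surjective φ := by
  rw [← Set.range_eq_univ]
  by_contra h
  exact hH ((hG.2 _ h).of_embedding
    ⟨⟨fun x => ⟨φ x, x, rfl⟩, fun x y h => φ.injective (congrArg Subtype.val h)⟩,
      φ.map_adj_iff⟩)

theorem IsMinimalPolarObstruction.nonempty_iso {G : SimpleGraph V} {H : SimpleGraph W} {s k : ℕ}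
    (hG : IsMinimalPolarObstruction G s k) (φ : H ↪g G) (hH : ¬ IsPolar H s k) :
    Nonempty (G ≃g H) :=
  ⟨(RelIso.ofSurjective φ (hG.surjective φ hH)).symm⟩

theorem IsMinimalPolarObstruction.of_iso {G : SimpleGraph V} {H : SimpleGraph W} {s k : ℕ}
    (hG : IsMinimalPolarObstruction G s k) (e : G ≃g H) : IsMinimalPolarObstruction H s k := by
  refine ⟨fun h => hG.1 (h.of_embedding e.toEmbedding), fun U hU => ?_⟩
  refine (hG.2 (e ⁻¹' U) fun h => hU ?_).of_embedding
    ⟨⟨fun x => ⟨e.symm x, by simp⟩, fun x y h => ?_⟩, ?_⟩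
  · rw [← Set.image_preimage_eq U e.surjective, h, Set.image_univ, e.surjective.range_eq]
  · simpa [Subtype.ext_iff] using h
  · intro x y
    exact e.symm.map_adj_iff

theorem isPolar_compl {G : SimpleGraph V} {s k : ℕ} (h : IsPolar G s k) : IsPolar Gᶜ k s := by
  obtain ⟨A, ⟨f, hf⟩, hB⟩ := h
  have key : ∀ U : Set V, Gᶜ.induce U = (G.induce U)ᶜ := by
    intro U
    ext x y
    simp [Subtype.ext_iff]
  refine ⟨Aᶜ, ?_, ?_⟩
  · rw [key]
    exact hB
  · unfold IsCluster
    rw [key, compl_compl, compl_compl]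
    exact ⟨f, hf⟩

theorem IsMinimalPolarObstruction.compl {G : SimpleGraph V} {s k : ℕ}
    (h : IsMinimalPolarObstruction G s k) : IsMinimalPolarObstruction Gᶜ k s := by
  refine ⟨fun h' => h.1 (by simpa using isPolar_compl h'), fun U hU => ?_⟩
  have key : Gᶜ.induce U = (G.induce U)ᶜ := by
    ext x y
    simp [Subtype.ext_iff]
  rw [key]
  exact isPolar_compl (h.2 U hU)

/-! ### Small induced subgraphs and split graphs -/

/-- `a b`, `c d` are the edges of an induced `2K₂`. -/
structure IsTwoK2 (G : SimpleGraph V) (a b c d : V) : Prop where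
  ab : G.Adj a b
  cd : G.Adj c d
  ac : ¬ G.Adj a c
  ad : ¬ G.Adj a d
  bc : ¬ G.Adj b c
  bd : ¬ G.Adj b d

/-- `a, b, c, d` is an induced four-cycle. -/
structure IsC4 (G : SimpleGraph V) (a b c d : V) : Prop where
  ab : G.Adj a b
  bc : G.Adj b c
  cd : G.Adj c d
  da : G.Adj d a
  ac : ¬ G.Adj a c
  bd : ¬ G.Adj b d
  ac_ne : a ≠ c
  bd_ne : b ≠ d

/-- `a, b, c, d, e` is an induced five-cycle. -/
structure IsC5 (G : SimpleGraph V) (a b c d e : V) : Prop where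
  ab : G.Adj a b
  bc : G.Adj b c
  cd : G.Adj c d
  de : G.Adj d e
  ea : G.Adj e a
  ac : ¬ G.Adj a c
  bd : ¬ G.Adj b d
  ce : ¬ G.Adj c e
  da : ¬ G.Adj d a
  eb : ¬ G.Adj e b

/-- `a, b, c, d` is an induced path. -/
structure IsP4 (G : SimpleGraph V) (a b c d : V) : Prop where
  ab : G.Adj a b
  bc : G.Adj b c
  cd : G.Adj c d
  ac : ¬ G.Adj a c
  ad : ¬ G.Adj a d
  bd : ¬ G.Adj b d

theorem IsP4.compl {G : SimpleGraph V} {a b c d : V} (h : IsP4 G a b c d) :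
    IsP4 Gᶜ b d a c := by
  obtain ⟨h1, h2, h3, h4, h5, h6⟩ := h
  constructor <;> simp only [SimpleGraph.compl_adj] <;> grind [SimpleGraph.Adj.symm]

/-- Every graph is split unless it contains `2K₂`, `C₄` or `C₅` (Földes and Hammer). -/
theorem exists_split [Finite V] (G : SimpleGraph V)
    (h1 : ∀ a b c d, ¬ IsTwoK2 G a b c d) (h2 : ∀ a b c d, ¬ IsC4 G a b c d)
    (h3 : ∀ a b c d e, ¬ IsC5 G a b c d e) :
    ∃ K : Set V, (∀ x ∈ K, ∀ y ∈ K, x ≠ y → G.Adj x y) ∧ ∀ x ∉ K, ∀ y ∉ K, ¬ G.Adj x y := by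
  classical
  have := Fintype.ofFinite V
  let Q : Finset (Finset V) := Finset.univ.filter fun K => ∀ x ∈ K, ∀ y ∈ K, x ≠ y → G.Adj x y
  have hQ : ∀ K, K ∈ Q ↔ ∀ x ∈ K, ∀ y ∈ K, x ≠ y → G.Adj x y := fun K => by simp [Q]
  -- The clique has maximum size and, among those, maximum degree sum; the second condition controls
  -- exchanges of one vertex.
  obtain ⟨K₁, hK₁, hmax₁⟩ := Q.exists_max_image Finset.card ⟨∅, by simp [hQ]⟩
  obtain ⟨K, hK', hmax₂⟩ := (Q.filter fun K => K.card = K₁.card).exists_max_image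
    (fun K => ∑ x ∈ K, G.degree x) ⟨K₁, by simp [hK₁]⟩
  obtain ⟨hK, hcard⟩ := Finset.mem_filter.1 hK'
  rw [hQ] at hK
  have hmax : ∀ K' ∈ Q, K'.card ≤ K.card := fun K' h => hcard ▸ hmax₁ K' h
  have hdeg : ∀ K' ∈ Q, K'.card = K.card → ∑ x ∈ K', G.degree x ≤ ∑ x ∈ K, G.degree x :=
    fun K' h h' => hmax₂ K' (Finset.mem_filter.2 ⟨h, h'.trans hcard⟩)
  refine ⟨K, fun x hx y hy => hK x hx y hy, ?_⟩
  -- every outer vertex has a non-neighbour in the clique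
  have hnon : ∀ x ∉ K, ∃ p ∈ K, ¬ G.Adj x p := by
    intro x hx
    by_contra! hc
    have := hmax (insert x K) (by
      rw [hQ]
      simp only [Finset.mem_insert]
      rintro a (rfl | ha) b (rfl | hb) hab
      · exact absurd rfl hab
      · exact hc b hb
      · exact (hc a ha).symm
      · exact hK a ha b hb hab)
    rw [Finset.card_insert_of_notMem hx] at this
    omega
  -- For an outer edge `xy` with nested non-neighbourhoods, `x` misses a single `p ∈ K`. Exchanging
  -- `p` for `x` gives `deg x ≤ deg p`, so `p` has a neighbour `z` missed by `x`, which closes a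
  -- `C₄` or `C₅`.
  have main : ∀ x ∉ K, ∀ y ∉ K, G.Adj x y → ¬ (∀ p ∈ K, ¬ G.Adj x p → ¬ G.Adj y p) := by
    intro x hx y hy hxy hsub
    obtain ⟨p, hp, hxp⟩ := hnon x hx
    have hyp := hsub p hp hxp
    have huniq : ∀ q ∈ K, q ≠ p → G.Adj x q := by
      intro q hq hqp
      by_contra hxq
      exact h1 x y p q ⟨hxy, hK p hp q hq hqp.symm, hxp, hxq, hyp, hsub q hq hxq⟩
    have hxp' : x ≠ p := by rintro rfl; exact hx hp
    have hyp' : y ≠ p := by rintro rfl; exact hy hp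
    have hxe : x ∉ K.erase p := fun h => hx (Finset.mem_of_mem_erase h)
    obtain ⟨q, hq, hqp, hyq⟩ : ∃ q ∈ K, q ≠ p ∧ ¬ G.Adj y q := by
      by_contra! hc
      have := hmax (insert y (insert x (K.erase p))) (by
        rw [hQ]
        simp only [Finset.mem_insert, Finset.mem_erase]
        rintro a (rfl | rfl | ⟨hap, ha⟩) b (rfl | rfl | ⟨hbp, hb⟩) hab
        · exact absurd rfl hab
        · exact hxy.symm
        · exact hc b hb hbp
        · exact hxy
        · exact absurd rfl hab
        · exact huniq b hb hbp
        · exact (hc a ha hap).symm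
        · exact (huniq a ha hap).symm
        · exact hK a ha b hb hab)
      rw [Finset.card_insert_of_notMem, Finset.card_insert_of_notMem hxe,
        Finset.card_erase_of_mem hp] at this
      · have := Finset.card_pos.2 ⟨p, hp⟩
        omega
      · simp [hxy.ne', hy]
    have hle : G.degree x ≤ G.degree p := by
      have := hdeg (insert x (K.erase p)) (by
        rw [hQ]
        simp only [Finset.mem_insert, Finset.mem_erase]
        rintro a (rfl | ⟨hap, ha⟩) b (rfl | ⟨hbp, hb⟩) hab
        · exact absurd rfl hab
        · exact huniq b hb hbp
        · exact (huniq a ha hap).symm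
        · exact hK a ha b hb hab) (by
        rw [Finset.card_insert_of_notMem hxe, Finset.card_erase_of_mem hp]
        have := Finset.card_pos.2 ⟨p, hp⟩
        omega)
      rw [Finset.sum_insert hxe, ← Finset.add_sum_erase K _ hp] at this
      omega
    obtain ⟨z, hpz, hxz⟩ : ∃ z, G.Adj p z ∧ ¬ G.Adj x z := by
      by_contra! hc
      have hss : G.neighborFinset p ⊂ G.neighborFinset x := by
        refine Finset.ssubset_iff_subset_ne.2 ⟨fun z hz => ?_, fun h => ?_⟩
        · simpa using hc z (by simpa using hz)
        · have : y ∈ G.neighborFinset p := by simpa [h] using hxy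
          exact hyp (by simpa using this : G.Adj p y).symm
      have := Finset.card_lt_card hss
      simp only [SimpleGraph.card_neighborFinset_eq_degree] at this
      omega
    have hyz : G.Adj y z := by
      by_contra hyz
      exact h1 x y p z ⟨hxy, hpz, hxp, hxz, hyp, hyz⟩
    have hxq := huniq q hq hqp
    have hqp2 := hK q hq p hp hqp
    have hyq' : y ≠ q := by rintro rfl; exact hy hq
    by_cases hzq : G.Adj z q
    · exact h2 x y z q ⟨hxy, hyz, hzq, hxq.symm, hxz, hyq,
        by rintro rfl; exact hxp hpz.symm, hyq'⟩
    · exact h3 x q p z y ⟨hxq, hqp2, hpz, hyz.symm, hxy.symm, hxp, fun h => hzq h.symm,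
        fun h => hyp h.symm, fun h => hxz h.symm, hyq⟩
  intro x hx y hy hxy
  -- If the non-neighbourhoods are incomparable, witnesses `p` and `q` complete the edge `xy` to a
  -- `C₄`.
  by_cases hs : ∀ p ∈ K, ¬ G.Adj x p → ¬ G.Adj y p
  · exact main x hx y hy hxy hs
  · by_cases hs' : ∀ p ∈ K, ¬ G.Adj y p → ¬ G.Adj x p
    · exact main y hy x hx hxy.symm hs'
    · push Not at hs hs'
      obtain ⟨p, hp, hxp, hyp⟩ := hs
      obtain ⟨q, hq, hyq, hxq⟩ := hs'
      have hpq : p ≠ q := by rintro rfl; exact hxp hxq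
      exact h2 x y p q ⟨hxy, hyp, hK p hp q hq hpq, hxq.symm, hxp, hyq,
        by rintro rfl; exact hx hp, by rintro rfl; exact hy hq⟩

/-! ### Cuts and Seinsche's theorem -/

/-- The vertex set `U` has a partition into two nonempty parts without edges between them. -/
def HasCut (G : SimpleGraph V) (U : Set V) : Prop :=
  ∃ S ⊆ U, S.Nonempty ∧ (U \ S).Nonempty ∧ ∀ x ∈ S, ∀ y ∈ U, y ∉ S → ¬ G.Adj x y

theorem not_preconnected_iff {G : SimpleGraph V} :
    ¬ G.Preconnected ↔ HasCut G Set.univ := by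
  constructor
  · intro h
    unfold SimpleGraph.Preconnected at h
    push Not at h
    obtain ⟨u, v, huv⟩ := h
    refine ⟨{x | G.Reachable u x}, Set.subset_univ _, ⟨u, SimpleGraph.Reachable.refl _⟩,
      ⟨v, trivial, huv⟩, fun x hx y _ hy hxy => hy ?_⟩
    exact SimpleGraph.Reachable.trans hx hxy.reachable
  · rintro ⟨S, -, ⟨u, hu⟩, ⟨v, -, hv⟩, h⟩ hc
    obtain ⟨p⟩ := hc u v
    induction p with
    | nil => exact hv hu
    | @cons a b c hab p ih =>
      by_cases hb : b ∈ S
      · exact ih hb hv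
      · exact h a hu b trivial hb hab

/-- The induction step of Seinsche's theorem: a vertex joined to all of `U` disconnects the
complement, and in every other case a cut survives. -/
theorem HasCut.insert_of_isP4_free {G : SimpleGraph V} (hG : ∀ a b c d, ¬ IsP4 G a b c d)
    {U : Set V} {v : V} (hv : v ∉ U) (h : HasCut G U) :
    HasCut G (insert v U) ∨ HasCut Gᶜ (insert v U) := by
  -- The non-neighbours of `v` in `S` are cut off: an edge from such a `y` to a neighbour `x ∈ S` of
  -- `v` would make `y x v z` an induced path.
  have key : ∀ S ⊆ U, S.Nonempty → (U \ S).Nonempty →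
      (∀ x ∈ S, ∀ y ∈ U, y ∉ S → ¬ G.Adj x y) → (∃ u ∈ S, ¬ G.Adj v u) →
      (∃ z ∈ U, z ∉ S ∧ G.Adj v z) → HasCut G (insert v U) := by
    rintro S hSU - - hS ⟨u, hu, hvu⟩ ⟨z, hz, hzS, hvz⟩
    refine ⟨{x ∈ S | ¬ G.Adj v x}, fun x hx => Or.inr (hSU hx.1), ⟨u, hu, hvu⟩,
      ⟨v, Or.inl rfl, fun h => hv (hSU h.1)⟩, ?_⟩
    rintro y ⟨hy, hvy⟩ x (rfl | hx) hx'
    · exact fun h => hvy h.symm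
    · by_cases hxS : x ∈ S
      · have hvx : G.Adj v x := by
          by_contra hc
          exact hx' ⟨hxS, hc⟩
        intro hyx
        exact hG y x v z ⟨hyx, hvx.symm, hvz, fun h => hvy h.symm, hS y hy z hz hzS,
          hS x hxS z hz hzS⟩
      · exact hS y hy x hx hxS
  obtain ⟨S, hSU, hne, hne', hS⟩ := h
  by_cases hall : ∀ u ∈ U, G.Adj v u
  · right
    refine ⟨{v}, by simp, by simp, ?_, ?_⟩
    · obtain ⟨u, hu⟩ := hne
      exact ⟨u, Or.inr (hSU hu), by rintro rfl; exact hv (hSU hu)⟩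
    · rintro x rfl y (rfl | hy) hne
      · exact absurd rfl hne
      · simpa [hne] using fun _ => hall y hy
  left
  by_cases hSv : ∀ z ∈ U, z ∉ S → ¬ G.Adj v z
  · refine ⟨U \ S, fun x hx => Or.inr hx.1, hne', ⟨v, Or.inl rfl, fun h => hv h.1⟩, ?_⟩
    rintro x ⟨hx, hxS⟩ y (rfl | hy) hy'
    · exact fun h => hSv x hx hxS h.symm
    · have : y ∈ S := by
        by_contra hc
        exact hy' ⟨hy, hc⟩
      exact fun h => hS y this x hx hxS h.symm
  by_cases hSv' : ∀ z ∈ S, ¬ G.Adj v z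
  · refine ⟨S, fun x hx => Or.inr (hSU hx), hne, ⟨v, Or.inl rfl, fun h => hv (hSU h)⟩, ?_⟩
    rintro x hx y (rfl | hy) hy'
    · exact fun h => hSv' x hx h.symm
    · exact hS x hx y hy hy'
  push Not at hall hSv hSv'
  obtain ⟨u, hu, hvu⟩ := hall
  obtain ⟨z, hz, hvz⟩ := hSv'
  by_cases huS : u ∈ S
  · exact key S hSU hne hne' hS ⟨u, huS, hvu⟩ hSv
  · refine key (U \ S) Set.sdiff_subset hne' ?_ ?_ ⟨u, ⟨hu, huS⟩, hvu⟩
      ⟨z, hSU hz, fun h => h.2 hz, hvz⟩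
    · rwa [Set.sdiff_sdiff_cancel_left hSU]
    · rintro x ⟨hx, hxS⟩ y hy hy'
      have : y ∈ S := by
        by_contra hc
        exact hy' ⟨hy, hc⟩
      exact fun h => hS y this x hx hxS h.symm

/-- A graph with at least two vertices which is connected and has a connected complement contains
an induced `P₄` (Seinsche). -/
theorem exists_isP4 [Finite V] [Nontrivial V] {G : SimpleGraph V} (h1 : G.Preconnected)
    (h2 : Gᶜ.Preconnected) : ∃ a b c d, IsP4 G a b c d := by
  classical
  have := Fintype.ofFinite V
  by_contra! hG
  have hG' : ∀ a b c d, ¬ IsP4 Gᶜ a b c d := fun a b c d h =>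
    hG b d a c (by simpa using h.compl)
  have key : ∀ U : Finset V, 2 ≤ U.card → HasCut G (U : Set V) ∨ HasCut Gᶜ (U : Set V) := by
    intro U
    induction U using Finset.induction_on with
    | empty => intro h; simp at h
    | insert v U hv ih =>
      intro hU
      rw [Finset.card_insert_of_notMem hv] at hU
      rw [Finset.coe_insert]
      rcases Nat.lt_or_ge U.card 2 with hlt | hge
      · obtain ⟨u, rfl⟩ := Finset.card_eq_one.1 (by omega : U.card = 1)
        have hvu : v ≠ u := by simpa using hv
        by_cases h : G.Adj v u
        · right
          refine ⟨{v}, by simp, by simp, ⟨u, by simp [hvu.symm]⟩, ?_⟩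
          rintro x rfl y hy hyx
          have : y = u := by simpa [show y ≠ x from hyx] using hy
          subst this
          simp [h]
        · left
          refine ⟨{v}, by simp, by simp, ⟨u, by simp [hvu.symm]⟩, ?_⟩
          rintro x rfl y hy hyx
          have : y = u := by simpa [show y ≠ x from hyx] using hy
          subst this
          exact h
      · rcases ih hge with h | h
        · exact h.insert_of_isP4_free hG (by simpa using hv)
        · have := h.insert_of_isP4_free hG' (v := v) (by simpa using hv)
          rw [compl_compl] at this
          exact this.symm
  rcases key Finset.univ (by
    rw [Finset.card_univ]; exact Fintype.one_lt_card) with h | h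
  · rw [Finset.coe_univ] at h
    exact not_preconnected_iff.2 h h1
  · rw [Finset.coe_univ] at h
    exact not_preconnected_iff.2 h h2

/-! ### The seven graphs that are polar for no number of parts -/

section Essential

instance : DecidableRel banner.Adj := fun _ _ => by unfold banner; infer_instance

instance (n : ℕ) : DecidableRel (pathGraph n).Adj :=
  fun _ _ => decidable_of_iff _ pathGraph_adj.symm

instance (G : SimpleGraph V) (H : SimpleGraph W) [DecidableRel G.Adj] [DecidableRel H.Adj] :
    DecidableRel (G ⊕g H).Adj
  | .inl a, .inl b => decidable_of_iff (G.Adj a b) (by simp)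
  | .inr a, .inr b => decidable_of_iff (H.Adj a b) (by simp)
  | .inl _, .inr _ => isFalse (by simp)
  | .inr _, .inl _ => isFalse (by simp)

/-- The first alternative is an induced `K₁ + K₂`, which no complete multipartite graph contains
whatever its number of parts. The condition is thus free of `s` and can be decided on a finite
graph. -/
theorem not_isPolar_of_forall_bool (H : SimpleGraph V)
    (h : ∀ A : V → Bool, (∃ u, A u = true ∧ ∃ v, A v = true ∧ ¬ H.Adj u v ∧
      ∃ w, A w = true ∧ H.Adj u w ∧ ¬ H.Adj v w) ∨
      ∃ u, A u = false ∧ ∃ v, A v = false ∧ u ≠ v ∧ ¬ H.Adj u v) (s : ℕ) : ¬ IsPolar H s 1 := by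
  classical
  rw [isPolar_iff]
  rintro ⟨A, ⟨f, -, hf⟩, hB⟩
  rcases h fun u => decide (u ∈ A) with ⟨u, hu, v, hv, huv, w, hw, huw, hvw⟩ | ⟨u, hu, v, hv, hne, huv⟩
  · simp only [decide_eq_true_eq] at hu hv hw
    rw [hf u trivial hu v trivial hv] at huv
    rw [hf u trivial hu w trivial hw] at huw
    rw [hf v trivial hv w trivial hw] at hvw
    push Not at huv hvw
    exact huw (huv.trans hvw)
  · simp only [decide_eq_false_iff_not] at hu hv
    exact huv (hB u trivial hu v trivial hv hne)

/-- The colouring `c v` encodes a partition of the graph without `v`: colours `0` and `1` are two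
multipartite parts, colour `2` is the clique. -/
theorem isMinimalPolarObstruction_of_coloring (H : SimpleGraph V) {s : ℕ} (hs : 2 ≤ s)
    (hH : ¬ IsPolar H s 1) (c : V → V → Fin 3)
    (hc : ∀ v u w, u ≠ v → w ≠ v → u ≠ w → (c v u = 2 ∧ c v w = 2 ∧ H.Adj u w) ∨
      (c v u ≠ 2 ∧ c v w = 2) ∨ (c v u = 2 ∧ c v w ≠ 2) ∨
      c v u ≠ 2 ∧ c v w ≠ 2 ∧ (H.Adj u w ↔ c v u ≠ c v w)) :
    IsMinimalPolarObstruction H s 1 := by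
  rw [isMinimalPolarObstruction_iff, ← isPolar_iff]
  refine ⟨hH, fun v => PolarOn.of_labels {u | c v u ≠ 2} (c v) {0, 1} hs ?_ ?_ ?_⟩
  · intro u _ hu
    simp only [Set.mem_ofPred_eq] at hu
    generalize c v u = i at hu
    fin_cases i <;> simp_all
  · intro u hu hA w hw hB
    by_cases huw : u = w
    · subst huw; simp
    · rcases hc v u w hu hw huw with h | h | h | h
      · exact absurd h.1 hA
      · exact absurd h.2 hB
      · exact absurd h.1 hA
      · exact h.2.2
  · intro u hu hA w hw hB huw
    simp only [Set.mem_ofPred_eq, not_not] at hA hB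
    rcases hc v u w hu hw huw with h | h | h | h
    · exact h.2.2
    · exact absurd hA h.1
    · exact absurd hB h.2
    · exact absurd hA h.1

set_option maxRecDepth 100000
set_option synthInstance.maxSize 1000
set_option synthInstance.maxHeartbeats 400000

theorem not_isPolar_K1_twoK2 (s : ℕ) : ¬ IsPolar (K 1 ⊕g (K 2 ⊕g K 2)) s 1 :=
  not_isPolar_of_forall_bool _ (by decide) s

theorem not_isPolar_twoP3 (s : ℕ) : ¬ IsPolar (pathGraph 3 ⊕g pathGraph 3) s 1 :=
  not_isPolar_of_forall_bool _ (by decide) s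

theorem not_isPolar_C4_twoK1 (s : ℕ) : ¬ IsPolar (cycleGraph 4 ⊕g (K 1 ⊕g K 1)) s 1 :=
  not_isPolar_of_forall_bool _ (by decide) s

theorem not_isPolar_K1_compl_P3_K2 (s : ℕ) : ¬ IsPolar (K 1 ⊕g (pathGraph 3 ⊕g K 2)ᶜ) s 1 :=
  not_isPolar_of_forall_bool _ (by decide) s

theorem not_isPolar_K1_C5 (s : ℕ) : ¬ IsPolar (K 1 ⊕g cycleGraph 5) s 1 :=
  not_isPolar_of_forall_bool _ (by decide) s

theorem not_isPolar_K1_banner (s : ℕ) : ¬ IsPolar (K 1 ⊕g banner) s 1 :=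
  not_isPolar_of_forall_bool _ (by decide) s

theorem not_isPolar_K1_compl_P5 (s : ℕ) : ¬ IsPolar (K 1 ⊕g (pathGraph 5)ᶜ) s 1 :=
  not_isPolar_of_forall_bool _ (by decide) s

theorem IsEssential.not_isPolar {G : SimpleGraph V} (hG : IsEssential G) (s : ℕ) :
    ¬ IsPolar G s 1 := by
  intro h
  rcases hG with ⟨⟨e⟩⟩ | ⟨⟨e⟩⟩ | ⟨⟨e⟩⟩ | ⟨⟨e⟩⟩ | ⟨⟨e⟩⟩ | ⟨⟨e⟩⟩ | ⟨⟨e⟩⟩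
  · exact not_isPolar_K1_twoK2 s (h.of_embedding e.symm.toEmbedding)
  · exact not_isPolar_twoP3 s (h.of_embedding e.symm.toEmbedding)
  · exact not_isPolar_C4_twoK1 s (h.of_embedding e.symm.toEmbedding)
  · exact not_isPolar_K1_compl_P3_K2 s (h.of_embedding e.symm.toEmbedding)
  · exact not_isPolar_K1_C5 s (h.of_embedding e.symm.toEmbedding)
  · exact not_isPolar_K1_banner s (h.of_embedding e.symm.toEmbedding)
  · exact not_isPolar_K1_compl_P5 s (h.of_embedding e.symm.toEmbedding)

theorem IsEssential.isMinimalPolarObstruction {G : SimpleGraph V} (hG : IsEssential G) {s : ℕ}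
    (hs : 2 ≤ s) : IsMinimalPolarObstruction G s 1 := by
  rcases hG with ⟨⟨e⟩⟩ | ⟨⟨e⟩⟩ | ⟨⟨e⟩⟩ | ⟨⟨e⟩⟩ | ⟨⟨e⟩⟩ | ⟨⟨e⟩⟩ | ⟨⟨e⟩⟩ <;>
    refine IsMinimalPolarObstruction.of_iso ?_ e.symm
  -- In this and the following tables the row is the deleted vertex and the column the coloured one;
  -- the diagonal is irrelevant.
  · exact isMinimalPolarObstruction_of_coloring _ hs (not_isPolar_K1_twoK2 s)
      (fun v u => (![![0, 0, 1, 2, 2], ![0, 0, 0, 0, 2], ![0, 0, 0, 0, 2], ![0, 0, 2, 0, 0],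
        ![0, 0, 2, 0, 0]] : Fin 5 → Fin 5 → Fin 3)
        (Sum.elim ![0] (Sum.elim ![1, 2] ![3, 4]) v)
        (Sum.elim ![0] (Sum.elim ![1, 2] ![3, 4]) u)) (by decide)
  · exact isMinimalPolarObstruction_of_coloring _ hs (not_isPolar_twoP3 s)
      (fun v u => (![![0, 2, 2, 0, 1, 0], ![0, 0, 0, 0, 2, 0], ![2, 2, 0, 0, 1, 0],
        ![0, 1, 0, 0, 2, 2], ![0, 2, 0, 0, 0, 0], ![0, 1, 0, 2, 2, 0]] : Fin 6 → Fin 6 → Fin 3)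
        (Sum.elim ![0, 1, 2] ![3, 4, 5] v) (Sum.elim ![0, 1, 2] ![3, 4, 5] u)) (by decide)
  · exact isMinimalPolarObstruction_of_coloring _ hs (not_isPolar_C4_twoK1 s)
      (fun v u => (![![0, 0, 2, 0, 0, 0], ![0, 0, 0, 2, 0, 0], ![2, 0, 0, 0, 0, 0],
        ![0, 2, 0, 0, 0, 0], ![0, 1, 0, 1, 0, 2], ![0, 1, 0, 1, 2, 0]] : Fin 6 → Fin 6 → Fin 3)
        (Sum.elim ![0, 1, 2, 3] (Sum.elim ![4] ![5]) v)
        (Sum.elim ![0, 1, 2, 3] (Sum.elim ![4] ![5]) u)) (by decide)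
  · exact isMinimalPolarObstruction_of_coloring _ hs (not_isPolar_K1_compl_P3_K2 s)
      (fun v u => (![![0, 0, 0, 2, 1, 1], ![2, 0, 0, 0, 1, 1], ![0, 2, 0, 2, 0, 0],
        ![2, 0, 0, 0, 1, 1], ![0, 0, 0, 2, 0, 2], ![0, 0, 0, 2, 2, 0]] : Fin 6 → Fin 6 → Fin 3)
        (Sum.elim ![0] (Sum.elim ![1, 2, 3] ![4, 5]) v)
        (Sum.elim ![0] (Sum.elim ![1, 2, 3] ![4, 5]) u)) (by decide)
  · exact isMinimalPolarObstruction_of_coloring _ hs (not_isPolar_K1_C5 s)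
      (fun v u => (![![0, 0, 1, 0, 2, 2], ![0, 0, 0, 2, 2, 0], ![0, 0, 0, 0, 2, 2],
        ![0, 2, 0, 0, 0, 2], ![0, 2, 2, 0, 0, 0], ![0, 0, 2, 2, 0, 0]] : Fin 6 → Fin 6 → Fin 3)
        (Sum.elim ![0] ![1, 2, 3, 4, 5] v) (Sum.elim ![0] ![1, 2, 3, 4, 5] u)) (by decide)
  · exact isMinimalPolarObstruction_of_coloring _ hs (not_isPolar_K1_banner s)
      (fun v u => (![![0, 0, 1, 0, 1, 2], ![0, 0, 0, 2, 0, 0], ![0, 0, 0, 2, 2, 0],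
        ![0, 2, 0, 0, 0, 0], ![0, 0, 2, 2, 0, 0], ![2, 0, 1, 0, 1, 0]] : Fin 6 → Fin 6 → Fin 3)
        (Sum.elim ![0] ![1, 2, 3, 4, 5] v) (Sum.elim ![0] ![1, 2, 3, 4, 5] u)) (by decide)
  · exact isMinimalPolarObstruction_of_coloring _ hs (not_isPolar_K1_compl_P5 s)
      (fun v u => (![![0, 0, 0, 2, 1, 1], ![0, 0, 2, 0, 0, 2], ![0, 2, 0, 0, 0, 2],
        ![2, 0, 0, 0, 1, 1], ![0, 0, 0, 2, 0, 2], ![0, 2, 0, 0, 2, 0]] : Fin 6 → Fin 6 → Fin 3)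
        (Sum.elim ![0] ![1, 2, 3, 4, 5] v) (Sum.elim ![0] ![1, 2, 3, 4, 5] u)) (by decide)

end Essential

/-! ### The three disconnected obstructions depending on `s` -/

section Special

@[simp] theorem join_adj_inl_inl {G : SimpleGraph V} {H : SimpleGraph W} {a b : V} :
    (join G H).Adj (.inl a) (.inl b) ↔ G.Adj a b := by
  simp only [join, compl_adj, sum_adj_inl, ne_eq, Sum.inl.injEq]
  grind [SimpleGraph.irrefl]

@[simp] theorem join_adj_inr_inr {G : SimpleGraph V} {H : SimpleGraph W} {a b : W} :
    (join G H).Adj (.inr a) (.inr b) ↔ H.Adj a b := by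
  simp only [join, compl_adj, sum_adj_inr, ne_eq, Sum.inr.injEq]
  grind [SimpleGraph.irrefl]

@[simp] theorem join_adj_inl_inr {G : SimpleGraph V} {H : SimpleGraph W} {a : V} {b : W} :
    (join G H).Adj (.inl a) (.inr b) := by
  simp [join]

@[simp] theorem join_adj_inr_inl {G : SimpleGraph V} {H : SimpleGraph W} {a : W} {b : V} :
    (join G H).Adj (.inr a) (.inl b) := by
  simp [join]

/-- Vertices of a clique in the multipartite side lie in different parts, so cliques there bound `s`
from below. -/
theorem PolarOn.exists_partition {G : SimpleGraph V} {s : ℕ} (h : PolarOn G Set.univ s) :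
    ∃ A : Set V, (∀ u ∈ A, ∀ v ∈ A, ∀ w ∈ A, ¬ G.Adj u v → G.Adj u w → G.Adj v w) ∧
      (∀ u ∉ A, ∀ v ∉ A, u ≠ v → G.Adj u v) ∧
      ∀ (ι : Type) [Fintype ι] (g : ι → V), (∀ i, g i ∈ A) → (∀ i j, i ≠ j → G.Adj (g i) (g j)) →
        Fintype.card ι ≤ s := by
  obtain ⟨A, ⟨f, h1, h2⟩, h3⟩ := h
  refine ⟨A, fun u hu v hv w hw => ?_, fun u hu v hv => h3 u trivial hu v trivial hv,
    fun ι _ g hg hadj => ?_⟩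
  · rw [h2 u trivial hu v trivial hv, h2 u trivial hu w trivial hw, h2 v trivial hv w trivial hw]
    intro h h'
    push Not at h
    rwa [← h]
  · have := Fintype.card_le_of_injective (fun i => (⟨f (g i), h1 _ trivial (hg i)⟩ : Fin s)) (by
      intro i j hij
      by_contra hne
      exact (h2 _ trivial (hg i) _ trivial (hg j)).1 (hadj i j hne) (congrArg Fin.val hij))
    simpa using this

/-- The clique side misses one component, so the multipartite side contains a `K_{s+1}`. -/
theorem not_isPolar_twoK (s : ℕ) : ¬ IsPolar (K (s + 1) ⊕g K (s + 1)) s 1 := by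
  rw [isPolar_iff]
  intro h
  obtain ⟨A, -, hB, hcard⟩ := h.exists_partition
  have key : (∀ i, Sum.inl i ∈ A) ∨ ∀ i, Sum.inr i ∈ A := by
    by_contra! hc
    obtain ⟨⟨i, hi⟩, ⟨j, hj⟩⟩ := hc
    simpa using hB _ hi _ hj
  rcases key with h | h
  · simpa using hcard (Fin (s + 1)) _ h (by simp)
  · simpa using hcard (Fin (s + 1)) _ h (by simp)

/-- If `K₂` lies in the multipartite side, no vertex of the other component does, since `K₁ + K₂`
would appear; then the clique side contains `2K₁`. Otherwise the whole join, with a clique of order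
`s + 1`, lies in the multipartite side. -/
theorem not_isPolar_K2_join (s : ℕ) :
    ¬ IsPolar (K 2 ⊕g join (K s) (K 1 ⊕g K 1)) s 1 := by
  rw [isPolar_iff]
  intro h
  obtain ⟨A, hA, hB, hcard⟩ := h.exists_partition
  by_cases h0 : ∀ i, Sum.inl i ∈ A
  · have key : ∀ j, Sum.inr j ∉ A := fun j hj => by
      have := hA _ hj _ (h0 0) _ (h0 1)
      have := hA (Sum.inl 0) (h0 0) _ hj (Sum.inl 1) (h0 1)
      simp at this
    simpa using hB _ (key (.inr (.inl 0))) _ (key (.inr (.inr 0)))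
  · push Not at h0
    obtain ⟨i, hi⟩ := h0
    have key : ∀ j, Sum.inr j ∈ A := fun j => by
      by_contra hj
      simpa using hB _ hi _ hj
    have := hcard (Option (Fin s))
      (fun i => i.elim (Sum.inr (.inr (.inl 0))) fun i => Sum.inr (.inl i)) (by
        rintro (_ | i) <;> simp [key]) (by
        rintro (_ | i) (_ | j) <;> simp)
    simp at this

/-- An isolated vertex in the multipartite side makes that side independent, and `C₄` would be
split. If it is in the clique side, the multipartite side contains the join and its clique of `(s -
1) + 2` vertices. -/
theorem not_isPolar_K1_join (s : ℕ) (hs : 2 ≤ s) :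
    ¬ IsPolar (K 1 ⊕g join (K (s - 1)) (cycleGraph 4)) s 1 := by
  rw [isPolar_iff]
  intro h
  obtain ⟨A, hA, hB, hcard⟩ := h.exists_partition
  by_cases h0 : Sum.inl 0 ∈ A
  · have hadj : ∀ i j, Sum.inr i ∈ A → Sum.inr j ∈ A →
        ¬ (join (K (s - 1)) (cycleGraph 4)).Adj i j := fun i j hi hj hij => by
      have := hA (Sum.inl 0) h0 _ hi (Sum.inr j) hj
      have := hA (Sum.inr i) hi _ h0 (Sum.inr j) hj
      simp_all
    have h' : ∀ i j, Sum.inr i ∉ A → Sum.inr j ∉ A → i ≠ j →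
        (join (K (s - 1)) (cycleGraph 4)).Adj i j := fun i j hi hj hij => by
      simpa using hB _ hi _ hj (by simpa using hij)
    have e1 : ∀ i j : Fin 4, Sum.inr (Sum.inr i) ∈ A → Sum.inr (Sum.inr j) ∈ A →
        ¬ (cycleGraph 4).Adj i j := fun i j hi hj => by
      simpa using hadj _ _ hi hj
    have e2 : ∀ i j : Fin 4, Sum.inr (Sum.inr i) ∉ A → Sum.inr (Sum.inr j) ∉ A → i ≠ j →
        (cycleGraph 4).Adj i j := fun i j hi hj hij => by
      simpa using h' _ _ hi hj (by simpa using hij)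
    have h02 : Sum.inr (Sum.inr 0) ∈ A ∨ Sum.inr (Sum.inr 2) ∈ A := by
      by_contra! hc
      exact absurd (e2 0 2 hc.1 hc.2 (by decide)) (by decide)
    have h13 : Sum.inr (Sum.inr 1) ∈ A ∨ Sum.inr (Sum.inr 3) ∈ A := by
      by_contra! hc
      exact absurd (e2 1 3 hc.1 hc.2 (by decide)) (by decide)
    rcases h02 with h | h <;> rcases h13 with h' | h' <;>
      exact absurd (by decide) (e1 _ _ h h')
  · have key : ∀ j, Sum.inr j ∈ A := fun j => by
      by_contra hj
      simpa using hB _ h0 _ hj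
    have := hcard (Fin (s - 1) ⊕ Fin 2)
      (Sum.elim (fun i => Sum.inr (.inl i)) ![Sum.inr (.inr 0), Sum.inr (.inr 1)]) (by
        rintro (i | i)
        · simp [key]
        · fin_cases i <;> simp [key]) (by
        have c01 : (cycleGraph 4).Adj 0 1 := by decide
        rintro (i | i) (j | j)
        · simp
        · fin_cases j <;> simp
        · fin_cases i <;> simp
        · fin_cases i <;> fin_cases j <;> simp [c01, c01.symm])
    simp only [Fintype.card_sum, Fintype.card_fin] at this
    omega

theorem IsSpecialDisconnected.not_isPolar {G : SimpleGraph V} {s : ℕ} (hs : 2 ≤ s)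
    (hG : IsSpecialDisconnected G s) : ¬ IsPolar G s 1 := by
  intro h
  rcases hG with ⟨⟨e⟩⟩ | ⟨⟨e⟩⟩ | ⟨⟨e⟩⟩
  · exact not_isPolar_twoK s (h.of_embedding e.symm.toEmbedding)
  · exact not_isPolar_K2_join s (h.of_embedding e.symm.toEmbedding)
  · exact not_isPolar_K1_join s hs (h.of_embedding e.symm.toEmbedding)

/-- Here and in the next two lemmas a whole component serves as the multipartite side. One extra
part suffices, which distinguishes these graphs from the essential ones. -/
theorem isPolar_succ_twoK (s : ℕ) : PolarOn (K (s + 1) ⊕g K (s + 1)) Set.univ (s + 1) :=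
  PolarOn.of_labels (Set.range Sum.inl) (Sum.elim id fun _ => 0) Finset.univ (by simp) (by simp)
    (by simp) (by simp)

theorem isPolar_succ_K2_join (s : ℕ) :
    PolarOn (K 2 ⊕g join (K s) (K 1 ⊕g K 1)) Set.univ (s + 1) := by
  refine PolarOn.of_labels (Set.range Sum.inr)
    (Sum.elim (fun _ => none) (Sum.elim some fun _ => none)) Finset.univ (by simp) (by simp) ?_ ?_
  · rintro (u | u | u | u) - hu (v | v | v | v) - hv <;> simp_all <;>
      exact Subsingleton.elim _ _
  · rintro (u | u) - hu (v | v) - hv <;> simp_all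

theorem isPolar_succ_K1_join (s : ℕ) (hs : 2 ≤ s) :
    PolarOn (K 1 ⊕g join (K (s - 1)) (cycleGraph 4)) Set.univ (s + 1) := by
  refine PolarOn.of_labels (Set.range Sum.inr)
    (Sum.elim (fun _ => Sum.inr 0) (Sum.elim Sum.inl fun i => Sum.inr (![0, 1, 0, 1] i : Fin 2)))
    Finset.univ (by simp; omega) (by simp) ?_ ?_
  · have : ∀ u v : Fin 4, (cycleGraph 4).Adj u v ↔
        (![0, 1, 0, 1] u : Fin 2) ≠ (![0, 1, 0, 1] v : Fin 2) := by decide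
    rintro (u | u | u) - hu (v | v | v) - hv <;> simp_all
  · rintro (u | u) - hu (v | v) - hv <;> simp_all

theorem IsSpecialDisconnected.isPolar_succ {G : SimpleGraph V} {s : ℕ} (hs : 2 ≤ s)
    (hG : IsSpecialDisconnected G s) : IsPolar G (s + 1) 1 := by
  rcases hG with ⟨⟨e⟩⟩ | ⟨⟨e⟩⟩ | ⟨⟨e⟩⟩
  · exact (isPolar_iff.2 (isPolar_succ_twoK s)).of_embedding e.toEmbedding
  · exact (isPolar_iff.2 (isPolar_succ_K2_join s)).of_embedding e.toEmbedding
  · exact (isPolar_iff.2 (isPolar_succ_K1_join s hs)).of_embedding e.toEmbedding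

theorem isMinimal_twoK (s : ℕ) : IsMinimalPolarObstruction (K (s + 1) ⊕g K (s + 1)) s 1 := by
  rw [isMinimalPolarObstruction_iff, ← isPolar_iff]
  refine ⟨not_isPolar_twoK s, ?_⟩
  rintro (v | v)
  · exact PolarOn.of_labels (Set.range Sum.inl) (Sum.elim id fun _ => 0) (Finset.univ.erase v)
      (by simp) (by simp) (by simp) (by simp)
  · exact PolarOn.of_labels (Set.range Sum.inr) (Sum.elim (fun _ => 0) id) (Finset.univ.erase v)
      (by simp) (by simp) (by simp) (by simp)

theorem isMinimal_K2_join (s : ℕ) (hs : 2 ≤ s) :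
    IsMinimalPolarObstruction (K 2 ⊕g join (K s) (K 1 ⊕g K 1)) s 1 := by
  rw [isMinimalPolarObstruction_iff, ← isPolar_iff]
  refine ⟨not_isPolar_K2_join s, ?_⟩
  rintro (v | v | v)
  -- Without a vertex of `K₂` the graph is split: `K_s` is the clique and the rest is independent.
  · refine PolarOn.of_labels (Set.range (Sum.inr ∘ Sum.inl))ᶜ (fun _ => ()) Finset.univ
      (by simp; omega) (by simp) ?_ ?_
    · rintro (a | a | a | a) ha hA (b | b | b | b) hb hB <;> simp_all <;> try omega
    · rintro (a | a | a) ha hA (b | b | b) hb hB <;> simp_all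
  · refine PolarOn.of_labels (Set.range Sum.inr)
      (Sum.elim (fun _ => none) (Sum.elim some fun _ => none)) (Finset.univ.erase (some v))
      (by simp) ?_ ?_ ?_
    · rintro (a | a | a) ha hA <;> simp_all
    · rintro (a | a | a | a) ha hA (b | b | b | b) hb hB <;> simp_all
      · exact Subsingleton.elim _ _
      · exact Subsingleton.elim _ _
    · rintro (a | a) ha hA (b | b) hb hB <;> simp_all
  -- What remains of `2K₁` extends `K_s` to the clique side; the two vertices of `K₂` are the parts.
  · refine PolarOn.of_labels (Set.range Sum.inl)
      (Sum.elim id fun _ => 0) (Finset.univ : Finset (Fin 2)) (by simpa using hs) (by simp) ?_ ?_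
    · simp
    · rcases v with v | v <;>
      · rintro (a | a | a | a) ha hA (b | b | b | b) hb hB <;> simp_all <;>
          exact absurd (Subsingleton.elim _ _) ‹¬ _›

theorem isMinimal_K1_join (s : ℕ) (hs : 2 ≤ s) :
    IsMinimalPolarObstruction (K 1 ⊕g join (K (s - 1)) (cycleGraph 4)) s 1 := by
  rw [isMinimalPolarObstruction_iff, ← isPolar_iff]
  refine ⟨not_isPolar_K1_join s hs, ?_⟩
  rintro (v | v | v)
  · have h1 : ∀ u v : Fin 4, 2 ≤ u → 2 ≤ v → ((cycleGraph 4).Adj u v ↔ u ≠ v) := by decide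
    have h2 : ∀ u v : Fin 4, ¬ 2 ≤ u → ¬ 2 ≤ v → u ≠ v → (cycleGraph 4).Adj u v := by decide
    -- The edge `2 3` of the cycle gives two parts; the edge `0 1` joins the clique.
    refine PolarOn.of_labels {x | ∃ i, 2 ≤ i ∧ x = Sum.inr (Sum.inr i)}
      (Sum.elim (fun _ => 0) (Sum.elim (fun _ => 0) id)) {2, 3} (by simpa using hs) ?_ ?_ ?_
    · rintro a ha ⟨i, hi, rfl⟩
      fin_cases i <;> simp_all
    · rintro a ha ⟨i, hi, rfl⟩ b hb ⟨j, hj, rfl⟩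
      simp [h1 i j hi hj]
    · rintro (a | a | a) ha hA (b | b | b) hb hB <;> simp_all <;>
        exact absurd (Subsingleton.elim _ _) ‹¬ _›
  · refine PolarOn.of_labels (Set.range Sum.inr)
      (Sum.elim (fun _ => Sum.inr 0)
        (Sum.elim Sum.inl fun i => Sum.inr (![0, 1, 0, 1] i : Fin 2)))
      (Finset.univ.erase (.inl v)) (by simp; omega) ?_ ?_ ?_
    · rintro (a | a | a) ha hA <;> simp_all
    · have : ∀ u v : Fin 4, (cycleGraph 4).Adj u v ↔
          (![0, 1, 0, 1] u : Fin 2) ≠ (![0, 1, 0, 1] v : Fin 2) := by decide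
      rintro (a | a | a) ha hA (b | b | b) hb hB <;> simp_all
    · rintro (a | a) ha hA (b | b) hb hB <;> simp_all
  · have h1 : ∀ v a b : Fin 4, a ≠ v → b ≠ v → a ≠ v + 2 → b ≠ v + 2 →
        ¬ (cycleGraph 4).Adj a b := by decide
    -- The antipode `v + 2` joins the clique; the two cycle neighbours of `v` and the isolated
    -- vertex are independent.
    refine PolarOn.of_labels {x | ∀ y, x = Sum.inr y → ∃ i, i ≠ v + 2 ∧ y = Sum.inr i}
      (fun _ => ()) Finset.univ (by simp; omega) (by simp) ?_ ?_
    · rintro (a | a | a) ha hA (b | b | b) hb hB <;> simp_all <;>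
        first | exact Subsingleton.elim _ _ | exact h1 v a b ha hb hA hB
    · rintro (a | a | a) ha hA (b | b | b) hb hB <;> simp_all

theorem IsSpecialDisconnected.isMinimalPolarObstruction {G : SimpleGraph V} {s : ℕ} (hs : 2 ≤ s)
    (hG : IsSpecialDisconnected G s) : IsMinimalPolarObstruction G s 1 := by
  rcases hG with ⟨⟨e⟩⟩ | ⟨⟨e⟩⟩ | ⟨⟨e⟩⟩
  · exact (isMinimal_twoK s).of_iso e.symm
  · exact (isMinimal_K2_join s hs).of_iso e.symm
  · exact (isMinimal_K1_join s hs).of_iso e.symm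

theorem IsEssential.not_preconnected {G : SimpleGraph V} (hG : IsEssential G) :
    ¬ G.Preconnected := by
  intro h
  rcases hG with ⟨⟨e⟩⟩ | ⟨⟨e⟩⟩ | ⟨⟨e⟩⟩ | ⟨⟨e⟩⟩ | ⟨⟨e⟩⟩ | ⟨⟨e⟩⟩ | ⟨⟨e⟩⟩ <;>
    exact not_preconnected_sum (e.preconnected_iff.1 h)

theorem IsSpecialDisconnected.not_preconnected {G : SimpleGraph V} {s : ℕ}
    (hG : IsSpecialDisconnected G s) : ¬ G.Preconnected := by
  intro h
  rcases hG with ⟨⟨e⟩⟩ | ⟨⟨e⟩⟩ | ⟨⟨e⟩⟩ <;>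
    exact not_preconnected_sum (e.preconnected_iff.1 h)

end Special

/-! ### Recognising the essential graphs as induced subgraphs -/

section Disconnected

/-- An embedding from a function reflecting equality and adjacency. -/
theorem nonempty_embedding {H : SimpleGraph W} {G : SimpleGraph V} (f : W → V)
    (h : ∀ u v, (H.Adj u v ↔ G.Adj (f u) (f v)) ∧ (f u = f v → u = v)) : Nonempty (H ↪g G) :=
  ⟨⟨⟨f, fun u v => (h u v).2⟩, fun {u v} => (h u v).1.symm⟩⟩

/-- Distinct and non-adjacent. -/
def Apart (G : SimpleGraph V) (x y : V) : Prop := x ≠ y ∧ ¬ G.Adj x y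

variable {G : SimpleGraph V}

theorem embedding_K1_twoK2 {x a b c d : V} (h : IsTwoK2 G a b c d) (ha : Apart G x a)
    (hb : Apart G x b) (hc : Apart G x c) (hd : Apart G x d) :
    Nonempty (K 1 ⊕g (K 2 ⊕g K 2) ↪g G) := by
  obtain ⟨h1, h2, h3, h4, h5, h6⟩ := h
  refine nonempty_embedding (Sum.elim ![x] (Sum.elim ![a, b] ![c, d])) ?_
  unfold Apart at *
  rintro (u | u | u) (v | v | v) <;> fin_cases u <;> fin_cases v <;> simp <;>
    grind [SimpleGraph.Adj.symm, SimpleGraph.irrefl]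

theorem embedding_twoP3 {a b c d e f : V} (h1 : G.Adj a b) (h2 : G.Adj b c) (h3 : Apart G a c)
    (h4 : G.Adj d e) (h5 : G.Adj e f) (h6 : Apart G d f)
    (h : ∀ x y, (x = a ∨ x = b ∨ x = c) → (y = d ∨ y = e ∨ y = f) → Apart G x y) :
    Nonempty (pathGraph 3 ⊕g pathGraph 3 ↪g G) := by
  have p01 : (pathGraph 3).Adj 0 1 := by decide
  have p12 : (pathGraph 3).Adj 1 2 := by decide
  have p02 : ¬ (pathGraph 3).Adj 0 2 := by decide
  refine nonempty_embedding (Sum.elim ![a, b, c] ![d, e, f]) ?_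
  unfold Apart at *
  rintro (u | u) (v | v) <;> fin_cases u <;> fin_cases v <;> simp <;>
    grind [SimpleGraph.Adj.symm, SimpleGraph.irrefl]

theorem embedding_C4_twoK1 {a b c d x y : V} (h : IsC4 G a b c d)
    (hx : ∀ z, (z = a ∨ z = b ∨ z = c ∨ z = d) → Apart G x z)
    (hy : ∀ z, (z = a ∨ z = b ∨ z = c ∨ z = d) → Apart G y z) (hxy : Apart G x y) :
    Nonempty (cycleGraph 4 ⊕g (K 1 ⊕g K 1) ↪g G) := by
  have p01 : (cycleGraph 4).Adj 0 1 := by decide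
  have p12 : (cycleGraph 4).Adj 1 2 := by decide
  have p23 : (cycleGraph 4).Adj 2 3 := by decide
  have p30 : (cycleGraph 4).Adj 3 0 := by decide
  have p02 : ¬ (cycleGraph 4).Adj 0 2 := by decide
  have p13 : ¬ (cycleGraph 4).Adj 1 3 := by decide
  obtain ⟨h1, h2, h3, h4, h5, h6, h7, h8⟩ := h
  refine nonempty_embedding (Sum.elim ![a, b, c, d] (Sum.elim ![x] ![y])) ?_
  unfold Apart at *
  rintro (u | u | u) (v | v | v) <;> fin_cases u <;> fin_cases v <;> simp <;>
    grind [SimpleGraph.Adj.symm, SimpleGraph.irrefl]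

/-- An isolated vertex, a four-cycle and a vertex adjacent to three vertices of the cycle. -/
theorem embedding_K1_compl_P3_K2 {a b c d x y : V} (h : IsC4 G a b c d)
    (hy : ∀ z, (z = a ∨ z = b ∨ z = c ∨ z = d ∨ z = x) → Apart G y z)
    (ha : G.Adj x a) (hb : G.Adj x b) (hc : G.Adj x c) (hd : Apart G x d) :
    Nonempty (K 1 ⊕g (pathGraph 3 ⊕g K 2)ᶜ ↪g G) := by
  have p01 : (pathGraph 3).Adj 0 1 := by decide
  have p12 : (pathGraph 3).Adj 1 2 := by decide
  have p02 : ¬ (pathGraph 3).Adj 0 2 := by decide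
  obtain ⟨h1, h2, h3, h4, h5, h6, h7, h8⟩ := h
  -- In the complement, `x d b` is the `P₃` and `a c` the `K₂`.
  refine nonempty_embedding (Sum.elim ![y] (Sum.elim ![x, d, b] ![a, c])) ?_
  unfold Apart at *
  rintro (u | u | u) (v | v | v) <;> fin_cases u <;> fin_cases v <;> simp <;>
    grind [SimpleGraph.Adj.symm, SimpleGraph.irrefl]

theorem embedding_K1_C5 {a b c d e y : V} (h : IsC5 G a b c d e)
    (hy : ∀ z, (z = a ∨ z = b ∨ z = c ∨ z = d ∨ z = e) → Apart G y z) :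
    Nonempty (K 1 ⊕g cycleGraph 5 ↪g G) := by
  have p01 : (cycleGraph 5).Adj 0 1 := by decide
  have p12 : (cycleGraph 5).Adj 1 2 := by decide
  have p23 : (cycleGraph 5).Adj 2 3 := by decide
  have p34 : (cycleGraph 5).Adj 3 4 := by decide
  have p40 : (cycleGraph 5).Adj 4 0 := by decide
  have p02 : ¬ (cycleGraph 5).Adj 0 2 := by decide
  have p13 : ¬ (cycleGraph 5).Adj 1 3 := by decide
  have p24 : ¬ (cycleGraph 5).Adj 2 4 := by decide
  have p30 : ¬ (cycleGraph 5).Adj 3 0 := by decide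
  have p41 : ¬ (cycleGraph 5).Adj 4 1 := by decide
  obtain ⟨h1, h2, h3, h4, h5, h6, h7, h8, h9, h10⟩ := h
  refine nonempty_embedding (Sum.elim ![y] ![a, b, c, d, e]) ?_
  unfold Apart at *
  rintro (u | u) (v | v) <;> fin_cases u <;> fin_cases v <;> simp <;>
    grind [SimpleGraph.Adj.symm, SimpleGraph.irrefl]

/-- An isolated vertex, a four-cycle and a vertex adjacent to one vertex of the cycle. -/
theorem embedding_K1_banner {a b c d x y : V} (h : IsC4 G a b c d)
    (hy : ∀ z, (z = a ∨ z = b ∨ z = c ∨ z = d ∨ z = x) → Apart G y z)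
    (ha : Apart G x a) (hb : Apart G x b) (hc : G.Adj x c) (hd : Apart G x d) :
    Nonempty (K 1 ⊕g banner ↪g G) := by
  have p01 : banner.Adj 0 1 := by decide
  have p12 : banner.Adj 1 2 := by decide
  have p23 : banner.Adj 2 3 := by decide
  have p30 : banner.Adj 3 0 := by decide
  have p24 : banner.Adj 2 4 := by decide
  have p02 : ¬ banner.Adj 0 2 := by decide
  have p13 : ¬ banner.Adj 1 3 := by decide
  have p40 : ¬ banner.Adj 4 0 := by decide
  have p41 : ¬ banner.Adj 4 1 := by decide
  have p43 : ¬ banner.Adj 4 3 := by decide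
  obtain ⟨h1, h2, h3, h4, h5, h6, h7, h8⟩ := h
  refine nonempty_embedding (Sum.elim ![y] ![a, b, c, d, x]) ?_
  unfold Apart at *
  rintro (u | u) (v | v) <;> fin_cases u <;> fin_cases v <;> simp <;>
    grind [SimpleGraph.Adj.symm, SimpleGraph.irrefl]

/-- An isolated vertex, a four-cycle and a vertex adjacent to two consecutive vertices of the
cycle. -/
theorem embedding_K1_compl_P5 {a b c d x y : V} (h : IsC4 G a b c d)
    (hy : ∀ z, (z = a ∨ z = b ∨ z = c ∨ z = d ∨ z = x) → Apart G y z)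
    (ha : G.Adj x a) (hb : G.Adj x b) (hc : Apart G x c) (hd : Apart G x d) :
    Nonempty (K 1 ⊕g (pathGraph 5)ᶜ ↪g G) := by
  have p01 : (pathGraph 5).Adj 0 1 := by decide
  have p12 : (pathGraph 5).Adj 1 2 := by decide
  have p23 : (pathGraph 5).Adj 2 3 := by decide
  have p34 : (pathGraph 5).Adj 3 4 := by decide
  have p40 : ¬ (pathGraph 5).Adj 4 0 := by decide
  have p02 : ¬ (pathGraph 5).Adj 0 2 := by decide
  have p13 : ¬ (pathGraph 5).Adj 1 3 := by decide
  have p24 : ¬ (pathGraph 5).Adj 2 4 := by decide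
  have p30 : ¬ (pathGraph 5).Adj 3 0 := by decide
  have p41 : ¬ (pathGraph 5).Adj 4 1 := by decide
  obtain ⟨h1, h2, h3, h4, h5, h6, h7, h8⟩ := h
  -- In the complement, `a c x d b` is a path.
  refine nonempty_embedding (Sum.elim ![y] ![a, c, x, d, b]) ?_
  unfold Apart at *
  rintro (u | u) (v | v) <;> fin_cases u <;> fin_cases v <;> simp <;>
    grind [SimpleGraph.Adj.symm, SimpleGraph.irrefl]

end Disconnected

/-! ### Complete multipartite sides and their transversals -/

section Classification

variable {G : SimpleGraph V}

theorem exists_injective_fin_of_le_card {T : Finset V} {n : ℕ} (h : n ≤ T.card) :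
    ∃ g : Fin n → V, Function.Injective g ∧ ∀ i, g i ∈ T :=
  ⟨fun i => T.equivFin.symm (Fin.castLE h i), fun i j hij => by
    simpa [Subtype.ext_iff] using hij, fun i => (T.equivFin.symm _).2⟩

theorem embedding_twoK {s : ℕ} {S T : Finset V} (hS : s + 1 ≤ S.card) (hT : s + 1 ≤ T.card)
    (hS' : ∀ x ∈ S, ∀ y ∈ S, x ≠ y → G.Adj x y) (hT' : ∀ x ∈ T, ∀ y ∈ T, x ≠ y → G.Adj x y)
    (h : ∀ x ∈ S, ∀ y ∈ T, Apart G x y) : Nonempty (K (s + 1) ⊕g K (s + 1) ↪g G) := by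
  obtain ⟨g, hg, hgS⟩ := exists_injective_fin_of_le_card hS
  obtain ⟨g', hg', hgT⟩ := exists_injective_fin_of_le_card hT
  refine nonempty_embedding (Sum.elim g g') ?_
  unfold Apart at h
  rintro (u | u) (v | v)
  · have h1 := hS' _ (hgS u) _ (hgS v)
    have h2 := hg.eq_iff (a := u) (b := v)
    simp
    grind [SimpleGraph.irrefl]
  · have := h _ (hgS u) _ (hgT v)
    simp
    grind
  · have := h _ (hgS v) _ (hgT u)
    simp
    grind [SimpleGraph.Adj.symm]
  · have h1 := hT' _ (hgT u) _ (hgT v)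
    have h2 := hg'.eq_iff (a := u) (b := v)
    simp
    grind [SimpleGraph.irrefl]

theorem embedding_K2_join {s : ℕ} {T : Finset V} {a b p q : V} (hT : s ≤ T.card)
    (hT' : ∀ x ∈ T, ∀ y ∈ T, x ≠ y → G.Adj x y) (hp : ∀ x ∈ T, G.Adj x p)
    (hq : ∀ x ∈ T, G.Adj x q) (hpq : Apart G p q) (hab : G.Adj a b)
    (h : ∀ x, (x ∈ T ∨ x = p ∨ x = q) → Apart G a x ∧ Apart G b x) :
    Nonempty (K 2 ⊕g join (K s) (K 1 ⊕g K 1) ↪g G) := by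
  obtain ⟨g, hg, hgT⟩ := exists_injective_fin_of_le_card hT
  have hga := fun i => h _ (Or.inl (hgT i))
  have hgp := fun i => hp _ (hgT i)
  have hgq := fun i => hq _ (hgT i)
  have h1 := h p
  have h2 := h q
  unfold Apart at *
  refine nonempty_embedding (Sum.elim ![a, b] (Sum.elim g (Sum.elim ![p] ![q]))) ?_
  rintro (u | u | u | u) (v | v | v | v)
  case inr.inl.inr.inl =>
    have h1 := hT' _ (hgT u) _ (hgT v)
    have h2 := hg.eq_iff (a := u) (b := v)
    simp
    grind [SimpleGraph.irrefl]
  case inr.inl.inl => have := hga u; fin_cases v <;> simp <;> grind [SimpleGraph.Adj.symm]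
  case inl.inr.inl => have := hga v; fin_cases u <;> simp <;> grind
  case inr.inl.inr.inr.inl =>
    have := hgp u; fin_cases v; simp; grind [SimpleGraph.irrefl]
  case inr.inl.inr.inr.inr =>
    have := hgq u; fin_cases v; simp; grind [SimpleGraph.irrefl]
  case inr.inr.inl.inr.inl =>
    have := hgp v; fin_cases u; simp; grind [SimpleGraph.irrefl, SimpleGraph.Adj.symm]
  case inr.inr.inr.inr.inl =>
    have := hgq v; fin_cases u; simp; grind [SimpleGraph.irrefl, SimpleGraph.Adj.symm]
  all_goals
    fin_cases u <;> fin_cases v <;> simp <;> grind [SimpleGraph.Adj.symm, SimpleGraph.irrefl]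

theorem embedding_K1_join {s : ℕ} {T : Finset V} {a b c d y : V} (hT : s - 1 ≤ T.card)
    (hT' : ∀ x ∈ T, ∀ y ∈ T, x ≠ y → G.Adj x y) (h : IsC4 G a b c d)
    (hTC : ∀ x ∈ T, G.Adj x a ∧ G.Adj x b ∧ G.Adj x c ∧ G.Adj x d)
    (hy : ∀ x, (x ∈ T ∨ x = a ∨ x = b ∨ x = c ∨ x = d) → Apart G y x) :
    Nonempty (K 1 ⊕g join (K (s - 1)) (cycleGraph 4) ↪g G) := by
  obtain ⟨g, hg, hgT⟩ := exists_injective_fin_of_le_card hT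
  have hgy := fun i => hy _ (Or.inl (hgT i))
  have hgc := fun i => hTC _ (hgT i)
  have p01 : (cycleGraph 4).Adj 0 1 := by decide
  have p12 : (cycleGraph 4).Adj 1 2 := by decide
  have p23 : (cycleGraph 4).Adj 2 3 := by decide
  have p30 : (cycleGraph 4).Adj 3 0 := by decide
  have p02 : ¬ (cycleGraph 4).Adj 0 2 := by decide
  have p13 : ¬ (cycleGraph 4).Adj 1 3 := by decide
  obtain ⟨h1, h2, h3, h4, h5, h6, h7, h8⟩ := h
  unfold Apart at *
  refine nonempty_embedding (Sum.elim ![y] (Sum.elim g ![a, b, c, d])) ?_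
  rintro (u | u | u) (v | v | v)
  case inr.inl.inr.inl =>
    have h1 := hT' _ (hgT u) _ (hgT v)
    have h2 := hg.eq_iff (a := u) (b := v)
    simp
    grind [SimpleGraph.irrefl]
  case inr.inl.inl => have := hgy u; fin_cases v; simp; grind [SimpleGraph.Adj.symm]
  case inl.inr.inl => have := hgy v; fin_cases u; simp; grind
  case inr.inl.inr.inr =>
    have := hgc u
    fin_cases v <;> simp <;> grind [SimpleGraph.irrefl]
  case inr.inr.inr.inl =>
    have := hgc v
    fin_cases u <;> simp <;> grind [SimpleGraph.irrefl, SimpleGraph.Adj.symm]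
  all_goals
    fin_cases u <;> fin_cases v <;> simp <;> grind [SimpleGraph.Adj.symm, SimpleGraph.irrefl]

/-- Non-adjacency is transitive on `S`, so `S` induces a complete multipartite graph. -/
def IsMultipartiteOn (G : SimpleGraph V) (S : Set V) : Prop :=
  ∀ u ∈ S, ∀ v ∈ S, ∀ w ∈ S, ¬ G.Adj u v → G.Adj u w → G.Adj v w

/-- A clique of a complete multipartite graph extends to a transversal of the parts. -/
theorem IsMultipartiteOn.exists_transversal [Finite V] {S : Set V} (hS : IsMultipartiteOn G S)
    (T₀ : Finset V) (hT₀ : ∀ x ∈ T₀, x ∈ S) (hT₀' : ∀ x ∈ T₀, ∀ y ∈ T₀, x ≠ y → G.Adj x y) :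
    ∃ T : Finset V, T₀ ⊆ T ∧ (∀ x ∈ T, x ∈ S) ∧ (∀ x ∈ T, ∀ y ∈ T, x ≠ y → G.Adj x y) ∧
      ∃ f : V → V, (∀ u ∈ S, f u ∈ T) ∧ ∀ u ∈ S, ∀ v ∈ S, G.Adj u v ↔ f u ≠ f v := by
  classical
  have := Fintype.ofFinite V
  obtain ⟨T, hT, hmax⟩ := (Finset.univ.filter fun T : Finset V => T₀ ⊆ T ∧ (∀ x ∈ T, x ∈ S) ∧
    ∀ x ∈ T, ∀ y ∈ T, x ≠ y → G.Adj x y).exists_max_image Finset.card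
    ⟨T₀, by simpa using ⟨hT₀, hT₀'⟩⟩
  simp only [Finset.mem_filter, Finset.mem_univ, true_and] at hT hmax
  obtain ⟨h0, h1, h2⟩ := hT
  -- By maximality of `T`, each vertex of `S` misses some member of `T`; that member names its part.
  have hex : ∀ u ∈ S, ∃ t ∈ T, ¬ G.Adj u t := by
    intro u hu
    by_contra! hc
    have huT : u ∉ T := fun h => G.irrefl (hc u h)
    have := hmax (insert u T) ⟨h0.trans (Finset.subset_insert _ _), by
      simpa using ⟨hu, h1⟩, by
      simp only [Finset.mem_insert]
      rintro x (rfl | hx) y (rfl | hy) hxy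
      · exact absurd rfl hxy
      · exact hc y hy
      · exact (hc x hx).symm
      · exact h2 x hx y hy hxy⟩
    rw [Finset.card_insert_of_notMem huT] at this
    omega
  choose! f hfT hf using hex
  refine ⟨T, h0, h1, h2, f, hfT, fun u hu v hv => ⟨fun huv he => ?_, fun he => ?_⟩⟩
  · have := hS u hu _ (h1 _ (hfT u hu)) v hv (hf u hu) huv
    exact hf v hv (he ▸ this).symm
  · by_contra huv
    have h3 := h2 _ (hfT u hu) _ (hfT v hv) he
    have h4 := hS _ (h1 _ (hfT u hu)) u hu _ (h1 _ (hfT v hv)) (fun h => hf u hu h.symm) h3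
    exact hf v hv (hS u hu v hv _ (h1 _ (hfT v hv)) huv h4)

/-- A `K₁ + K₂` in `S` together with `cd` would be `K₁ + 2K₂`, so `S` is complete multipartite. If
it is a clique, one of the two sides has at most `s` vertices, as `2K_{s+1}` is excluded. If not,
more than `s` parts, one of them containing two vertices, would give `K₂ + (K_s ⊕ 2K₁)`. -/
theorem polarOn_of_two_edges [Finite V] {s : ℕ} {S : Set V}
    (hcut : ∀ x ∈ S, ∀ y ∉ S, ¬ G.Adj x y)
    (e1 : ¬ Nonempty (K 1 ⊕g (K 2 ⊕g K 2) ↪g G))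
    (n1 : ¬ Nonempty (K (s + 1) ⊕g K (s + 1) ↪g G))
    (n2 : ¬ Nonempty (K 2 ⊕g join (K s) (K 1 ⊕g K 1) ↪g G))
    {c d : V} (hc : c ∉ S) (hd : d ∉ S) (hcd : G.Adj c d)
    (hclique : ∀ u ∉ S, ∀ v ∉ S, u ≠ v → G.Adj u v) :
    PolarOn G Set.univ s := by
  classical
  have := Fintype.ofFinite V
  have hap : ∀ x ∈ S, ∀ y ∉ S, Apart G x y := fun x hx y hy =>
    ⟨by rintro rfl; exact hy hx, hcut x hx y hy⟩
  have hap' : ∀ x ∉ S, ∀ y ∈ S, Apart G x y := fun x hx y hy =>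
    ⟨(hap y hy x hx).1.symm, fun h => (hap y hy x hx).2 h.symm⟩
  have hS : IsMultipartiteOn G S := by
    intro u hu v hv w hw huv huw
    by_contra hvw
    refine e1 (embedding_K1_twoK2 (x := v) ⟨huw, hcd, hcut u hu c hc, hcut u hu d hd,
      hcut w hw c hc, hcut w hw d hd⟩ ⟨?_, fun h => huv h.symm⟩ ⟨?_, hvw⟩ (hap v hv c hc)
      (hap v hv d hd))
    · rintro rfl; exact hvw huw
    · rintro rfl; exact huv huw
  by_cases hcl : ∀ u ∈ S, ∀ v ∈ S, u ≠ v → G.Adj u v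
  · by_cases h1 : s + 1 ≤ S.toFinset.card
    · by_cases h2 : s + 1 ≤ Sᶜ.toFinset.card
      · exact absurd (embedding_twoK h1 h2 (by simpa using hcl) (by simpa using hclique)
          (by simpa using hap)) n1
      · refine PolarOn.of_labels Sᶜ id Sᶜ.toFinset (by omega) (by simp) ?_ ?_
        · intro u _ hu v _ hv
          exact ⟨fun h => h.ne, hclique u hu v hv⟩
        · intro u _ hu v _ hv
          simp only [Set.mem_compl_iff, not_not] at hu hv
          exact hcl u hu v hv
    · refine PolarOn.of_labels S id S.toFinset (by omega) (by simp) ?_ ?_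
      · intro u _ hu v _ hv
        exact ⟨fun h => h.ne, hcl u hu v hv⟩
      · exact fun u _ hu v _ hv => hclique u hu v hv
  · push Not at hcl
    obtain ⟨p, hp, q, hq, hpq, hpq'⟩ := hcl
    obtain ⟨T, hT0, hTS, hT, f, hf, hf'⟩ := hS.exists_transversal {p} (by simpa using hp) (by simp)
    have hpT : p ∈ T := hT0 (by simp)
    by_cases hcard : T.card ≤ s
    · exact PolarOn.of_labels S f T hcard (fun u _ hu => hf u hu)
        (fun u _ hu v _ hv => hf' u hu v hv) fun u _ hu v _ hv => hclique u hu v hv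
    · have hpT' : ∀ x ∈ T.erase p, G.Adj x p := fun x hx =>
        hT x (Finset.mem_of_mem_erase hx) p hpT (Finset.ne_of_mem_erase hx)
      refine absurd (embedding_K2_join (T := T.erase p) (p := p) (q := q) ?_ ?_ hpT' ?_
        ⟨hpq, hpq'⟩ hcd ?_) n2
      · rw [Finset.card_erase_of_mem hpT]
        omega
      · exact fun x hx y hy => hT x (Finset.mem_of_mem_erase hx) y (Finset.mem_of_mem_erase hy)
      · exact fun x hx => (hS p hp q hq x (hTS x (Finset.mem_of_mem_erase hx)) hpq'
          (hpT' x hx).symm).symm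
      · intro x hx
        have hxS : x ∈ S := by
          rcases hx with hx | rfl | rfl
          · exact hTS x (Finset.mem_of_mem_erase hx)
          · exact hp
          · exact hq
        exact ⟨hap' c hc x hxS, hap' d hd x hxS⟩

/-- If every vertex of `S` sees every four-cycle of `S` like a vertex of a complete multipartite
graph, and there is a four-cycle in `S`, then `S` is complete multipartite. -/
theorem isMultipartiteOn_of_isC4 {S : Set V} {a b a' b' : V} (h : IsC4 G a b a' b')
    (ha : a ∈ S) (hb : b ∈ S) (ha' : a' ∈ S) (hb' : b' ∈ S)
    (H : ∀ p q p' q', IsC4 G p q p' q' → p ∈ S → q ∈ S → p' ∈ S → q' ∈ S → ∀ x ∈ S,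
      (G.Adj x p ↔ G.Adj x p') ∧ (G.Adj x q ↔ G.Adj x q') ∧ (G.Adj x p ∨ G.Adj x q)) :
    IsMultipartiteOn G S := by
  obtain ⟨h1, h2, h3, h4, h5, h6, h7, h8⟩ := h
  intro u hu v hv w hw huv huw
  by_contra hvw
  have huv' : u ≠ v := by rintro rfl; exact hvw huw
  have hvw' : v ≠ w := by rintro rfl; exact huv huw
  have h0 : ∀ x ∈ S, (G.Adj x a ↔ G.Adj x a') ∧ (G.Adj x b ↔ G.Adj x b') ∧
      (G.Adj x a ∨ G.Adj x b) := H a b a' b' ⟨h1, h2, h3, h4, h5, h6, h7, h8⟩ ha hb ha' hb'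
  -- substituting `x` for `a` or `b` in the four-cycle
  have hA : ∀ x ∈ S, ¬ G.Adj x a → x ≠ a → ∀ y ∈ S, (G.Adj y x ↔ G.Adj y a) := by
    intro x hx hxa hne y hy
    have hxb := (h0 x hx).2.2.resolve_left hxa
    exact (H x b a b' ⟨hxb, h1.symm, h4.symm, ((h0 x hx).2.1.1 hxb).symm, hxa, h6, hne, h8⟩
      hx hb ha hb' y hy).1
  have hB : ∀ x ∈ S, ¬ G.Adj x b → x ≠ b → ∀ y ∈ S, (G.Adj y x ↔ G.Adj y b) := by
    intro x hx hxb hne y hy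
    have hxa := (h0 x hx).2.2.resolve_right hxb
    exact (H a x a' b ⟨hxa.symm, (h0 x hx).1.1 hxa, h2.symm, h1.symm, h5, hxb, h7, hne⟩
      ha hx ha' hb y hy).2.1
  -- Here `a x a' y` is a four-cycle, so every vertex of `S` treats `x` and `y` alike.
  have hF : ∀ x ∈ S, G.Adj x a → G.Adj x b → ∀ y ∈ S, G.Adj y a → G.Adj y b → ¬ G.Adj x y →
      x ≠ y → ∀ z ∈ S, (G.Adj z x ↔ G.Adj z y) := by
    intro x hx hxa hxb y hy hya hyb hxy hne z hz
    have hxa' := (h0 x hx).1.1 hxa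
    have hya' := (h0 y hy).1.1 hya
    exact (H a x a' y ⟨hxa.symm, hxa', hya'.symm, hya, h5, hxy, h7, hne⟩ ha hx ha' hy z hz).2.1
  -- Distinct non-adjacent vertices are twins: both behave like `a`, both like `b`, or both are
  -- joined to `a` and `b`.
  have key : ∀ x ∈ S, ∀ y ∈ S, x ≠ y → ¬ G.Adj x y → ∀ z ∈ S, G.Adj z x → G.Adj z y := by
    intro x hx y hy hne hxy z hz hzx
    have hyx : ¬ G.Adj y x := fun h => hxy h.symm
    by_cases hxa : G.Adj x a
    · by_cases hxb : G.Adj x b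
      · by_cases hya : G.Adj y a
        · by_cases hyb : G.Adj y b
          · exact (hF x hx hxa hxb y hy hya hyb hxy hne z hz).1 hzx
          · by_cases hyb' : y = b
            · subst hyb'; exact absurd hxb hxy
            · exact absurd ((hB y hy hyb hyb' x hx).2 hxb) hxy
        · by_cases hya' : y = a
          · subst hya'; exact absurd hxa hxy
          · exact absurd ((hA y hy hya hya' x hx).2 hxa) hxy
      · by_cases hxb' : x = b
        · subst hxb'
          exact ((hB y hy hyx hne.symm z hz).2 hzx)
        · have hzb := (hB x hx hxb hxb' z hz).1 hzx
          have hyb : ¬ G.Adj y b := fun h => hyx ((hB x hx hxb hxb' y hy).2 h)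
          by_cases hyb' : y = b
          · subst hyb'; exact hzb
          · exact (hB y hy hyb hyb' z hz).2 hzb
    · by_cases hxa' : x = a
      · subst hxa'
        exact ((hA y hy hyx hne.symm z hz).2 hzx)
      · have hza := (hA x hx hxa hxa' z hz).1 hzx
        have hya : ¬ G.Adj y a := fun h => hyx ((hA x hx hxa hxa' y hy).2 h)
        by_cases hya' : y = a
        · subst hya'; exact hza
        · exact (hA y hy hya hya' z hz).2 hza
  exact hvw (key u hu v hv huv' huv w hw huw.symm).symm

end Classification

/-! ### Classification of the disconnected obstructions -/

section DisconnectedClassification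

variable {G : SimpleGraph V}

theorem PolarOn.of_split {U : Set V} {s : ℕ} (hs : 1 ≤ s) (K : Set V)
    (h1 : ∀ x ∈ U, x ∈ K → ∀ y ∈ U, y ∈ K → x ≠ y → G.Adj x y)
    (h2 : ∀ x ∈ U, x ∉ K → ∀ y ∈ U, y ∉ K → ¬ G.Adj x y) : PolarOn G U s := by
  refine PolarOn.of_labels Kᶜ (fun _ => ()) Finset.univ (by simpa using hs) (by simp) ?_ ?_
  · intro u hu huK v hv hvK
    simpa using h2 u hu huK v hv hvK
  · intro u hu huK v hv hvK
    simp only [Set.mem_compl_iff, not_not] at huK hvK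
    exact h1 u hu huK v hv hvK

/-- The vertex `y` is isolated, so the remaining graph has no `2K₂` and no `C₅`; without a `C₄` the
graph is split. With a `C₄`, `y` is the only vertex outside `S` and `S` is complete multipartite; an
excess of parts gives `K₁ + (K_{s-1} ⊕ C₄)`. -/
theorem polarOn_of_independent_side [Finite V] {s : ℕ} {S : Set V} (hs : 2 ≤ s)
    (hcut : ∀ x ∈ S, ∀ y ∉ S, ¬ G.Adj x y) (hind : ∀ x ∉ S, ∀ y ∉ S, ¬ G.Adj x y)
    {y : V} (hy : y ∉ S)
    (e1 : ¬ Nonempty (K 1 ⊕g (K 2 ⊕g K 2) ↪g G))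
    (e3 : ¬ Nonempty (cycleGraph 4 ⊕g (K 1 ⊕g K 1) ↪g G))
    (e4 : ¬ Nonempty (K 1 ⊕g (pathGraph 3 ⊕g K 2)ᶜ ↪g G))
    (e5 : ¬ Nonempty (K 1 ⊕g cycleGraph 5 ↪g G))
    (e6 : ¬ Nonempty (K 1 ⊕g banner ↪g G))
    (e7 : ¬ Nonempty (K 1 ⊕g (pathGraph 5)ᶜ ↪g G))
    (n3 : ¬ Nonempty (K 1 ⊕g join (K (s - 1)) (cycleGraph 4) ↪g G)) :
    PolarOn G Set.univ s := by
  classical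
  have hap : ∀ x ∈ S, ∀ y ∉ S, Apart G y x := fun x hx y hy =>
    ⟨by rintro rfl; exact hy hx, fun h => hcut x hx y hy h.symm⟩
  have hmem : ∀ {u v}, G.Adj u v → u ∈ S := by
    intro u v huv
    by_contra hu
    by_cases hv : v ∈ S
    · exact hcut v hv u hu huv.symm
    · exact hind u hu v hv huv
  by_cases hC4 : ∃ a b a' b', IsC4 G a b a' b'
  swap
  · push Not at hC4
    obtain ⟨K, hK, hK'⟩ := exists_split G
      (fun a b c d h => e1 (embedding_K1_twoK2 h (hap a (hmem h.ab) y hy)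
        (hap b (hmem h.ab.symm) y hy) (hap c (hmem h.cd) y hy) (hap d (hmem h.cd.symm) y hy)))
      hC4
      (fun a b c d e h => e5 (embedding_K1_C5 h (y := y) (by
        rintro z (rfl | rfl | rfl | rfl | rfl)
        · exact hap _ (hmem h.ab) y hy
        · exact hap _ (hmem h.bc) y hy
        · exact hap _ (hmem h.cd) y hy
        · exact hap _ (hmem h.de) y hy
        · exact hap _ (hmem h.ea) y hy)))
    exact PolarOn.of_split (by omega) K (fun x _ hx y _ hy => hK x hx y hy)
      fun x _ hx y _ hy => hK' x hx y hy
  obtain ⟨a, b, a', b', hC⟩ := hC4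
  have hCS : ∀ {p q p' q'}, IsC4 G p q p' q' →
      ∀ z, (z = p ∨ z = q ∨ z = p' ∨ z = q') → z ∈ S := by
    rintro p q p' q' h z (rfl | rfl | rfl | rfl)
    · exact hmem h.ab
    · exact hmem h.bc
    · exact hmem h.cd
    · exact hmem h.da
  have huniq : ∀ x ∉ S, x = y := by
    intro x hx
    by_contra hne
    exact e3 (embedding_C4_twoK1 hC (fun z hz => hap z (hCS hC z hz) x hx)
      (fun z hz => hap z (hCS hC z hz) y hy) ⟨hne, hind x hx y hy⟩)
  -- A vertex off the cycle sees an opposite pair or all of it. Seeing none, one, two consecutive or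
  -- three vertices gives, together with `y`, the graphs `C₄ + 2K₁`, `K₁ + P`, `K₁ + P₅ᶜ` and `K₁ +
  -- (P₃ + K₂)ᶜ`.
  have H : ∀ p q p' q', IsC4 G p q p' q' → p ∈ S → q ∈ S → p' ∈ S → q' ∈ S → ∀ x ∈ S,
      (G.Adj x p ↔ G.Adj x p') ∧ (G.Adj x q ↔ G.Adj x q') ∧ (G.Adj x p ∨ G.Adj x q) := by
    intro p q p' q' h _ _ _ _ x hx
    have hY : ∀ z, (z = p ∨ z = q ∨ z = p' ∨ z = q' ∨ z = x) → Apart G y z := by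
      intro z hz
      refine hap z ?_ y hy
      rcases hz with h' | h' | h' | h' | rfl
      · exact hCS h z (by simp [h'])
      · exact hCS h z (by simp [h'])
      · exact hCS h z (by simp [h'])
      · exact hCS h z (by simp [h'])
      · exact hx
    by_cases hxp : x = p
    · subst hxp; simp [h.ab, h.ac, h.da.symm]
    by_cases hxq : x = q
    · subst hxq; simp [h.ab.symm, h.bc, h.bd]
    by_cases hxp' : x = p'
    · subst hxp'
      have : ¬ G.Adj x p := fun h' => h.ac h'.symm
      simp [this, h.cd, h.bc.symm]
    by_cases hxq' : x = q'
    · subst hxq'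
      have : ¬ G.Adj x q := fun h' => h.bd h'.symm
      simp [this, h.da, h.cd.symm]
    have r1 : IsC4 G q p' q' p := ⟨h.bc, h.cd, h.da, h.ab, h.bd, fun h' => h.ac h'.symm, h.bd_ne,
      h.ac_ne.symm⟩
    have r2 : IsC4 G p' q' p q := ⟨h.cd, h.da, h.ab, h.bc, fun h' => h.ac h'.symm,
      fun h' => h.bd h'.symm, h.ac_ne.symm, h.bd_ne.symm⟩
    have r3 : IsC4 G q' p q p' := ⟨h.da, h.ab, h.bc, h.cd, fun h' => h.bd h'.symm, h.ac,
      h.bd_ne.symm, h.ac_ne⟩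
    have y1 : ∀ z, (z = q ∨ z = p' ∨ z = q' ∨ z = p ∨ z = x) → Apart G y z :=
      fun z hz => hY z (by tauto)
    have y2 : ∀ z, (z = p' ∨ z = q' ∨ z = p ∨ z = q ∨ z = x) → Apart G y z :=
      fun z hz => hY z (by tauto)
    have y3 : ∀ z, (z = q' ∨ z = p ∨ z = q ∨ z = p' ∨ z = x) → Apart G y z :=
      fun z hz => hY z (by tauto)
    have hyC : ∀ z, (z = p ∨ z = q ∨ z = p' ∨ z = q') → Apart G y z :=
      fun z hz => hY z (by tauto)
    by_cases ap : G.Adj x p <;> by_cases aq : G.Adj x q <;> by_cases ap' : G.Adj x p' <;>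
      by_cases aq' : G.Adj x q'
    · simp [ap, aq, ap', aq']
    · exact absurd (embedding_K1_compl_P3_K2 h hY ap aq ap' ⟨hxq', aq'⟩) e4
    · exact absurd (embedding_K1_compl_P3_K2 r3 y3 aq' ap aq ⟨hxp', ap'⟩) e4
    · exact absurd (embedding_K1_compl_P5 h hY ap aq ⟨hxp', ap'⟩ ⟨hxq', aq'⟩) e7
    · exact absurd (embedding_K1_compl_P3_K2 r2 y2 ap' aq' ap ⟨hxq, aq⟩) e4
    · simp [ap, aq, ap', aq']
    · exact absurd (embedding_K1_compl_P5 r3 y3 aq' ap ⟨hxq, aq⟩ ⟨hxp', ap'⟩) e7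
    · exact absurd (embedding_K1_banner r2 y2 ⟨hxp', ap'⟩ ⟨hxq', aq'⟩ ap ⟨hxq, aq⟩) e6
    · exact absurd (embedding_K1_compl_P3_K2 r1 y1 aq ap' aq' ⟨hxp, ap⟩) e4
    · exact absurd (embedding_K1_compl_P5 r1 y1 aq ap' ⟨hxq', aq'⟩ ⟨hxp, ap⟩) e7
    · simp [ap, aq, ap', aq']
    · exact absurd (embedding_K1_banner r3 y3 ⟨hxq', aq'⟩ ⟨hxp, ap⟩ aq ⟨hxp', ap'⟩) e6
    · exact absurd (embedding_K1_compl_P5 r2 y2 ap' aq' ⟨hxp, ap⟩ ⟨hxq, aq⟩) e7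
    · exact absurd (embedding_K1_banner h hY ⟨hxp, ap⟩ ⟨hxq, aq⟩ ap' ⟨hxq', aq'⟩) e6
    · exact absurd (embedding_K1_banner r1 y1 ⟨hxq, aq⟩ ⟨hxp', ap'⟩ aq' ⟨hxp, ap⟩) e6
    · refine absurd (embedding_C4_twoK1 h (x := y) (y := x) hyC ?_ (hY x (by simp))) e3
      rintro z (rfl | rfl | rfl | rfl)
      exacts [⟨hxp, ap⟩, ⟨hxq, aq⟩, ⟨hxp', ap'⟩, ⟨hxq', aq'⟩]
  have haS : a ∈ S := hmem hC.ab
  have hbS : b ∈ S := hmem hC.bc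
  have hM : IsMultipartiteOn G S := isMultipartiteOn_of_isC4 hC haS hbS (hmem hC.cd)
    (hmem hC.da) H
  obtain ⟨T, hT0, hTS, hT, f, hf, hf'⟩ := hM.exists_transversal {a, b} (by simp [haS, hbS]) (by
    have h1 := hC.ab
    have h2 := hC.ab.symm
    simp [h1, h2])
  have haT : a ∈ T := hT0 (by simp)
  have hbT : b ∈ T := hT0 (by simp)
  by_cases hcard : T.card ≤ s
  · exact PolarOn.of_labels S f T hcard (fun u _ hu => hf u hu)
      (fun u _ hu v _ hv => hf' u hu v hv)
      fun u _ hu v _ hv huv => absurd ((huniq u hu).trans (huniq v hv).symm) huv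
  -- The parts of `a` and `b` supply the four-cycle, leaving at least `s - 1` further parts.
  · have hmemT : ∀ x ∈ (T.erase a).erase b, x ≠ b ∧ x ≠ a ∧ x ∈ T := by simp
    refine absurd (embedding_K1_join (s := s) (T := (T.erase a).erase b) (y := y) ?_ ?_ hC
      ?_ ?_) n3
    · rw [Finset.card_erase_of_mem (by simp [hbT, hC.ab.ne']), Finset.card_erase_of_mem haT]
      omega
    · exact fun x hx z hz => hT x (hmemT x hx).2.2 z (hmemT z hz).2.2
    · intro x hx
      obtain ⟨h1, h2, h3⟩ := hmemT x hx
      have h4 := hT x h3 a haT h2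
      have h5 := hT x h3 b hbT h1
      have := H a b a' b' hC haS hbS (hmem hC.cd) (hmem hC.da) x (hTS x h3)
      exact ⟨h4, h5, this.1.1 h4, this.2.1.1 h5⟩
    · rintro x (hx | hx)
      · exact hap x (hTS x (hmemT x hx).2.2) y hy
      · exact hap x (hCS hC x hx) y hy

/-- The disconnected minimal `(s, 1)`-polar obstructions, `s ≥ 2`. -/
theorem IsMinimalPolarObstruction.isEssential_or_isSpecialDisconnected [Finite V] {s : ℕ}
    (hs : 2 ≤ s) (hG : IsMinimalPolarObstruction G s 1) (hc : ¬ G.Preconnected) :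
    IsEssential G ∨ IsSpecialDisconnected G s := by
  by_contra hcon
  unfold IsEssential IsSpecialDisconnected at hcon
  push Not at hcon
  obtain ⟨⟨c1, c2, c3, c4, c5, c6, c7⟩, d1, d2, d3⟩ := hcon
  -- An induced copy of a non-polar graph would be all of `G`; the same reason excludes all ten
  -- graphs.
  have e1 : ¬ Nonempty (K 1 ⊕g (K 2 ⊕g K 2) ↪g G) := fun ⟨φ⟩ =>
    not_isEmpty_iff.2 (hG.nonempty_iso φ (not_isPolar_K1_twoK2 s)) c1
  have e2 : ¬ Nonempty (pathGraph 3 ⊕g pathGraph 3 ↪g G) := fun ⟨φ⟩ =>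
    not_isEmpty_iff.2 (hG.nonempty_iso φ (not_isPolar_twoP3 s)) c2
  have e3 : ¬ Nonempty (cycleGraph 4 ⊕g (K 1 ⊕g K 1) ↪g G) := fun ⟨φ⟩ =>
    not_isEmpty_iff.2 (hG.nonempty_iso φ (not_isPolar_C4_twoK1 s)) c3
  have e4 : ¬ Nonempty (K 1 ⊕g (pathGraph 3 ⊕g K 2)ᶜ ↪g G) := fun ⟨φ⟩ =>
    not_isEmpty_iff.2 (hG.nonempty_iso φ (not_isPolar_K1_compl_P3_K2 s)) c4
  have e5 : ¬ Nonempty (K 1 ⊕g cycleGraph 5 ↪g G) := fun ⟨φ⟩ =>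
    not_isEmpty_iff.2 (hG.nonempty_iso φ (not_isPolar_K1_C5 s)) c5
  have e6 : ¬ Nonempty (K 1 ⊕g banner ↪g G) := fun ⟨φ⟩ =>
    not_isEmpty_iff.2 (hG.nonempty_iso φ (not_isPolar_K1_banner s)) c6
  have e7 : ¬ Nonempty (K 1 ⊕g (pathGraph 5)ᶜ ↪g G) := fun ⟨φ⟩ =>
    not_isEmpty_iff.2 (hG.nonempty_iso φ (not_isPolar_K1_compl_P5 s)) c7
  have n1 : ¬ Nonempty (K (s + 1) ⊕g K (s + 1) ↪g G) := fun ⟨φ⟩ =>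
    not_isEmpty_iff.2 (hG.nonempty_iso φ (not_isPolar_twoK s)) d1
  have n2 : ¬ Nonempty (K 2 ⊕g join (K s) (K 1 ⊕g K 1) ↪g G) := fun ⟨φ⟩ =>
    not_isEmpty_iff.2 (hG.nonempty_iso φ (not_isPolar_K2_join s)) d2
  have n3 : ¬ Nonempty (K 1 ⊕g join (K (s - 1)) (cycleGraph 4) ↪g G) := fun ⟨φ⟩ =>
    not_isEmpty_iff.2 (hG.nonempty_iso φ (not_isPolar_K1_join s hs)) d3
  refine hG.1 (isPolar_iff.2 ?_)
  obtain ⟨S, -, ⟨x, hx⟩, ⟨y, -, hy⟩, hcut⟩ := not_preconnected_iff.1 hc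
  replace hcut : ∀ x ∈ S, ∀ y ∉ S, ¬ G.Adj x y := fun x hx y hy => hcut x hx y trivial hy
  have hcut' : ∀ x ∈ Sᶜ, ∀ y ∉ Sᶜ, ¬ G.Adj x y := fun x hx y hy h =>
    hcut y (by simpa using hy) x hx h.symm
  by_cases h1 : ∃ a ∈ S, ∃ b ∈ S, G.Adj a b
  swap
  · push Not at h1
    exact polarOn_of_independent_side hs hcut' (by simpa using h1) (y := x) (by simpa using hx)
      e1 e3 e4 e5 e6 e7 n3
  by_cases h2 : ∃ c ∉ S, ∃ d ∉ S, G.Adj c d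
  swap
  · push Not at h2
    exact polarOn_of_independent_side hs hcut h2 hy e1 e3 e4 e5 e6 e7 n3
  -- both sides contain edges: one of them is a clique
  have clique : ∀ S : Set V, (∀ x ∈ S, ∀ y ∉ S, ¬ G.Adj x y) → (∃ a ∈ S, ∃ b ∈ S, G.Adj a b) →
      (∃ c ∉ S, ∃ d ∉ S, G.Adj c d) → (¬ ∃ a ∈ S, ∃ b ∈ S, ∃ c ∈ S, G.Adj a b ∧ G.Adj b c ∧
        Apart G a c) → ∀ u ∈ S, ∀ v ∈ S, u ≠ v → G.Adj u v := by
    rintro S hcut ⟨a, ha, b, hb, hab⟩ ⟨c, hc, d, hd, hcd⟩ hP3 u hu v hv huv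
    have hap : ∀ x ∈ S, ∀ y ∉ S, Apart G x y := fun x hx y hy =>
      ⟨by rintro rfl; exact hy hx, hcut x hx y hy⟩
    have hS : IsMultipartiteOn G S := by
      intro u hu v hv w hw huv huw
      by_contra hvw
      refine e1 (embedding_K1_twoK2 (x := v) ⟨huw, hcd, hcut u hu c hc, hcut u hu d hd,
        hcut w hw c hc, hcut w hw d hd⟩ ⟨?_, fun h => huv h.symm⟩ ⟨?_, hvw⟩ (hap v hv c hc)
        (hap v hv d hd))
      · rintro rfl; exact hvw huw
      · rintro rfl; exact huv huw
    by_contra hnuv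
    -- In a multipartite side `u` sees an end of the edge `ab`, and so does `v`, which gives an
    -- induced `P₃`.
    by_cases hua : G.Adj u a
    · exact hP3 ⟨u, hu, a, ha, v, hv, hua, (hS u hu v hv a ha hnuv hua).symm, huv, hnuv⟩
    · have hub : G.Adj u b := hS a ha u hu b hb (fun h => hua h.symm) hab
      exact hP3 ⟨u, hu, b, hb, v, hv, hub, (hS u hu v hv b hb hnuv hub).symm, huv, hnuv⟩
  by_cases hP : ∃ a ∈ S, ∃ b ∈ S, ∃ c ∈ S, G.Adj a b ∧ G.Adj b c ∧ Apart G a c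
  · by_cases hP' : ∃ a ∈ Sᶜ, ∃ b ∈ Sᶜ, ∃ c ∈ Sᶜ, G.Adj a b ∧ G.Adj b c ∧ Apart G a c
    · obtain ⟨a, ha, b, hb, c, hc, hab, hbc, hac⟩ := hP
      obtain ⟨d, hd, e, he, f, hf, hde, hef, hdf⟩ := hP'
      refine absurd (embedding_twoP3 hab hbc hac hde hef hdf ?_) e2
      intro p q hp hq
      have hp' : p ∈ S := by rcases hp with rfl | rfl | rfl <;> assumption
      have hq' : q ∉ S := by rcases hq with rfl | rfl | rfl <;> assumption
      exact ⟨by rintro rfl; exact hq' hp', hcut p hp' q hq'⟩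
    · obtain ⟨c, hc, d, hd, hcd⟩ := h2
      exact polarOn_of_two_edges hcut e1 n1 n2 hc hd hcd
        (clique Sᶜ hcut' ⟨c, hc, d, hd, hcd⟩ (by simpa using h1) hP')
  · obtain ⟨a, ha, b, hb, hab⟩ := id h1
    exact polarOn_of_two_edges hcut' e1 n1 n2 (by simpa using ha) (by simpa using hb) hab
      (by simpa using clique S hcut h1 h2 hP)

end DisconnectedClassification

/-! ### Hulls of induced paths in `P₄`-extendible graphs -/

section Extendible

variable {G : SimpleGraph V} {a b c d : V}

theorem IsP4.symm (h : IsP4 G a b c d) : IsP4 G d c b a :=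
  ⟨h.cd.symm, h.bc.symm, h.ab.symm, fun h' => h.bd h'.symm, fun h' => h.ad h'.symm,
    fun h' => h.ac h'.symm⟩

theorem IsP4.ne (h : IsP4 G a b c d) : a ≠ c ∧ a ≠ d ∧ b ≠ d := by
  refine ⟨?_, ?_, ?_⟩
  · rintro rfl; exact h.ad h.cd
  · rintro rfl; exact h.ac h.cd.symm
  · rintro rfl; exact h.ad h.ab

theorem IsP4.inducesP4 (h : IsP4 G a b c d) : InducesP4 G {a, b, c, d} := by
  obtain ⟨h1, h2, h3⟩ := h.ne
  obtain ⟨h4, h5, h6, h7, h8, h9⟩ := h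
  have p01 : (pathGraph 4).Adj 0 1 := by decide
  have p12 : (pathGraph 4).Adj 1 2 := by decide
  have p23 : (pathGraph 4).Adj 2 3 := by decide
  have p02 : ¬ (pathGraph 4).Adj 0 2 := by decide
  have p13 : ¬ (pathGraph 4).Adj 1 3 := by decide
  have p03 : ¬ (pathGraph 4).Adj 0 3 := by decide
  obtain ⟨φ⟩ : Nonempty (pathGraph 4 ↪g G.induce {a, b, c, d}) := by
    refine nonempty_embedding ![⟨a, by simp⟩, ⟨b, by simp⟩, ⟨c, by simp⟩, ⟨d, by simp⟩] ?_
    intro u v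
    fin_cases u <;> fin_cases v <;> simp <;> grind [SimpleGraph.Adj.symm, SimpleGraph.irrefl]
  have hφ : Function.Injective (Subtype.val ∘ φ) := Subtype.val_injective.comp φ.injective
  refine ⟨(RelIso.ofSurjective φ ?_).symm⟩
  have h1 : Finite ({a, b, c, d} : Set V) := Set.toFinite _
  have h2 : Nat.card ({a, b, c, d} : Set V) ≤ Nat.card (Fin 4) := by
    classical
    rw [Nat.card_coe_set_eq, Nat.card_eq_fintype_card, Fintype.card_fin]
    have := Set.ncard_coe_finset ({a, b, c, d} : Finset V)
    push_cast at this
    rw [this]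
    exact Finset.card_le_four
  exact (Function.Injective.bijective_of_nat_card_le φ.injective h2).2

theorem InducesP4.exists_isP4 {U : Set V} (h : InducesP4 G U) :
    ∃ a b c d, IsP4 G a b c d ∧ U = {a, b, c, d} := by
  obtain ⟨e⟩ := h
  have key : ∀ i j, G.Adj (e.symm i) (e.symm j) ↔ (pathGraph 4).Adj i j := fun i j =>
    e.symm.map_adj_iff
  refine ⟨e.symm 0, e.symm 1, e.symm 2, e.symm 3, ⟨?_, ?_, ?_, ?_, ?_, ?_⟩, ?_⟩
  iterate 6 rw [key]; decide
  ext x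
  constructor
  · intro hx
    have : x = e.symm (e ⟨x, hx⟩) := by simp
    generalize e ⟨x, hx⟩ = i at this
    fin_cases i <;> simp_all
  · rintro (rfl | rfl | rfl | rfl) <;> exact Subtype.coe_prop _

theorem IsP4Extendible.of_embedding {H : SimpleGraph W} (hG : IsP4Extendible G) (φ : H ↪g G) :
    IsP4Extendible H := by
  have key : ∀ U : Set W, InducesP4 H U → InducesP4 G (φ '' U) := by
    intro U hU
    obtain ⟨a, b, c, d, h, rfl⟩ := hU.exists_isP4
    have : IsP4 G (φ a) (φ b) (φ c) (φ d) := by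
      constructor <;> rw [φ.map_adj_iff]
      exacts [h.ab, h.bc, h.cd, h.ac, h.ad, h.bd]
    simpa [Set.image_insert_eq] using this.inducesP4
  intro U hU x hx y hy
  have h : ∀ x ∈ extensionVertices H U, φ x ∈ extensionVertices G (φ '' U) := by
    rintro x ⟨hx, U', hU', hxU', w, hw, hw'⟩
    exact ⟨by simpa using hx, _, key U' hU', ⟨x, hxU', rfl⟩, φ w, ⟨w, hw, rfl⟩, ⟨w, hw', rfl⟩⟩
  exact φ.injective (hG _ (key U hU) (h x hx) (h y hy))

theorem IsP4.mem_extensionVertices {U : Set V} (h : IsP4 G a b c d) {x w : V} (hx : x ∉ U)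
    (hx' : x = a ∨ x = b ∨ x = c ∨ x = d) (hw : w = a ∨ w = b ∨ w = c ∨ w = d) (hw' : w ∈ U) :
    x ∈ extensionVertices G U :=
  ⟨hx, _, h.inducesP4, hx', w, hw', hw⟩

/-- The path `a b c d`, its extension vertex and the vertices adjacent to `b` and `c` only. -/
def hull (G : SimpleGraph V) (a b c d : V) : Set V :=
  {v | v ∈ ({a, b, c, d} : Set V) ∨ v ∈ extensionVertices G {a, b, c, d} ∨
    (¬ G.Adj v a ∧ G.Adj v b ∧ G.Adj v c ∧ ¬ G.Adj v d)}

/-- Any mixed adjacency pattern except the middle one puts `v` into an induced path with three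
vertices of `a b c d`, making it an extension vertex. The middle pattern belongs to the hull by
definition. -/
theorem IsP4.total_or_null (h : IsP4 G a b c d) {v : V} (hv : v ∉ hull G a b c d) :
    (G.Adj v a ∧ G.Adj v b ∧ G.Adj v c ∧ G.Adj v d) ∨
      (¬ G.Adj v a ∧ ¬ G.Adj v b ∧ ¬ G.Adj v c ∧ ¬ G.Adj v d) := by
  simp only [hull, Set.mem_ofPred_eq, not_or] at hv
  obtain ⟨hvW, hvE, hmid⟩ := hv
  have key : ∀ {p q r s}, IsP4 G p q r s → (v = p ∨ v = q ∨ v = r ∨ v = s) →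
      ((b = p ∨ b = q ∨ b = r ∨ b = s) ∨ (c = p ∨ c = q ∨ c = r ∨ c = s)) → False := by
    rintro p q r s h' hv (hw | hw)
    · exact hvE (h'.mem_extensionVertices hvW hv hw (by simp))
    · exact hvE (h'.mem_extensionVertices hvW hv hw (by simp))
  obtain ⟨h1, h2, h3, h4, h5, h6⟩ := h
  have s4 : ¬ G.Adj c a := fun h => h4 h.symm
  have s5 : ¬ G.Adj d a := fun h => h5 h.symm
  have s6 : ¬ G.Adj d b := fun h => h6 h.symm
  by_cases ha : G.Adj v a <;> by_cases hb : G.Adj v b <;> by_cases hc : G.Adj v c <;>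
    by_cases hd : G.Adj v d
  · simp [ha, hb, hc, hd]
  · exact (key ⟨ha.symm, hc, h3, h4, h5, hd⟩ (by simp) (by simp)).elim
  · exact (key ⟨ha.symm, hd, h3.symm, h5, h4, hc⟩ (by simp) (by simp)).elim
  · exact (key ⟨hb, h2, h3, hc, hd, h6⟩ (by simp) (by simp)).elim
  · exact (key ⟨hd.symm, ha, h1, s5, s6, hb⟩ (by simp) (by simp)).elim
  · exact (key ⟨h3.symm, hc.symm, ha, fun h => hd h.symm, s5, s4⟩ (by simp) (by simp)).elim
  · exact (key ⟨ha, h1, h2, hb, hc, h4⟩ (by simp) (by simp)).elim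
  · exact (key ⟨ha, h1, h2, hb, hc, h4⟩ (by simp) (by simp)).elim
  · exact (key ⟨hd.symm, hb, h1.symm, s6, s5, ha⟩ (by simp) (by simp)).elim
  · exact absurd ⟨ha, hb, hc, hd⟩ hmid
  · exact (key ⟨h1, hb.symm, hd, fun h => ha h.symm, h5, h6⟩ (by simp) (by simp)).elim
  · exact (key ⟨hb, h2, h3, hc, hd, h6⟩ (by simp) (by simp)).elim
  · exact (key ⟨hc, h2.symm, h1.symm, hb, ha, s4⟩ (by simp) (by simp)).elim
  · exact (key ⟨hc, h2.symm, h1.symm, hb, ha, s4⟩ (by simp) (by simp)).elim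
  · exact (key ⟨hd, h3.symm, h2.symm, hc, hb, s6⟩ (by simp) (by simp)).elim
  · simp [ha, hb, hc, hd]

/-- The extension vertex together with three vertices of the path induces a path. -/
theorem exists_isP4_of_mem_extensionVertices (hG : IsP4Extendible G) {U : Set V}
    (hU : InducesP4 G U) {x : V} (hx : x ∈ extensionVertices G U) :
    ∃ p q r s, IsP4 G p q r s ∧ ((x = p ∧ q ∈ U ∧ r ∈ U ∧ s ∈ U) ∨
      (x = q ∧ p ∈ U ∧ r ∈ U ∧ s ∈ U)) := by
  obtain ⟨hxU, U', hU', hxU', w, hw, hw'⟩ := id hx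
  obtain ⟨p, q, r, s, h, rfl⟩ := hU'.exists_isP4
  -- A vertex of the second path outside `U` is itself an extension vertex, hence equals `x`.
  have key : ∀ y ∈ ({p, q, r, s} : Set V), y ≠ x → y ∈ U := by
    intro y hy hne
    by_contra hyU
    exact hne (hG U hU ⟨hyU, _, hU', hy, w, hw, hw'⟩ hx)
  obtain ⟨n1, n2, n3⟩ := h.ne
  rcases hxU' with rfl | rfl | rfl | rfl
  · exact ⟨x, q, r, s, h, Or.inl ⟨rfl, key q (by simp) h.ab.ne', key r (by simp) n1.symm,
      key s (by simp) n2.symm⟩⟩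
  · exact ⟨p, x, r, s, h, Or.inr ⟨rfl, key p (by simp) h.ab.ne, key r (by simp) h.bc.ne',
      key s (by simp) n3.symm⟩⟩
  · exact ⟨s, x, q, p, h.symm, Or.inr ⟨rfl, key s (by simp) h.cd.ne', key q (by simp) h.bc.ne,
      key p (by simp) n1⟩⟩
  · exact ⟨x, r, q, p, h.symm, Or.inl ⟨rfl, key r (by simp) h.cd.ne, key q (by simp) n3,
      key p (by simp) n2⟩⟩

/-- If `v` is joined to the path but not to `m`, an induced path through `v`, `m` and two path
vertices makes `v` an extension vertex. Together with `IsP4.not_adj_hull`, the hull is a homogeneous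
set. -/
theorem IsP4.adj_hull (hG : IsP4Extendible G) (h : IsP4 G a b c d) {v : V}
    (hv : v ∉ hull G a b c d) (hva : G.Adj v a) : ∀ m ∈ hull G a b c d, G.Adj v m := by
  obtain ⟨-, hvb, hvc, hvd⟩ : G.Adj v a ∧ G.Adj v b ∧ G.Adj v c ∧ G.Adj v d := by
    rcases h.total_or_null hv with h' | h'
    · exact h'
    · exact absurd hva h'.1
  have hvW : ∀ w ∈ ({a, b, c, d} : Set V), G.Adj v w := by
    rintro w (rfl | rfl | rfl | rfl) <;> assumption
  have hvU : v ∉ ({a, b, c, d} : Set V) := fun h' => hv (Or.inl h')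
  have hvE : v ∉ extensionVertices G {a, b, c, d} := fun h' => hv (Or.inr (Or.inl h'))
  rintro m (hm | hm | ⟨hma, hmb, hmc, hmd⟩)
  · exact hvW m hm
  · by_contra hvm
    obtain ⟨p, q, r, s, h', ⟨rfl, hq, hr, hs⟩ | ⟨rfl, hp, hr, hs⟩⟩ :=
      exists_isP4_of_mem_extensionVertices hG h.inducesP4 hm
    · exact hvE (IsP4.mem_extensionVertices (G := G) (a := m) (b := q) (c := v) (d := s)
        ⟨h'.ab, (hvW q hq).symm, hvW s hs, fun h => hvm h.symm, h'.ad, h'.bd⟩ hvU (by simp)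
        (w := q) (by simp) hq)
    · exact hvE (IsP4.mem_extensionVertices (G := G) (a := m) (b := p) (c := v) (d := s)
        ⟨h'.ab.symm, (hvW p hp).symm, hvW s hs, fun h => hvm h.symm, h'.bd, h'.ad⟩ hvU (by simp)
        (w := p) (by simp) hp)
  · by_contra hvm
    exact hvE (IsP4.mem_extensionVertices (G := G) (a := m) (b := b) (c := v) (d := d)
      ⟨hmb, hvb.symm, hvd, fun h => hvm h.symm, hmd, h.bd⟩ hvU (by simp) (w := b) (by simp)
      (by simp))

theorem IsP4.not_adj_hull (hG : IsP4Extendible G) (h : IsP4 G a b c d) {v : V}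
    (hv : v ∉ hull G a b c d) (hva : ¬ G.Adj v a) : ∀ m ∈ hull G a b c d, ¬ G.Adj v m := by
  obtain ⟨-, hvb, hvc, hvd⟩ : ¬ G.Adj v a ∧ ¬ G.Adj v b ∧ ¬ G.Adj v c ∧ ¬ G.Adj v d := by
    rcases h.total_or_null hv with h' | h'
    · exact absurd h'.1 hva
    · exact h'
  have hvW : ∀ w ∈ ({a, b, c, d} : Set V), ¬ G.Adj v w := by
    rintro w (rfl | rfl | rfl | rfl) <;> assumption
  have hvU : v ∉ ({a, b, c, d} : Set V) := fun h' => hv (Or.inl h')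
  have hvE : v ∉ extensionVertices G {a, b, c, d} := fun h' => hv (Or.inr (Or.inl h'))
  rintro m (hm | hm | ⟨hma, hmb, hmc, hmd⟩) hvm
  · exact hvW m hm hvm
  · obtain ⟨p, q, r, s, h', ⟨rfl, hq, hr, hs⟩ | ⟨rfl, hp, hr, hs⟩⟩ :=
      exists_isP4_of_mem_extensionVertices hG h.inducesP4 hm
    · exact hvE (IsP4.mem_extensionVertices (G := G) (a := v) (b := m) (c := q) (d := r)
        ⟨hvm, h'.ab, h'.bc, hvW q hq, hvW r hr, h'.ac⟩ hvU (by simp) (w := q) (by simp) hq)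
    · exact hvE (IsP4.mem_extensionVertices (G := G) (a := v) (b := m) (c := r) (d := s)
        ⟨hvm, h'.bc, h'.cd, hvW r hr, hvW s hs, h'.bd⟩ hvU (by simp) (w := r) (by simp) hr)
  · exact hvE (IsP4.mem_extensionVertices (G := G) (a := v) (b := m) (c := b) (d := a)
      ⟨hvm, hmb, h.ab.symm, hvb, hva, hma⟩ hvU (by simp) (w := b) (by simp) (by simp))

/-- The vertices of a homogeneous set with at least three elements are not in an induced `P₄`
with three outer vertices. -/
theorem IsP4Extendible.false_of_module (hG : IsP4Extendible G) {M : Set V} {x y z : V}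
    (hx : x ∈ M) (hy : y ∈ M) (hz : z ∈ M) (hxy : x ≠ y) (hxz : x ≠ z) (hyz : y ≠ z)
    {p q r : V} (hp : p ∉ M) (hq : q ∉ M) (hr : r ∉ M)
    (h : (∀ m ∈ M, IsP4 G m p q r) ∨ ∀ m ∈ M, IsP4 G p q m r) : False := by
  have key : ∀ m ∈ M, m ≠ x → m ∉ ({x, p, q, r} : Set V) := by
    rintro m hm hmx (rfl | rfl | rfl | rfl)
    exacts [hmx rfl, hp hm, hq hm, hr hm]
  have hU : InducesP4 G {x, p, q, r} := by
    rcases h with h | h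
    · exact (h x hx).inducesP4
    · have := (h x hx).inducesP4
      rwa [show ({p, q, x, r} : Set V) = {x, p, q, r} by ext; simp; tauto] at this
  have hE : ∀ m ∈ M, m ≠ x → m ∈ extensionVertices G {x, p, q, r} := by
    intro m hm hmx
    rcases h with h | h
    · exact (h m hm).mem_extensionVertices (key m hm hmx) (by simp) (w := p) (by simp) (by simp)
    · exact (h m hm).mem_extensionVertices (key m hm hmx) (by simp) (w := p) (by simp) (by simp)
  exact hyz (hG _ hU (hE y hy hxy.symm) (hE z hz hxz.symm))

/-- In a `P₄`-extendible graph which is connected and has a connected complement, the hull of some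
induced `P₄` consists of all vertices. -/
theorem IsP4Extendible.exists_hull_eq_univ [Finite V] [Nontrivial V] (hG : IsP4Extendible G)
    (h1 : G.Preconnected) (h2 : Gᶜ.Preconnected) :
    ∃ a b c d, IsP4 G a b c d ∧ hull G a b c d = Set.univ := by
  classical
  have := Fintype.ofFinite V
  obtain ⟨a₀, b₀, c₀, d₀, h₀⟩ := exists_isP4 h1 h2
  -- The path is chosen with largest hull. If the hull is proper, it is a homogeneous set, and the
  -- other vertices split into those complete (`T`) and those anticomplete (`N`) to it.
  obtain ⟨⟨a, b, c, d⟩, hW, hmax⟩ := (Finset.univ.filter fun x : V × V × V × V =>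
    IsP4 G x.1 x.2.1 x.2.2.1 x.2.2.2).exists_max_image
    (fun x => (hull G x.1 x.2.1 x.2.2.1 x.2.2.2).ncard) ⟨(a₀, b₀, c₀, d₀), by simpa using h₀⟩
  simp only [Finset.mem_filter, Finset.mem_univ, true_and, Prod.forall] at hW hmax
  refine ⟨a, b, c, d, hW, ?_⟩
  by_contra hne
  set M := hull G a b c d with hM
  obtain ⟨v, hv⟩ := (Set.ne_univ_iff_exists_notMem M).1 hne
  have haM : a ∈ M := Or.inl (by simp)
  have hbM : b ∈ M := Or.inl (by simp)
  have hcM : c ∈ M := Or.inl (by simp)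
  have hmod : ∀ v ∉ M, G.Adj v a → ∀ m ∈ M, G.Adj v m := fun v hv => hW.adj_hull hG hv
  have hmod' : ∀ v ∉ M, ¬ G.Adj v a → ∀ m ∈ M, ¬ G.Adj v m := fun v hv => hW.not_adj_hull hG hv
  have hP : ∀ p ∉ M, ∀ q ∉ M, ∀ r ∉ M, ¬ ((∀ m ∈ M, IsP4 G m p q r) ∨ ∀ m ∈ M, IsP4 G p q m r) :=
    fun p hp q hq r hr h => hG.false_of_module haM hbM hcM hW.ab.ne hW.ne.1 hW.bc.ne hp hq hr h
  -- edges from outer neighbours of `M` to outer non-neighbours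
  let T : Finset V := Finset.univ.filter fun t => t ∉ M ∧ G.Adj t a
  let N : Finset V := Finset.univ.filter fun n => n ∉ M ∧ ¬ G.Adj n a
  have hT : ∀ t, t ∈ T ↔ t ∉ M ∧ G.Adj t a := fun t => by simp [T]
  have hN : ∀ t, t ∈ N ↔ t ∉ M ∧ ¬ G.Adj t a := fun t => by simp [N]
  -- Otherwise `m t n n'` is an induced path for every `m ∈ M`.
  have hcomp : ∀ t ∈ T, ∀ n ∈ N, ∀ n' ∈ N, G.Adj t n → G.Adj n n' → G.Adj t n' := by
    intro t ht n hn n' hn' htn hnn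
    rw [hT] at ht
    rw [hN] at hn hn'
    by_contra htn'
    exact hP t ht.1 n hn.1 n' hn'.1 (Or.inl fun m hm => ⟨(hmod t ht.1 ht.2 m hm).symm, htn, hnn,
      fun h => hmod' n hn.1 hn.2 m hm h.symm, fun h => hmod' n' hn'.1 hn'.2 m hm h.symm, htn'⟩)
  -- Otherwise `n t m t'` is an induced path for every `m ∈ M`.
  have hcocomp : ∀ t ∈ T, ∀ t' ∈ T, ∀ n ∈ N, G.Adj n t → ¬ G.Adj n t' → G.Adj t t' := by
    intro t ht t' ht' n hn hnt hnt'
    rw [hT] at ht ht'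
    rw [hN] at hn
    by_contra htt
    exact hP n hn.1 t ht.1 t' ht'.1 (Or.inr fun m hm => ⟨hnt, hmod t ht.1 ht.2 m hm,
      (hmod t' ht'.1 ht'.2 m hm).symm, hmod' n hn.1 hn.2 m hm, hnt', htt⟩)
  have hTne : T.Nonempty := by
    by_contra hTe
    rw [Finset.not_nonempty_iff_eq_empty] at hTe
    refine not_preconnected_iff.2 ⟨M, Set.subset_univ _, ⟨a, haM⟩, ⟨v, trivial, hv⟩, ?_⟩ h1
    intro x hx y _ hy hxy
    by_cases hya : G.Adj y a
    · have : y ∈ T := (hT y).2 ⟨hy, hya⟩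
      simp [hTe] at this
    · exact hmod' y hy hya x hx hxy.symm
  -- A vertex of `T` with most neighbours in `N` turns out to be complete to `N`.
  obtain ⟨t, ht, htmax⟩ := T.exists_max_image (fun t => (N.filter (G.Adj t)).card) hTne
  have htN : ∀ n ∈ N, G.Adj t n := by
    by_contra! hc
    obtain ⟨n, hn, htn⟩ := hc
    have hnn : ∀ n₁ ∈ N, G.Adj t n₁ → ∀ n₂ ∈ N, ¬ G.Adj t n₂ → ¬ G.Adj n₂ n₁ :=
      fun n₁ hn₁ h₁ n₂ hn₂ h₂ h => h₂ (hcomp t ht n₁ hn₁ n₂ hn₂ h₁ h.symm)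
    have hex : ∃ t' ∈ T, ∃ n₀ ∈ N, ¬ G.Adj t n₀ ∧ G.Adj t' n₀ := by
      by_contra! hc
      refine not_preconnected_iff.2 ⟨{x | x ∈ N ∧ ¬ G.Adj t x}, Set.subset_univ _, ⟨n, hn, htn⟩,
        ⟨a, trivial, fun h => ((hN a).1 h.1).1 haM⟩, ?_⟩ h1
      rintro x ⟨hx, htx⟩ y - hy hxy
      by_cases hyM : y ∈ M
      · exact hmod' x ((hN x).1 hx).1 ((hN x).1 hx).2 y hyM hxy
      by_cases hya : G.Adj y a
      · exact hc y ((hT y).2 ⟨hyM, hya⟩) x hx htx hxy.symm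
      · have hyN : y ∈ N := (hN y).2 ⟨hyM, hya⟩
        by_cases hty : G.Adj t y
        · exact hnn y hyN hty x hx htx hxy
        · exact hy ⟨hyN, hty⟩
    obtain ⟨t', ht', n₀, hn₀, htn₀, ht'n₀⟩ := hex
    obtain ⟨n₁, hn₁, htn₁, ht'n₁⟩ : ∃ n₁ ∈ N, G.Adj t n₁ ∧ ¬ G.Adj t' n₁ := by
      by_contra! hc
      have : N.filter (G.Adj t) ⊂ N.filter (G.Adj t') := by
        refine Finset.ssubset_iff_subset_ne.2 ⟨fun x hx => ?_, fun h => ?_⟩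
        · simp only [Finset.mem_filter] at hx ⊢
          exact ⟨hx.1, hc x hx.1 hx.2⟩
        · have : n₀ ∈ N.filter (G.Adj t) := by rw [h]; simp [hn₀, ht'n₀]
          exact htn₀ (Finset.mem_filter.1 this).2
      have h3 := Finset.card_lt_card this
      have h4 := htmax t' ht'
      omega
    have htt : G.Adj t t' := hcocomp t ht t' ht' n₁ hn₁ htn₁.symm fun h => ht'n₁ h.symm
    have hQ : IsP4 G n₁ t t' n₀ := ⟨htn₁.symm, htt, ht'n₀, fun h => ht'n₁ h.symm,
      fun h => hnn n₁ hn₁ htn₁ n₀ hn₀ htn₀ h.symm, htn₀⟩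
    rw [hT] at ht ht'
    rw [hN] at hn₁ hn₀
    -- Every vertex of `M` sees exactly the two inner vertices of this path, so its hull is larger
    -- than `M`.
    have hsub : insert t M ⊆ hull G n₁ t t' n₀ := by
      rintro m (rfl | hm)
      · exact Or.inl (by simp)
      · exact Or.inr (Or.inr ⟨fun h => hmod' n₁ hn₁.1 hn₁.2 m hm h.symm,
          (hmod t ht.1 ht.2 m hm).symm, (hmod t' ht'.1 ht'.2 m hm).symm,
          fun h => hmod' n₀ hn₀.1 hn₀.2 m hm h.symm⟩)
    have h3 := Set.ncard_le_ncard hsub (Set.toFinite _)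
    rw [Set.ncard_insert_of_notMem ht.1 (Set.toFinite _)] at h3
    have h4 := hmax n₁ t t' n₀ hQ
    omega
  -- the vertices complete to `N` are complete to all other vertices
  refine not_preconnected_iff.2 ⟨{x | x ∈ T ∧ ∀ n ∈ N, G.Adj x n}, Set.subset_univ _, ⟨t, ht, htN⟩,
    ⟨a, trivial, fun h => ((hT a).1 h.1).1 haM⟩, ?_⟩ h2
  rintro x ⟨hx, hxN⟩ y - hy hxy
  rw [compl_adj] at hxy
  refine hxy.2 ?_
  by_cases hyM : y ∈ M
  · exact hmod x ((hT x).1 hx).1 ((hT x).1 hx).2 y hyM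
  by_cases hya : G.Adj y a
  · have hyT : y ∈ T := (hT y).2 ⟨hyM, hya⟩
    have : ∃ n ∈ N, ¬ G.Adj y n := by
      by_contra! hc
      exact hy ⟨hyT, hc⟩
    obtain ⟨n, hn, hyn⟩ := this
    exact hcocomp x hx y hyT n hn (hxN n hn).symm fun h => hyn h.symm
  · exact hxN y ((hN y).2 ⟨hyM, hya⟩)

end Extendible

/-! ### No obstruction is connected with connected complement -/

section Prime

variable {G : SimpleGraph V} {a b c d x : V}

/-- `v` is adjacent to `b` and `c`, and neither to `a` nor to `d`. -/
def IsMid (G : SimpleGraph V) (a b c d v : V) : Prop :=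
  ¬ G.Adj v a ∧ G.Adj v b ∧ G.Adj v c ∧ ¬ G.Adj v d

theorem PolarOn.of_bipartition {s : ℕ} (hs : 2 ≤ s) (B Z : Set V)
    (hB : ∀ u ∈ B, ∀ v ∈ B, u ≠ v → G.Adj u v)
    (hZ : ∀ u ∉ B, ∀ v ∉ B, G.Adj u v ↔ ¬ (u ∈ Z ↔ v ∈ Z)) : PolarOn G Set.univ s := by
  refine PolarOn.of_labels Bᶜ (· ∈ Z) {True, False} (Finset.card_le_two.trans hs) ?_ ?_ ?_
  · intro u _ _
    by_cases h : u ∈ Z <;> simp [h]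
  · intro u _ hu v _ hv
    rw [hZ u hu v hv, Ne, eq_iff_iff]
  · intro u _ hu v _ hv
    exact hB u (by simpa using hu) v (by simpa using hv)

/-- If two non-adjacent vertices without neighbours in `R` are added to `R`, and the resulting graph
is `(s, 1)`-polar, then `R` is split. -/
theorem PolarOn.exists_split {s : ℕ} {R : Set V} (had : Apart G a d)
    (ha : ∀ r ∈ R, Apart G r a) (hd : ∀ r ∈ R, Apart G r d)
    (h : PolarOn G (insert a (insert d R)) s) :
    ∃ K : Set V, (∀ x ∈ R, x ∈ K → ∀ y ∈ R, y ∈ K → x ≠ y → G.Adj x y) ∧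
      ∀ x ∈ R, x ∉ K → ∀ y ∈ R, y ∉ K → ¬ G.Adj x y := by
  obtain ⟨A, ⟨f, -, hf⟩, hB⟩ := h
  refine ⟨Aᶜ, fun x hx hxA y hy hyA => hB x (by simp [hx]) hxA y (by simp [hy]) hyA, ?_⟩
  intro x hx hxA y hy hyA
  simp only [Set.mem_compl_iff, not_not] at hxA hyA
  -- A vertex `e` of the multipartite side missed by `x` and `y` puts all three in one part. As `a`
  -- and `d` are not adjacent, one of them is available.
  have key : ∀ e ∈ insert a (insert d R), e ∈ A → Apart G x e → Apart G y e → ¬ G.Adj x y := by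
    intro e he heA hxe hye
    have h1 := hf x (by simp [hx]) hxA e he heA
    have h2 := hf y (by simp [hy]) hyA e he heA
    rw [hf x (by simp [hx]) hxA y (by simp [hy]) hyA]
    unfold Apart at *
    grind
  by_cases haA : a ∈ A
  · exact key a (by simp) haA (ha x hx) (ha y hy)
  by_cases hdA : d ∈ A
  · exact key d (by simp) hdA (hd x hx) (hd y hy)
  · exact absurd (hB a (by simp) haA d (by simp) hdA had.1) had.2

/-- The whole graph is split: the extension vertex behaves like an end of the path and joins the
independent side. -/
theorem IsP4.polarOn_of_endpoints {s : ℕ} (hs : 2 ≤ s) (h : IsP4 G a b c d) (E : Set V)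
    (hE : E.Subsingleton) (hV : ∀ v, v = a ∨ v = b ∨ v = c ∨ v = d ∨ v ∈ E ∨ IsMid G a b c d v)
    (hEa : ∀ v ∈ E, ¬ G.Adj v a ∧ ¬ G.Adj v d ∧ ∀ r, IsMid G a b c d r → ¬ G.Adj v r)
    {K : Set V} (hK : ∀ x, IsMid G a b c d x → x ∈ K → ∀ y, IsMid G a b c d y → y ∈ K → x ≠ y →
      G.Adj x y)
    (hK' : ∀ x, IsMid G a b c d x → x ∉ K → ∀ y, IsMid G a b c d y → y ∉ K → ¬ G.Adj x y) :
    PolarOn G Set.univ s := by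
  obtain ⟨h1, h2, h3, h4, h5, h6⟩ := h
  refine PolarOn.of_split (by omega) {v | v = b ∨ v = c ∨ (IsMid G a b c d v ∧ v ∈ K)} ?_ ?_
  · rintro u - (rfl | rfl | ⟨hu, huK⟩) v - (rfl | rfl | ⟨hv, hvK⟩) huv
    · exact absurd rfl huv
    · exact h2
    · exact hv.2.1.symm
    · exact h2.symm
    · exact absurd rfl huv
    · exact hv.2.2.1.symm
    · exact hu.2.1
    · exact hu.2.2.1
    · exact hK u hu huK v hv hvK huv
  · have key : ∀ v, ¬ (v = b ∨ v = c ∨ (IsMid G a b c d v ∧ v ∈ K)) →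
        v = a ∨ v = d ∨ v ∈ E ∨ (IsMid G a b c d v ∧ v ∉ K) := by
      intro v hv
      have := hV v
      tauto
    intro u _ hu v _ hv huv
    have e1 := fun hu hv => huv.ne (hE (x := u) hu (y := v) hv)
    have hu' := key u hu
    have hv' := key v hv
    clear hu hv
    rcases hu' with rfl | rfl | hu | ⟨hu, huK⟩ <;>
      rcases hv' with rfl | rfl | hv | ⟨hv, hvK⟩
    · exact huv.ne rfl
    · exact h5 huv
    · exact (hEa v hv).1 huv.symm
    · exact hv.1 huv.symm
    · exact h5 huv.symm
    · exact huv.ne rfl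
    · exact (hEa v hv).2.1 huv.symm
    · exact hv.2.2.2 huv.symm
    · exact (hEa u hu).1 huv
    · exact (hEa u hu).2.1 huv
    · exact e1 hu hv
    · exact (hEa u hu).2.2 v hv huv
    · exact hu.1 huv
    · exact hu.2.2.2 huv
    · exact (hEa v hv).2.2 u hu huv.symm
    · exact hK' u hu huK v hv hvK huv

/-- The whole graph is split: `x` behaves like an inner vertex of the path and joins the clique. -/
theorem IsP4.polarOn_of_midpoint {s : ℕ} (hs : 2 ≤ s) (h : IsP4 G a b c d)
    (hV : ∀ v, v = a ∨ v = b ∨ v = c ∨ v = d ∨ v = x ∨ IsMid G a b c d v)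
    (hxb : G.Adj x b) (hxc : G.Adj x c) (hx : ∀ r, IsMid G a b c d r → G.Adj x r)
    {K : Set V} (hK : ∀ x, IsMid G a b c d x → x ∈ K → ∀ y, IsMid G a b c d y → y ∈ K → x ≠ y →
      G.Adj x y)
    (hK' : ∀ x, IsMid G a b c d x → x ∉ K → ∀ y, IsMid G a b c d y → y ∉ K → ¬ G.Adj x y) :
    PolarOn G Set.univ s := by
  obtain ⟨h1, h2, h3, h4, h5, h6⟩ := h
  refine PolarOn.of_split (by omega) {v | v = b ∨ v = c ∨ v = x ∨ (IsMid G a b c d v ∧ v ∈ K)} ?_ ?_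
  · rintro u - (rfl | rfl | rfl | ⟨hu, huK⟩) v - (rfl | rfl | rfl | ⟨hv, hvK⟩) huv
    · exact absurd rfl huv
    · exact h2
    · exact hxb.symm
    · exact hv.2.1.symm
    · exact h2.symm
    · exact absurd rfl huv
    · exact hxc.symm
    · exact hv.2.2.1.symm
    · exact hxb
    · exact hxc
    · exact absurd rfl huv
    · exact hx v hv
    · exact hu.2.1
    · exact hu.2.2.1
    · exact (hx u hu).symm
    · exact hK u hu huK v hv hvK huv
  · have key : ∀ v, ¬ (v = b ∨ v = c ∨ v = x ∨ (IsMid G a b c d v ∧ v ∈ K)) →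
        v = a ∨ v = d ∨ (IsMid G a b c d v ∧ v ∉ K) := by
      intro v hv
      have := hV v
      tauto
    intro u _ hu v _ hv huv
    rcases key u hu with rfl | rfl | ⟨hu, huK⟩ <;>
      rcases key v hv with rfl | rfl | ⟨hv, hvK⟩
    · exact huv.ne rfl
    · exact h5 huv
    · exact hv.1 huv.symm
    · exact h5 huv.symm
    · exact huv.ne rfl
    · exact hv.2.2.2 huv.symm
    · exact hu.1 huv
    · exact hu.2.2.2 huv
    · exact hK' u hu huK v hv hvK huv

/-- The vertices of a path `a b c d`, a vertex `x` and an independent set of vertices adjacent to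
`b` and `c` only: the cases where `x` is adjacent to `a` and `b` and not to `c`, and possibly
to `d`. -/
theorem IsP4.polarOn_of_adj_ab {s : ℕ} (hs : 2 ≤ s) (h : IsP4 G a b c d)
    (hV : ∀ v, v = a ∨ v = b ∨ v = c ∨ v = d ∨ v = x ∨ IsMid G a b c d v)
    (hxa : G.Adj x a) (hxb : G.Adj x b)
    (hR : ∀ r, IsMid G a b c d r → ∀ r', IsMid G a b c d r' → ¬ G.Adj r r') :
    PolarOn G Set.univ s := by
  obtain ⟨h1, h2, h3, h4, h5, h6⟩ := h
  -- Outside the triangle remains a star with centre `c`.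
  refine PolarOn.of_bipartition hs {a, b, x} {c} ?_ ?_
  · rintro u (rfl | rfl | rfl) v (rfl | rfl | rfl) huv <;>
      first | exact absurd rfl huv | assumption | (apply SimpleGraph.Adj.symm; assumption)
  · have key : ∀ v ∉ ({a, b, x} : Set V), v = c ∨ v = d ∨ IsMid G a b c d v := by
      intro v hv
      have := hV v
      simp only [Set.mem_insert_iff, Set.mem_singleton_iff] at hv
      tauto
    have hRne : ∀ v, IsMid G a b c d v → v ≠ c := by
      rintro v hv rfl
      exact G.irrefl hv.2.2.1
    intro u hu v hv
    simp only [Set.mem_singleton_iff]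
    rcases key u hu with rfl | rfl | hu' <;> rcases key v hv with rfl | rfl | hv'
    · simp
    · simp [h3, h3.ne']
    · simp [hRne v hv', hv'.2.2.1.symm]
    · simp [h3.symm, h3.ne']
    · simp
    · have : ¬ G.Adj u v := fun h => hv'.2.2.2 h.symm
      simp [hRne v hv', h3.ne', this]
    · simp [hRne u hu', hu'.2.2.1]
    · simp [hRne u hu', h3.ne', hu'.2.2.2]
    · simp [hRne u hu', hRne v hv', hR u hu' v hv']

/-- The case where `x` is adjacent to `b` and `d`, not to `a` and `c`, and adjacent to an
independent set of vertices adjacent to `b` and `c` only. -/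
theorem IsP4.polarOn_of_adj_bd {s : ℕ} (hs : 2 ≤ s) (h : IsP4 G a b c d)
    (hV : ∀ v, v = a ∨ v = b ∨ v = c ∨ v = d ∨ v = x ∨ IsMid G a b c d v)
    (hxc : ¬ G.Adj x c) (hxd : G.Adj x d) (hxR : ∀ r, IsMid G a b c d r → G.Adj x r)
    (hR : ∀ r, IsMid G a b c d r → ∀ r', IsMid G a b c d r' → ¬ G.Adj r r') :
    PolarOn G Set.univ s := by
  obtain ⟨h1, h2, h3, h4, h5, h6⟩ := h
  -- Outside the edge `ab`, the vertices `c` and `x` are joined to `d` and to all middle vertices.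
  refine PolarOn.of_bipartition hs {a, b} {c, x} ?_ ?_
  · rintro u (rfl | rfl) v (rfl | rfl) huv <;>
      first | exact absurd rfl huv | assumption | (apply SimpleGraph.Adj.symm; assumption)
  · have key : ∀ v ∉ ({a, b} : Set V), (v = c ∨ v = x) ∨ (v = d ∨ IsMid G a b c d v) := by
      intro v hv
      have := hV v
      simp only [Set.mem_insert_iff, Set.mem_singleton_iff] at hv
      tauto
    have h1' : ∀ v, (v = d ∨ IsMid G a b c d v) → G.Adj v c ∧ G.Adj v x := by
      rintro v (rfl | hv)
      exacts [⟨h3.symm, hxd.symm⟩, ⟨hv.2.2.1, (hxR v hv).symm⟩]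
    have h2' : ∀ v, (v = d ∨ IsMid G a b c d v) → v ≠ c ∧ v ≠ x := fun v hv =>
      ⟨(h1' v hv).1.ne, (h1' v hv).2.ne⟩
    intro u hu v hv
    simp only [Set.mem_insert_iff, Set.mem_singleton_iff]
    rcases key u hu with hu' | hu' <;> rcases key v hv with hv' | hv'
    · have : ¬ G.Adj u v := by
        rcases hu' with rfl | rfl <;> rcases hv' with rfl | rfl
        exacts [G.irrefl, fun h => hxc h.symm, hxc, G.irrefl]
      simp [hu', hv', this]
    · have : G.Adj u v := by
        rcases hu' with rfl | rfl
        exacts [(h1' v hv').1.symm, (h1' v hv').2.symm]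
      simp [hu', h2' v hv', this]
    · have : G.Adj u v := by
        rcases hv' with rfl | rfl
        exacts [(h1' u hu').1, (h1' u hu').2]
      simp [hv', h2' u hu', this]
    · have : ¬ G.Adj u v := by
        rcases hu' with rfl | hu' <;> rcases hv' with rfl | hv'
        exacts [G.irrefl, fun h => hv'.2.2.2 h.symm, hu'.2.2.2, hR u hu' v hv']
      simp [h2' u hu', h2' v hv', this]

theorem IsMid.symm {v : V} (h : IsMid G a b c d v) : IsMid G d c b a v :=
  ⟨h.2.2.2, h.2.2.1, h.2.1, h.1⟩

theorem isMid_symm_iff {v : V} : IsMid G d c b a v ↔ IsMid G a b c d v := ⟨.symm, .symm⟩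

/-- The middle vertices are independent if `x` is adjacent to `a` and to no middle vertex. -/
theorem IsP4.mid_independent_of_adj (h : IsP4 G a b c d)
    (e1 : ¬ Nonempty (K 1 ⊕g (K 2 ⊕g K 2) ↪g G))
    (hxa : G.Adj x a) (hxd : Apart G x d) (hxR : ∀ r, IsMid G a b c d r → ¬ G.Adj x r) :
    ∀ r, IsMid G a b c d r → ∀ r', IsMid G a b c d r' → ¬ G.Adj r r' := by
  intro r hr r' hr' hrr
  have hrd : ∀ r, IsMid G a b c d r → Apart G d r := fun r hr =>
    ⟨by rintro rfl; exact h.bd hr.2.1.symm, fun h => hr.2.2.2 h.symm⟩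
  exact e1 (embedding_K1_twoK2 (x := d) ⟨hxa, hrr, hxR r hr, hxR r' hr', fun h => hr.1 h.symm,
    fun h => hr'.1 h.symm⟩ ⟨hxd.1.symm, fun h => hxd.2 h.symm⟩
    ⟨h.ne.2.1.symm, fun h' => h.ad h'.symm⟩ (hrd r hr) (hrd r' hr'))

/-- The middle vertices are independent if `x` is adjacent to `b`, `d` and all middle vertices, and
not to `a` and `c`. -/
theorem IsP4.mid_independent_of_adj_bd (h : IsP4 G a b c d)
    (e4 : ¬ Nonempty (K 1 ⊕g (pathGraph 3 ⊕g K 2)ᶜ ↪g G))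
    (hxa : Apart G x a) (hxc : Apart G x c) (hxd : G.Adj x d)
    (hxR : ∀ r, IsMid G a b c d r → G.Adj x r) :
    ∀ r, IsMid G a b c d r → ∀ r', IsMid G a b c d r' → ¬ G.Adj r r' := by
  intro r hr r' hr' hrr
  have hra : ∀ r, IsMid G a b c d r → Apart G a r := fun r hr =>
    ⟨by rintro rfl; exact h.ac hr.2.2.1, fun h => hr.1 h.symm⟩
  have hrd : ∀ r, IsMid G a b c d r → Apart G r d := fun r hr =>
    ⟨by rintro rfl; exact h.bd hr.2.1.symm, hr.2.2.2⟩
  refine e4 (embedding_K1_compl_P3_K2 (a := c) (b := r) (c := x) (d := d) (x := r') (y := a)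
    ⟨hr.2.2.1.symm, (hxR r hr).symm, hxd, h.cd.symm, fun h => hxc.2 h.symm, hr.2.2.2, hxc.1.symm,
      (hrd r hr).1⟩ ?_ hr'.2.2.1 hrr.symm (hxR r' hr').symm (hrd r' hr'))
  rintro z (rfl | rfl | rfl | rfl | rfl)
  · exact ⟨h.ne.1, h.ac⟩
  · exact hra _ hr
  · exact ⟨hxa.1.symm, fun h => hxa.2 h.symm⟩
  · exact ⟨h.ne.2.1, h.ad⟩
  · exact hra _ hr'

theorem IsP4Extendible.polarOn_of_hull_eq_univ {s : ℕ} (hs : 2 ≤ s) (hG : IsP4Extendible G)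
    (hmin : ∀ v, PolarOn G {v}ᶜ s) (e1 : ¬ Nonempty (K 1 ⊕g (K 2 ⊕g K 2) ↪g G))
    (e4 : ¬ Nonempty (K 1 ⊕g (pathGraph 3 ⊕g K 2)ᶜ ↪g G))
    (h : IsP4 G a b c d) (hV : hull G a b c d = Set.univ) : PolarOn G Set.univ s := by
  obtain ⟨n1, n2, n3⟩ := h.ne
  have hV' : ∀ v, v ∈ ({a, b, c, d} : Set V) ∨ v ∈ extensionVertices G {a, b, c, d} ∨
      IsMid G a b c d v := fun v => by
    have : v ∈ hull G a b c d := by simp [hV]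
    exact this
  -- The graph without `b` is polar and contains `a`, `d` and all middle vertices, so the middle
  -- vertices induce a split graph.
  obtain ⟨K, hK, hK'⟩ := PolarOn.exists_split (a := a) (d := d) (R := {v | IsMid G a b c d v})
    ⟨n2, h.ad⟩ (fun r hr => ⟨by rintro rfl; exact h.ac hr.2.2.1, hr.1⟩)
    (fun r hr => ⟨by rintro rfl; exact h.bd hr.2.1.symm, hr.2.2.2⟩)
    ((hmin b).mono (by
      rintro v (rfl | rfl | hv) rfl
      exacts [h.ab.ne rfl, n3 rfl, G.irrefl hv.2.1]) le_rfl)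
  by_cases hE : ∃ x, x ∈ extensionVertices G {a, b, c, d} ∧ ¬ IsMid G a b c d x
  swap
  · push Not at hE
    refine h.polarOn_of_endpoints hs ∅ Set.subsingleton_empty (fun v => ?_) (by simp) hK hK'
    rcases hV' v with (rfl | rfl | rfl | rfl) | hv | hv
    · simp
    · simp
    · simp
    · simp
    · simp [hE v hv]
    · simp [hv]
  obtain ⟨x, hxE, hxM⟩ := hE
  have hV : ∀ v, v = a ∨ v = b ∨ v = c ∨ v = d ∨ v = x ∨ IsMid G a b c d v := by
    intro v
    rcases hV' v with (rfl | rfl | rfl | rfl) | hv | hv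
    · simp
    · simp
    · simp
    · simp
    · simp [hG _ h.inducesP4 hv hxE]
    · simp [hv]
  have hVs : ∀ v, v = d ∨ v = c ∨ v = b ∨ v = a ∨ v = x ∨ IsMid G d c b a v := by
    intro v
    have := hV v
    rw [isMid_symm_iff]
    tauto
  have hxW : x ≠ a ∧ x ≠ b ∧ x ≠ c ∧ x ≠ d := by
    have := hxE.1
    simpa using this
  obtain ⟨na, nb, nc, nd⟩ := hxW
  -- no induced path through a middle vertex meets the path
  have key : ∀ {r}, IsMid G a b c d r → ∀ {p q s t}, IsP4 G p q s t →
      (r = p ∨ r = q ∨ r = s ∨ r = t) →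
      ((a = p ∨ a = q ∨ a = s ∨ a = t) ∨ (d = p ∨ d = q ∨ d = s ∨ d = t)) → False := by
    intro r hr p q s t h' hrp hw
    have hrW : r ∉ ({a, b, c, d} : Set V) := by
      rintro (rfl | rfl | rfl | rfl)
      exacts [h.ac hr.2.2.1, G.irrefl hr.2.1, G.irrefl hr.2.2.1, h.bd hr.2.1.symm]
    have : r ∈ extensionVertices G {a, b, c, d} := by
      rcases hw with hw | hw
      · exact h'.mem_extensionVertices hrW hrp hw (by simp)
      · exact h'.mem_extensionVertices hrW hrp hw (by simp)
    exact hxM (hG _ h.inducesP4 this hxE ▸ hr)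
  obtain ⟨h1, h2, h3, h4, h5, h6⟩ := id h
  have s4 : ¬ G.Adj c a := fun h => h4 h.symm
  have s5 : ¬ G.Adj d a := fun h => h5 h.symm
  have s6 : ¬ G.Adj d b := fun h => h6 h.symm
  have hEnd : ¬ G.Adj x a → ¬ G.Adj x d → (∀ r, IsMid G a b c d r → ¬ G.Adj x r) →
      PolarOn G Set.univ s := fun ha hd hr =>
    h.polarOn_of_endpoints hs {x} Set.subsingleton_singleton hV
      (by rintro v rfl; exact ⟨ha, hd, hr⟩) hK hK'
  have hMid : G.Adj x b → G.Adj x c → (∀ r, IsMid G a b c d r → G.Adj x r) →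
      PolarOn G Set.univ s := fun hb hc hr => h.polarOn_of_midpoint hs hV hb hc hr hK hK'
  -- Since `x` is the only extension vertex, `key` lets the adjacencies of `x` to the path dictate
  -- those to all middle vertices. Contradictory demands mean that there are no middle vertices.
  have k1 : G.Adj x a → G.Adj x c → ∀ r, IsMid G a b c d r → G.Adj x r := by
    intro ha hc r hr
    by_contra hxr
    exact key hr ⟨ha.symm, hc, hr.2.2.1.symm, h4, fun h => hr.1 h.symm, hxr⟩ (by simp) (by simp)
  have k2 : G.Adj x b → G.Adj x d → ∀ r, IsMid G a b c d r → G.Adj x r := by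
    intro hb hd r hr
    by_contra hxr
    exact key hr ⟨hd.symm, hb, hr.2.1.symm, s6, fun h => hr.2.2.2 h.symm, hxr⟩ (by simp) (by simp)
  have k3 : G.Adj x a → ¬ G.Adj x c → ∀ r, IsMid G a b c d r → ¬ G.Adj x r := by
    intro ha hc r hr hxr
    exact key hr ⟨ha.symm, hxr, hr.2.2.1, fun h => hr.1 h.symm, h4, hc⟩ (by simp) (by simp)
  have k4 : G.Adj x a → ¬ G.Adj x b → ∀ r, IsMid G a b c d r → G.Adj x r := by
    intro ha hb r hr
    by_contra hxr
    exact key hr ⟨ha, h1, hr.2.1.symm, hb, hxr, fun h => hr.1 h.symm⟩ (by simp) (by simp)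
  have k5 : G.Adj x d → ¬ G.Adj x b → ∀ r, IsMid G a b c d r → ¬ G.Adj x r := by
    intro hd hb r hr hxr
    exact key hr ⟨hr.2.1.symm, hxr.symm, hd, fun h => hb h.symm, h6, hr.2.2.2⟩ (by simp) (by simp)
  have k6 : ¬ G.Adj x d → ¬ G.Adj x c → ∀ r, IsMid G a b c d r → ¬ G.Adj x r := by
    intro hd hc r hr hxr
    exact key hr ⟨h3.symm, hr.2.2.1.symm, hxr.symm, fun h => hr.2.2.2 h.symm,
      fun h => hd h.symm, fun h => hc h.symm⟩ (by simp) (by simp)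
  have k7 : ¬ G.Adj x a → ¬ G.Adj x b → ∀ r, IsMid G a b c d r → ¬ G.Adj x r := by
    intro ha hb r hr hxr
    exact key hr ⟨h1, hr.2.1.symm, hxr.symm, fun h => hr.1 h.symm,
      fun h => ha h.symm, fun h => hb h.symm⟩ (by simp) (by simp)
  have k8 : G.Adj x d → ¬ G.Adj x c → ∀ r, IsMid G a b c d r → G.Adj x r := by
    intro hd hc r hr
    by_contra hxr
    exact key hr ⟨hd, h3.symm, hr.2.2.1.symm, hc, hxr, fun h => hr.2.2.2 h.symm⟩ (by simp) (by simp)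
  by_cases ha : G.Adj x a <;> by_cases hb : G.Adj x b <;> by_cases hc : G.Adj x c <;>
    by_cases hd : G.Adj x d
  · exact hMid hb hc (k1 ha hc)
  · exact hMid hb hc (k1 ha hc)
  · exact h.polarOn_of_adj_ab hs hV ha hb fun r hr => absurd (k2 hb hd r hr) (k3 ha hc r hr)
  · exact h.polarOn_of_adj_ab hs hV ha hb (h.mid_independent_of_adj e1 ha ⟨nd, hd⟩ (k3 ha hc))
  · exact h.symm.polarOn_of_adj_ab hs hVs hd hc fun r hr =>
      absurd (k4 ha hb r hr.symm) (k5 hd hb r hr.symm)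
  · exact h.symm.polarOn_of_adj_bd hs hVs hb ha (fun r hr => k4 ha hb r hr.symm)
      (h.symm.mid_independent_of_adj_bd e4 ⟨nd, hd⟩ ⟨nb, hb⟩ ha fun r hr => k4 ha hb r hr.symm)
  · exact h.polarOn_of_adj_bd hs hV hc hd (k4 ha hb) fun r hr =>
      absurd (k4 ha hb r hr) (k3 ha hc r hr)
  · exact h.symm.polarOn_of_adj_bd hs hVs hb ha (fun r hr => k4 ha hb r hr.symm) fun r hr =>
      absurd (k4 ha hb r hr.symm) (k3 ha hc r hr.symm)
  · exact hMid hb hc (k2 hb hd)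
  · exact absurd ⟨ha, hb, hc, hd⟩ hxM
  · exact h.polarOn_of_adj_bd hs hV hc hd (k2 hb hd)
      (h.mid_independent_of_adj_bd e4 ⟨na, ha⟩ ⟨nc, hc⟩ hd (k2 hb hd))
  · exact hEnd ha hd (k6 hd hc)
  · exact h.symm.polarOn_of_adj_ab hs hVs hd hc (h.symm.mid_independent_of_adj e1 hd ⟨na, ha⟩
      fun r hr => k7 ha hb r hr.symm)
  · exact hEnd ha hd (k7 ha hb)
  · exact h.polarOn_of_adj_bd hs hV hc hd (k8 hd hc) fun r hr =>
      absurd (k8 hd hc r hr) (k7 ha hb r hr)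
  · exact hEnd ha hd (k7 ha hb)

/-- A minimal `(s, 1)`-polar obstruction is disconnected or has a disconnected complement. -/
theorem IsMinimalPolarObstruction.not_preconnected_or {s : ℕ} [Finite V] (hs : 2 ≤ s)
    (hG : IsP4Extendible G) (hmin : IsMinimalPolarObstruction G s 1) :
    ¬ G.Preconnected ∨ ¬ Gᶜ.Preconnected := by
  by_contra! hc
  have hmin' := isMinimalPolarObstruction_iff.1 hmin
  have hnt : Nontrivial V := by
    by_contra hnt
    rw [not_nontrivial_iff_subsingleton] at hnt
    exact hmin'.1 (PolarOn.of_split (by omega) Set.univ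
      (fun x _ _ y _ _ hxy => absurd (Subsingleton.elim x y) hxy) (by simp))
  obtain ⟨a, b, c, d, h, hV⟩ := hG.exists_hull_eq_univ hc.1 hc.2
  -- A copy of either excluded graph would be `G` itself, but both are disconnected.
  refine hmin'.1 (hG.polarOn_of_hull_eq_univ hs hmin'.2 ?_ ?_ h hV)
  · rintro ⟨φ⟩
    obtain ⟨e⟩ := hmin.nonempty_iso φ (not_isPolar_K1_twoK2 s)
    exact not_preconnected_sum (e.preconnected_iff.1 hc.1)
  · rintro ⟨φ⟩
    obtain ⟨e⟩ := hmin.nonempty_iso φ (not_isPolar_K1_compl_P3_K2 s)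
    exact not_preconnected_sum (e.preconnected_iff.1 hc.1)

end Prime

/-! ### Joins and additivity of the number of parts -/

section Join

variable {G : SimpleGraph V}

theorem isMinimalPolarObstruction_induce_iff {U : Set V} {s : ℕ} :
    IsMinimalPolarObstruction (G.induce U) s 1 ↔
      ¬ PolarOn G U s ∧ ∀ v ∈ U, PolarOn G (U \ {v}) s := by
  have key : ∀ U' : Set U, PolarOn (G.induce U) U' s ↔ PolarOn G ((↑) '' U') s := by
    intro U'
    rw [← isPolar_induce_iff, ← isPolar_induce_iff]
    let e : (G.induce U).induce U' ≃g G.induce (((↑) : U → V) '' U') :=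
      ⟨Equiv.Set.image _ U' Subtype.val_injective, Iff.rfl⟩
    exact ⟨fun h => h.of_embedding e.symm.toEmbedding, fun h => h.of_embedding e.toEmbedding⟩
  rw [isMinimalPolarObstruction_iff, key]
  simp only [key, Set.image_univ, Subtype.range_coe_subtype, Set.ofPred_mem_eq, Subtype.forall]
  have : ∀ (v : V) (hv : v ∈ U), ((↑) '' ({⟨v, hv⟩}ᶜ : Set U) : Set V) = U \ {v} := by
    intro v hv
    ext x
    simp only [Set.mem_image, Set.mem_compl_iff, Set.mem_singleton_iff, Subtype.exists,
      Set.mem_sdiff]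
    constructor
    · rintro ⟨y, hy, hne, rfl⟩
      exact ⟨hy, fun h => hne (Subtype.ext h)⟩
    · rintro ⟨hx, hne⟩
      exact ⟨x, hx, fun h => hne (congrArg Subtype.val h), rfl⟩
  simp only [this]

variable {ι : Type w} [Fintype ι] {c : V → ι}

/-- Vertices of different factors are adjacent, so no multipartite part meets two factors, while
cliques of different factors unite to a clique. -/
theorem polarOn_iff_of_join (hc : ∀ u v, c u ≠ c v → G.Adj u v) {U : Set V} {s : ℕ} :
    PolarOn G U s ↔ ∃ r : ι → ℕ, (∀ i, PolarOn G (U ∩ c ⁻¹' {i}) (r i)) ∧ ∑ i, r i ≤ s := by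
  classical
  constructor
  · rintro ⟨A, ⟨f, hf, hA⟩, hB⟩
    let L : ι → Finset ℕ := fun i =>
      (Finset.range s).filter fun l => ∃ u ∈ U, u ∈ A ∧ c u = i ∧ f u = l
    refine ⟨fun i => (L i).card, fun i => PolarOn.of_labels A f (L i) le_rfl ?_
      (fun u hu huA v hv hvA => hA u hu.1 huA v hv.1 hvA)
      (fun u hu huA v hv hvA => hB u hu.1 huA v hv.1 hvA), ?_⟩
    · rintro u ⟨hu, hui⟩ huA
      simp only [L, Finset.mem_filter, Finset.mem_range]
      exact ⟨hf u hu huA, u, hu, huA, hui, rfl⟩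
    · have hdisj : Set.PairwiseDisjoint ((Finset.univ : Finset ι) : Set ι) L := by
        intro i _ j _ hij
        refine Finset.disjoint_left.2 fun l hl hl' => ?_
        obtain ⟨-, u, hu, huA, rfl, rfl⟩ := Finset.mem_filter.1 hl
        obtain ⟨-, v, hv, hvA, rfl, hvl⟩ := Finset.mem_filter.1 hl'
        exact (hA u hu huA v hv hvA).1 (hc u v hij) hvl.symm
      rw [← Finset.card_biUnion hdisj]
      refine (Finset.card_le_card (t := Finset.range s) ?_).trans (Finset.card_range s).le
      exact Finset.biUnion_subset.2 fun i _ => Finset.filter_subset _ _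
  · rintro ⟨r, hr, hs⟩
    choose A hA hB using hr
    choose f hf hA using hA
    refine PolarOn.of_labels {u | u ∈ A (c u)} (fun u => (⟨c u, f (c u) u⟩ : Σ _ : ι, ℕ))
      (Finset.univ.sigma fun i => Finset.range (r i)) (by simpa using hs) ?_ ?_ ?_
    · intro u hu huA
      simpa using hf (c u) u ⟨hu, rfl⟩ huA
    · intro u hu huA v hv hvA
      simp only [Set.mem_ofPred_eq] at huA hvA
      by_cases huv : c u = c v
      · rw [hA (c u) u ⟨hu, rfl⟩ huA v ⟨hv, huv.symm⟩ (by rwa [huv]), huv]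
        simp
      · simp [hc u v huv, huv]
    · intro u hu huA v hv hvA hne
      simp only [Set.mem_ofPred_eq] at huA hvA
      by_cases huv : c u = c v
      · exact hB (c u) u ⟨hu, rfl⟩ huA v ⟨hv, huv.symm⟩ (by rwa [huv]) hne
      · exact hc u v huv

/-- The factors of a join which is a minimal polar obstruction. -/
theorem IsMinimalPolarObstruction.exists_of_join [Nontrivial ι] {s : ℕ}
    (hc : ∀ u v, c u ≠ c v → G.Adj u v) (hsurj : Function.Surjective c)
    (hG : IsMinimalPolarObstruction G s 1)
    (hfac : ∀ i a, IsMinimalPolarObstruction (G.induce (c ⁻¹' {i})) a 1 →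
      (∃ b, PolarOn G (c ⁻¹' {i}) b) → PolarOn G (c ⁻¹' {i}) (a + 1)) :
    ∃ r : ι → ℕ, (∀ i, IsMinimalPolarObstruction (G.induce (c ⁻¹' {i})) (r i) 1) ∧
      (∀ i, PolarOn G (c ⁻¹' {i}) (r i + 1)) ∧ ∑ i, (r i + 1) = s + 1 := by
  classical
  rw [isMinimalPolarObstruction_iff] at hG
  obtain ⟨hG, hmin⟩ := hG
  have hex : ∀ i, ∃ b, PolarOn G (c ⁻¹' {i}) b := by
    intro i
    obtain ⟨j, hj⟩ := exists_ne i
    obtain ⟨v, rfl⟩ := hsurj j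
    exact ⟨s, (hmin v).mono (by rintro x rfl rfl; exact hj rfl) le_rfl⟩
  -- The least number of parts for the factor `i`; it exists because deleting a vertex of another
  -- factor leaves this one intact.
  let α : ι → ℕ := fun i => Nat.find (hex i)
  have hα : ∀ i, PolarOn G (c ⁻¹' {i}) (α i) := fun i => Nat.find_spec (hex i)
  have hα' : ∀ i b, PolarOn G (c ⁻¹' {i}) b → α i ≤ b := fun i b h => Nat.find_min' (hex i) h
  have hsum : s < ∑ i, α i := by
    by_contra! hle
    exact hG ((polarOn_iff_of_join hc).2 ⟨α, by simpa using hα, hle⟩)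
  have hF : ∀ v, ∃ m, PolarOn G (c ⁻¹' {c v} \ {v}) m ∧
      m + ∑ j ∈ Finset.univ.erase (c v), α j ≤ s := by
    intro v
    obtain ⟨r, hr, hrs⟩ := (polarOn_iff_of_join hc).1 (hmin v)
    refine ⟨r (c v), (hr (c v)).mono (fun x hx => ⟨hx.2, hx.1⟩) le_rfl, le_trans ?_ hrs⟩
    rw [← Finset.add_sum_erase _ r (Finset.mem_univ (c v))]
    refine Nat.add_le_add_left (Finset.sum_le_sum fun j hj => ?_) _
    have hne := Finset.ne_of_mem_erase hj
    exact hα' j _ ((hr j).mono (by rintro x rfl; exact ⟨by rintro rfl; exact hne rfl, rfl⟩) le_rfl)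
  have hsplit : ∀ i, α i + ∑ j ∈ Finset.univ.erase i, α j = ∑ j, α j := fun i =>
    Finset.add_sum_erase _ α (Finset.mem_univ i)
  have hpos : ∀ i, 1 ≤ α i := by
    intro i
    obtain ⟨v, rfl⟩ := hsurj i
    obtain ⟨m, -, hm⟩ := hF v
    have := hsplit (c v)
    omega
  have hless : ∀ v, PolarOn G (c ⁻¹' {c v} \ {v}) (α (c v) - 1) := by
    intro v
    obtain ⟨m, hm, hm'⟩ := hF v
    have := hsplit (c v)
    exact hm.mono subset_rfl (by omega)
  refine ⟨fun i => α i - 1, fun i => ?_, fun i => ?_, ?_⟩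
  · rw [isMinimalPolarObstruction_induce_iff]
    refine ⟨fun h => ?_, ?_⟩
    · have h1 : α i ≤ α i - 1 := hα' i _ h
      have h2 := hpos i
      omega
    · rintro v rfl
      exact hless v
  · rw [Nat.sub_add_cancel (hpos i)]
    exact hα i
  · simp only [Nat.sub_add_cancel (hpos _)]
    refine le_antisymm ?_ hsum
    obtain ⟨i⟩ : Nonempty ι := inferInstance
    -- Let `a` be the least number of parts sufficient after every deletion from the factor `i`. The
    -- factor is a minimal `(a, 1)`-obstruction, so `hfac` yields `α i = a + 1`; a deletion that
    -- really needs `a` parts then bounds the total by `s + 1`.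
    have hex' : ∃ a, ∀ v, c v = i → PolarOn G (c ⁻¹' {i} \ {v}) a :=
      ⟨α i - 1, by rintro v rfl; exact hless v⟩
    have ha := Nat.find_spec hex'
    have hamin : ∀ b, (∀ v, c v = i → PolarOn G (c ⁻¹' {i} \ {v}) b) → Nat.find hex' ≤ b :=
      fun b h => Nat.find_min' hex' h
    set a := Nat.find hex'
    have haα : a + 1 ≤ α i := by
      have := hamin (α i - 1) (by rintro v rfl; exact hless v)
      have := hpos i
      omega
    have hαa : α i ≤ a + 1 := by
      refine hα' i _ (hfac i a (isMinimalPolarObstruction_induce_iff.2 ⟨fun h => ?_, ha⟩) (hex i))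
      have := hα' i a h
      omega
    have : ∃ v, c v = i ∧ ∀ m, PolarOn G (c ⁻¹' {i} \ {v}) m → a ≤ m := by
      by_contra! hcon
      rcases Nat.eq_zero_or_pos a with h0 | h0
      · obtain ⟨v, hv⟩ := hsurj i
        obtain ⟨m, -, hm⟩ := hcon v hv
        omega
      · have := hamin (a - 1) (fun v hv => by
          obtain ⟨m, hm, hma⟩ := hcon v hv
          exact hm.mono subset_rfl (by omega))
        omega
    obtain ⟨v, rfl, hv⟩ := this
    obtain ⟨m, hm, hms⟩ := hF v
    have h1 := hv m hm
    have h2 := hsplit (c v)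
    omega

/-- Each factor needs exactly `r i + 1` parts, one too many in total, and deleting a vertex saves
one in its factor. -/
theorem isMinimalPolarObstruction_of_join {s : ℕ} (hc : ∀ u v, c u ≠ c v → G.Adj u v) {r : ι → ℕ}
    (hmin : ∀ i, IsMinimalPolarObstruction (G.induce (c ⁻¹' {i})) (r i) 1)
    (hr : ∀ i, PolarOn G (c ⁻¹' {i}) (r i + 1)) (hs : ∑ i, (r i + 1) = s + 1) :
    IsMinimalPolarObstruction G s 1 := by
  classical
  simp only [isMinimalPolarObstruction_induce_iff] at hmin
  rw [isMinimalPolarObstruction_iff, polarOn_iff_of_join hc]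
  refine ⟨?_, fun v => (polarOn_iff_of_join hc).2
    ⟨fun i => if i = c v then r i else r i + 1, fun i => ?_, ?_⟩⟩
  · rintro ⟨r', hr', hs'⟩
    have : ∑ i, (r i + 1) ≤ ∑ i, r' i := Finset.sum_le_sum fun i _ => by
      by_contra! hlt
      exact (hmin i).1 ((hr' i).mono (by simp) (by omega))
    omega
  · dsimp only
    split_ifs with hi
    · subst hi
      exact ((hmin (c v)).2 v rfl).mono (fun x hx => ⟨hx.2, hx.1⟩) le_rfl
    · exact (hr i).mono Set.inter_subset_right le_rfl
  · rw [← Finset.add_sum_erase _ _ (Finset.mem_univ (c v))] at hs ⊢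
    have : ∑ i ∈ Finset.univ.erase (c v), (if i = c v then r i else r i + 1) =
        ∑ i ∈ Finset.univ.erase (c v), (r i + 1) :=
      Finset.sum_congr rfl fun i hi => if_neg (Finset.ne_of_mem_erase hi)
    rw [this, if_pos rfl]
    omega

end Join

/-! ### One more part suffices for non-essential obstructions -/

section Bound

theorem PolarOn.exists_split_of_one {G : SimpleGraph V} {U : Set V} (h : PolarOn G U 1) :
    ∃ K : Set V, (∀ x ∈ U, x ∈ K → ∀ y ∈ U, y ∈ K → x ≠ y → G.Adj x y) ∧
      ∀ x ∈ U, x ∉ K → ∀ y ∈ U, y ∉ K → ¬ G.Adj x y := by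
  obtain ⟨A, ⟨f, hf, hA⟩, hB⟩ := h
  refine ⟨Aᶜ, fun x hx hxA y hy hyA => hB x hx hxA y hy hyA, fun x hx hxA y hy hyA => ?_⟩
  simp only [Set.mem_compl_iff, not_not] at hxA hyA
  rw [hA x hx hxA y hy hyA]
  have h1 := hf x hx hxA
  have h2 := hf y hy hyA
  omega

/-- Being `(0, 1)`-polar means being complete, so the obstruction is `2K₁`, a single part. -/
theorem IsMinimalPolarObstruction.isPolar_one {G : SimpleGraph V}
    (hG : IsMinimalPolarObstruction G 0 1) : IsPolar G 1 1 := by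
  rw [isMinimalPolarObstruction_iff] at hG
  obtain ⟨hG, hmin⟩ := hG
  rw [isPolar_iff]
  have : ∃ u v, u ≠ v ∧ ¬ G.Adj u v := by
    by_contra! hc
    exact hG ⟨∅, ⟨fun _ => 0, by simp⟩, fun u _ _ v _ _ huv => hc u v huv⟩
  obtain ⟨u, v, huv, hnuv⟩ := this
  have hall : ∀ w, w = u ∨ w = v := by
    by_contra! hc
    obtain ⟨w, hwu, hwv⟩ := hc
    obtain ⟨A, ⟨f, hf, -⟩, hB⟩ := hmin w
    exact hnuv (hB u hwu.symm (fun h => absurd (hf u hwu.symm h) (by simp)) v hwv.symm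
      (fun h => absurd (hf v hwv.symm h) (by simp)) huv)
  refine PolarOn.of_split le_rfl ∅ (by simp) ?_
  intro x _ _ y _ _ hxy
  rcases hall x with rfl | rfl <;> rcases hall y with rfl | rfl
  exacts [G.irrefl hxy, hnuv hxy, hnuv hxy.symm, G.irrefl hxy]

/-- Being `(1, 1)`-polar means being split, so the obstruction is `2K₂`, `C₄` or `C₅`; removing the
ends of an edge leaves `K₂` or `P₃`, which is complete bipartite. -/
theorem IsMinimalPolarObstruction.isPolar_two [Finite V] {G : SimpleGraph V}
    (hG : IsMinimalPolarObstruction G 1 1) : IsPolar G 2 1 := by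
  rw [isMinimalPolarObstruction_iff] at hG
  obtain ⟨hG, hmin⟩ := hG
  rw [isPolar_iff]
  by_cases h1 : ∃ a b c d, IsTwoK2 G a b c d
  · obtain ⟨a, b, c, d, h1, h2, h3, h4, h5, h6⟩ := h1
    have hall : ∀ w, w = a ∨ w = b ∨ w = c ∨ w = d := by
      by_contra! hc
      obtain ⟨w, ha, hb, hc, hd⟩ := hc
      obtain ⟨K, hK, hK'⟩ := (hmin w).exists_split_of_one
      have e1 := hK' a ha.symm
      have e2 := hK' c hc.symm
      have e3 := hK a ha.symm
      have e4 := hK b hb.symm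
      have f1 := h1.ne
      have f2 := h2.ne
      by_cases haK : a ∈ K
      · by_cases hcK : c ∈ K
        · exact h3 (e3 haK c hc.symm hcK (by rintro rfl; exact h4 h2))
        · by_cases hdK : d ∈ K
          · exact h4 (e3 haK d hd.symm hdK (by rintro rfl; exact h3 h2.symm))
          · exact e2 hcK d hd.symm hdK h2
      · by_cases hbK : b ∈ K
        · by_cases hcK : c ∈ K
          · exact h5 (e4 hbK c hc.symm hcK (by rintro rfl; exact h6 h2))
          · by_cases hdK : d ∈ K
            · exact h6 (e4 hbK d hd.symm hdK (by rintro rfl; exact h5 h2.symm))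
            · exact e2 hcK d hd.symm hdK h2
        · exact e1 haK b hb.symm hbK h1
    refine PolarOn.of_bipartition le_rfl {c, d} {a} ?_ ?_
    · have := h2.symm
      rintro u (rfl | rfl) v (rfl | rfl) huv <;> first | exact absurd rfl huv | assumption
    · have hm : ∀ v ∉ ({c, d} : Set V), v = a ∨ v = b := by
        intro v hv
        have := hall v
        simp only [Set.mem_insert_iff, Set.mem_singleton_iff] at hv
        tauto
      intro u hu v hv
      rcases hm u hu with rfl | rfl <;> rcases hm v hv with rfl | rfl <;>
        simp [h1, h1.symm, h1.ne']
  by_cases h2 : ∃ a b c d, IsC4 G a b c d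
  · obtain ⟨a, b, c, d, h1, h2, h3, h4, h5, h6, h7, h8⟩ := h2
    have hall : ∀ w, w = a ∨ w = b ∨ w = c ∨ w = d := by
      by_contra! hc
      obtain ⟨w, ha, hb, hc, hd⟩ := hc
      obtain ⟨K, hK, hK'⟩ := (hmin w).exists_split_of_one
      have hac : a ∉ K ∨ c ∉ K := by
        by_contra! hcon
        exact h5 (hK a ha.symm hcon.1 c hc.symm hcon.2 h7)
      have hbd : b ∉ K ∨ d ∉ K := by
        by_contra! hcon
        exact h6 (hK b hb.symm hcon.1 d hd.symm hcon.2 h8)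
      rcases hac with h | h <;> rcases hbd with h' | h'
      · exact hK' a ha.symm h b hb.symm h' h1
      · exact hK' d hd.symm h' a ha.symm h h4
      · exact hK' b hb.symm h' c hc.symm h h2
      · exact hK' c hc.symm h d hd.symm h' h3
    refine PolarOn.of_bipartition le_rfl {a, b} {c} ?_ ?_
    · have := h1.symm
      rintro u (rfl | rfl) v (rfl | rfl) huv <;> first | exact absurd rfl huv | assumption
    · have hm : ∀ v ∉ ({a, b} : Set V), v = c ∨ v = d := by
        intro v hv
        have := hall v
        simp only [Set.mem_insert_iff, Set.mem_singleton_iff] at hv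
        tauto
      intro u hu v hv
      rcases hm u hu with rfl | rfl <;> rcases hm v hv with rfl | rfl <;>
        simp [h3, h3.symm, h3.ne']
  by_cases h3 : ∃ a b c d e, IsC5 G a b c d e
  · obtain ⟨a, b, c, d, e, h1, h2, h3, h4, h5, h6, h7, h8, h9, h10⟩ := h3
    have nac : a ≠ c := by rintro rfl; exact h9 h3.symm
    have nbd : b ≠ d := by rintro rfl; exact h10 h4.symm
    have nce : c ≠ e := by rintro rfl; exact h6 h5.symm
    have nda : d ≠ a := by rintro rfl; exact h7 h1.symm
    have neb : e ≠ b := by rintro rfl; exact h8 h2.symm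
    have hall : ∀ w, w = a ∨ w = b ∨ w = c ∨ w = d ∨ w = e := by
      by_contra! hc
      obtain ⟨w, ha, hb, hc, hd, he⟩ := hc
      obtain ⟨K, hK, hK'⟩ := (hmin w).exists_split_of_one
      have e1 : a ∈ K → c ∉ K := fun h h' => h6 (hK a ha.symm h c hc.symm h' nac)
      have e2 : b ∈ K → d ∉ K := fun h h' => h7 (hK b hb.symm h d hd.symm h' nbd)
      have e3 : c ∈ K → e ∉ K := fun h h' => h8 (hK c hc.symm h e he.symm h' nce)
      have e4 : d ∈ K → a ∉ K := fun h h' => h9 (hK d hd.symm h a ha.symm h' nda)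
      have e5 : e ∈ K → b ∉ K := fun h h' => h10 (hK e he.symm h b hb.symm h' neb)
      have d1 : a ∉ K → b ∈ K := fun h => by
        by_contra h'; exact hK' a ha.symm h b hb.symm h' h1
      have d2 : b ∉ K → c ∈ K := fun h => by
        by_contra h'; exact hK' b hb.symm h c hc.symm h' h2
      have d3 : c ∉ K → d ∈ K := fun h => by
        by_contra h'; exact hK' c hc.symm h d hd.symm h' h3
      have d4 : d ∉ K → e ∈ K := fun h => by
        by_contra h'; exact hK' d hd.symm h e he.symm h' h4
      have d5 : e ∉ K → a ∈ K := fun h => by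
        by_contra h'; exact hK' e he.symm h a ha.symm h' h5
      by_cases haK : a ∈ K
      · exact e4 (d3 (e1 haK)) haK
      · exact e3 (by_contra fun h => e2 (d1 haK) (d3 h)) (d4 (e2 (d1 haK)))
    refine PolarOn.of_bipartition le_rfl {a, b} {d} ?_ ?_
    · have := h1.symm
      rintro u (rfl | rfl) v (rfl | rfl) huv <;> first | exact absurd rfl huv | assumption
    · have hm : ∀ v ∉ ({a, b} : Set V), v = c ∨ v = d ∨ v = e := by
        intro v hv
        have := hall v
        simp only [Set.mem_insert_iff, Set.mem_singleton_iff] at hv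
        tauto
      have h8' : ¬ G.Adj e c := fun h => h8 h.symm
      intro u hu v hv
      rcases hm u hu with rfl | rfl | rfl <;> rcases hm v hv with rfl | rfl | rfl <;>
        simp [h3, h3.symm, h3.ne, h4, h4.symm, h4.ne', h8, h8']
  · push Not at h1 h2 h3
    obtain ⟨K, hK, hK'⟩ := exists_split G h1 h2 h3
    exact PolarOn.of_split (by omega) K (fun x _ hx y _ hy => hK x hx y hy)
      fun x _ hx y _ hy => hK' x hx y hy

theorem adj_of_connectedComponentMk_ne {G : SimpleGraph V} (u v : V)
    (h : Gᶜ.connectedComponentMk u ≠ Gᶜ.connectedComponentMk v) : G.Adj u v := by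
  by_contra huv
  have hne : u ≠ v := by rintro rfl; exact h rfl
  exact h (ConnectedComponent.sound (Adj.reachable (by simp [hne, huv])))

theorem nontrivial_connectedComponent {G : SimpleGraph V} (h : ¬ G.Preconnected) :
    Nontrivial G.ConnectedComponent := by
  unfold Preconnected at h
  push Not at h
  obtain ⟨u, v, huv⟩ := h
  exact ⟨_, _, fun h => huv (ConnectedComponent.exact h)⟩

/-- A minimal `(s, 1)`-polar obstruction which is not essential is `(s + 1, 1)`-polar. -/
theorem IsMinimalPolarObstruction.isPolar_succ [Finite V] {G : SimpleGraph V} {s : ℕ}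
    (hP : IsP4Extendible G) (hG : IsMinimalPolarObstruction G s 1) (hE : ¬ IsEssential G) :
    IsPolar G (s + 1) 1 := by
  induction hn : Nat.card V using Nat.strong_induction_on generalizing V s with
  | _ n ih =>
  classical
  match s, hG with
  | 0, hG => exact hG.isPolar_one
  | 1, hG => exact hG.isPolar_two
  | s + 2, hG =>
    rcases hG.not_preconnected_or (by omega) hP with h | h
    · rcases hG.isEssential_or_isSpecialDisconnected (by omega) h with h' | h'
      · exact absurd h' hE
      · exact h'.isPolar_succ (by omega)
    · have := nontrivial_connectedComponent h
      have := Fintype.ofFinite Gᶜ.ConnectedComponent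
      -- Each factor is smaller, and it is not essential because it is polar for some number of
      -- parts; so the induction hypothesis applies to it.
      obtain ⟨r, -, hr, hs⟩ := hG.exists_of_join (c := Gᶜ.connectedComponentMk)
        adj_of_connectedComponentMk_ne Quot.mk_surjective (by
          intro i a hi hb
          rw [← isPolar_induce_iff]
          refine ih _ ?_ (hP.of_embedding (Embedding.induce _)) hi (fun h => ?_) rfl
          · rw [← hn]
            obtain ⟨j, hj⟩ := exists_ne i
            obtain ⟨v, rfl⟩ := j.exists_rep
            rw [Nat.card_coe_set_eq, ← Set.ncard_univ]
            refine Set.ncard_lt_ncard ((Set.ssubset_univ_iff).2 fun h => ?_) (Set.toFinite _)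
            have : v ∈ Gᶜ.connectedComponentMk ⁻¹' {i} := by rw [h]; trivial
            exact hj this
          · obtain ⟨b, hb⟩ := hb
            exact h.not_isPolar b (isPolar_induce_iff.2 hb))
      rw [isPolar_iff, polarOn_iff_of_join (c := Gᶜ.connectedComponentMk)
        adj_of_connectedComponentMk_ne]
      exact ⟨_, by simpa using hr, hs.le⟩

theorem IsEssential.of_iso {G : SimpleGraph V} {H : SimpleGraph W} (hG : IsEssential G)
    (e : G ≃g H) : IsEssential H :=
  have key {U : Type} {X : SimpleGraph U} : Nonempty (G ≃g X) → Nonempty (H ≃g X) :=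
    fun ⟨f⟩ => ⟨e.symm.trans f⟩
  hG.imp key <| .imp key <| .imp key <| .imp key <| .imp key <| .imp key key

/-- The complement of a component of the complement is an induced subgraph. -/
def componentComplIso (G : SimpleGraph V) (C : Gᶜ.ConnectedComponent) :
    C.toSimpleGraphᶜ ≃g G.induce (Gᶜ.connectedComponentMk ⁻¹' {C}) where
  toEquiv := Equiv.subtypeEquivRight fun _ => Iff.rfl
  map_rel_iff' {x y} := by
    change G.Adj x y ↔ x ≠ y ∧ ¬ ((x : V) ≠ y ∧ ¬ G.Adj x y)
    rw [Ne, Subtype.ext_iff]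
    grind [SimpleGraph.irrefl]

theorem isMinimalPolarObstruction_component_iff {G : SimpleGraph V} {C : Gᶜ.ConnectedComponent}
    {r : ℕ} : IsMinimalPolarObstruction C.toSimpleGraph 1 r ↔
      IsMinimalPolarObstruction (G.induce (Gᶜ.connectedComponentMk ⁻¹' {C})) r 1 := by
  refine ⟨fun h => h.compl.of_iso (componentComplIso G C), fun h => ?_⟩
  have := (h.of_iso (componentComplIso G C).symm).compl
  rwa [compl_compl] at this

theorem isEssential_component_iff {G : SimpleGraph V} {C : Gᶜ.ConnectedComponent} :
    IsEssential C.toSimpleGraphᶜ ↔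
      IsEssential (G.induce (Gᶜ.connectedComponentMk ⁻¹' {C})) :=
  ⟨fun h => h.of_iso (componentComplIso G C), fun h => h.of_iso (componentComplIso G C).symm⟩

/-- The components of the complement are the complements of the join factors, and complementation
turns `(1, r)` into `(r, 1)`. -/
theorem isRecursiveJoin_iff [Finite V] {G : SimpleGraph V} (hG : IsP4Extendible G) {s : ℕ} :
    IsRecursiveJoin G s ↔ ¬ Gᶜ.Preconnected ∧ IsMinimalPolarObstruction G s 1 := by
  classical
  refine and_congr_right fun h => ?_
  have hnt := nontrivial_connectedComponent h
  have := Fintype.ofFinite Gᶜ.ConnectedComponent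
  have hext : ∀ C : Gᶜ.ConnectedComponent,
      IsP4Extendible (G.induce (Gᶜ.connectedComponentMk ⁻¹' {C})) := fun C =>
    hG.of_embedding (Embedding.induce _)
  have hsucc : ∀ (C : Gᶜ.ConnectedComponent) (r : ℕ),
      IsMinimalPolarObstruction (G.induce (Gᶜ.connectedComponentMk ⁻¹' {C})) r 1 →
      ¬ IsEssential (G.induce (Gᶜ.connectedComponentMk ⁻¹' {C})) →
      PolarOn G (Gᶜ.connectedComponentMk ⁻¹' {C}) (r + 1) := fun C r h h' =>
    isPolar_induce_iff.1 (h.isPolar_succ (hext C) h')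
  -- The natural subtraction `t - 1` is harmless because there is at least one component.
  have hsum : ∀ {t : ℕ} (C : Fin t ≃ Gᶜ.ConnectedComponent) (r : Fin t → ℕ),
      s = (t - 1) + ∑ i, r i ↔ ∑ D, (r (C.symm D) + 1) = s + 1 := by
    intro t C r
    rw [← C.sum_comp]
    simp only [Equiv.symm_apply_apply, Finset.sum_add_distrib, Finset.sum_const, Finset.card_univ,
      Fintype.card_fin, smul_eq_mul, mul_one]
    have : 0 < t := by
      obtain ⟨D⟩ : Nonempty Gᶜ.ConnectedComponent := inferInstance
      exact (Nat.zero_le _).trans_lt (C.symm D).2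
    omega
  constructor
  · rintro ⟨t, C, r, hC, hs⟩
    simp only [isMinimalPolarObstruction_component_iff, isEssential_component_iff] at hC
    have hC' : ∀ D, IsMinimalPolarObstruction (G.induce (Gᶜ.connectedComponentMk ⁻¹' {D}))
        (r (C.symm D)) 1 ∧ ¬ IsEssential (G.induce (Gᶜ.connectedComponentMk ⁻¹' {D})) := fun D => by
      obtain ⟨i, rfl⟩ := C.surjective D
      simpa using hC i
    exact isMinimalPolarObstruction_of_join adj_of_connectedComponentMk_ne (fun D => (hC' D).1)
      (fun D => hsucc D _ (hC' D).1 (hC' D).2) ((hsum C r).1 hs)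
  · intro hM
    obtain ⟨r, hr, hr', hs⟩ := hM.exists_of_join (c := Gᶜ.connectedComponentMk)
      adj_of_connectedComponentMk_ne Quot.mk_surjective (fun C a hC ⟨b, hb⟩ =>
        hsucc C a hC fun h => h.not_isPolar b (isPolar_induce_iff.2 hb))
    let C := (Fintype.equivFin Gᶜ.ConnectedComponent).symm
    refine ⟨_, C, fun i => r (C i), fun i => ⟨isMinimalPolarObstruction_component_iff.2 (hr _), ?_⟩, (hsum C _).2 (by simpa)⟩
    rw [isEssential_component_iff]
    exact fun h => h.not_isPolar _ (isPolar_induce_iff.2 (hr' (C i)))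

end Bound

end PolarGraph

/-! ### The characterisation -/

theorem mainTheorem5 {V : Type*} [Finite V] (G : SimpleGraph V) (s : ℕ) (hs : 2 ≤ s)
    (hG : PolarGraph.IsP4Extendible G) :
    PolarGraph.IsMinimalPolarObstruction G s 1 ↔
      PolarGraph.ExactlyOne
        (PolarGraph.IsEssential G)
        (PolarGraph.IsSpecialDisconnected G s)
        (PolarGraph.IsRecursiveJoin G s) := by
  rw [PolarGraph.isRecursiveJoin_iff hG]
  have hcon : ¬ G.Preconnected → Gᶜ.Preconnected := fun h => by
    by_contra h'
    rcases G.connected_or_preconnected_compl with h1 | h1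
    · exact h h1.preconnected
    · exact h' h1
  have h1 : PolarGraph.IsEssential G → Gᶜ.Preconnected := fun h => hcon h.not_preconnected
  have h2 : PolarGraph.IsSpecialDisconnected G s → Gᶜ.Preconnected :=
    fun h => hcon h.not_preconnected
  -- An essential graph is not `(s + 1, 1)`-polar, whereas the three graphs depending on `s` are.
  have h3 : PolarGraph.IsEssential G → ¬ PolarGraph.IsSpecialDisconnected G s :=
    fun h h' => h.not_isPolar _ (h'.isPolar_succ hs)
  constructor
  · intro h
    unfold PolarGraph.ExactlyOne
    rcases h.not_preconnected_or hs hG with hd | hd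
    · have := h.isEssential_or_isSpecialDisconnected hs hd
      tauto
    · tauto
  · rintro (⟨h, -, -⟩ | ⟨-, h, -⟩ | ⟨-, -, -, h⟩)
    · exact h.isMinimalPolarObstruction hs
    · exact h.isMinimalPolarObstruction hs
    · exact h
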